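/- **Language.** Concept descriptions are built from concept names and $\top,\bot$ by $\neg$, $\sqcap$, $\sqcup$, value and existential restrictions $\forall\mathcal R.C$, $\exists\mathcal R.C$, and qualified number restrictions $\exists^{\ge n}\mathcal R.C$, $\exists^{\le n}\mathcal R.C$ ($n\ge 0$), with the usual set semantics over interpretations with non-empty domain. Each role expression has the form $$\mathcal R=\bigsqcup_{i=1}^{M}\ \bigsqcap_{j=1}^{N_i}\ (R^{ij}_1\circ R^{ij}_2\circ\cdots\circ R^{ij}_m),\qquad M,N_i,m\ge 1,$$ a union of intersections of chains of role names, all chains in one role expression having the same length $m$ ($m$ may differ between role expressions). $C$ is satisfiable if $C^{\mathcal I}\ne\emptyset$ for some interpretation $\mathcal I$; $D$ subsumes $C$ if $C^{\mathcal I}\subseteq D^{\mathcal I}$ for all $\mathcal I$. **Normal form.** Negations are pushed inwards to concept names ($\neg\exists^{\le n}\mathcal R.C=\exists^{\ge n+1}\mathcal R.C$; $\neg\exists^{\ge n}\mathcal R.C=\exists^{\le n-1}\mathcal R.C$, or $\bot$ if $n=0$), and $\exists\mathcal R.C$, $\forall\mathcal R.C$ are replaced by $\exists^{\ge 1}\mathcal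 R.C$, $\exists^{\le 0}\mathcal R.\neg C$. The normal form of $\neg C$ is denoted $\sim C$. **ABoxes.** An ABox $\mathcal A$ is a finite set of assertions $C(x)$, $R(x,y)$, $x\ne y$ (the last being symmetric) about individual names. $y$ is an $\mathcal R$-successor of $x$ in $\mathcal A$ if for some $i$ and for every $j\le N_i$ there is a chain of role assertions $R^{ij}_1(x,y_2),R^{ij}_2(y_2,y_3),\dots,R^{ij}_m(y_m,y)$ in $\mathcal A$. Call a set $Y$ of $\mathcal R$-successors of $x$ *explicitly distinct for* $C$ if $C(y)\in\mathcal A$ for all $y\in Y$ and $y\neq y'$ is in $\mathcal A$ for all different $y,y'\in Y$. $\mathcal A$ contains a clash if it contains $\bot(x)$, or $A(x)$ and $\neg A(x)$ for a concept name $A$, or $(\exists^{\le n}\mathcal R.C)(x)$ where $x$ has an explicitly distinct set for $C$ of more than $n$ $\mathcal R$-successors. **Completion rules.** - $\sqcap$: if $(C_1\sqcap C_2)(x)\in\mathcal A$ and $\{C_1(x),C_2(x)\}\not\subseteq\mathcal A$, add $C_1(x),C_2(x)$. - $\sqcup$: if $(C_1\sqcup C_2)(x)\in\mathcal A$ and $\{C_1(x),C_2(x)\}\cap\mathcal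 A=\emptyset$, add $C_1(x)$ or $C_2(x)$. - $\ge'$: if $(\exists^{\ge n}\mathcal R.C)(x)\in\mathcal A$ and a largest explicitly distinct set $Y$ of $\mathcal R$-successors of $x$ for $C$ has $p<n$ elements, choose $\hat\imath_1,\dots,\hat\imath_{n-p}\in\{1,\dots,M\}$ and fresh individuals $z_i$ ($1\le i\le n-p$) and $z^{j}_{ik}$ ($2\le k\le m$, $1\le j\le N_{\hat\imath_i}$), all different; add $C(z_i)$ and $R^{\hat\imath_i j}_1(x,z^j_{i2}),\dots,R^{\hat\imath_i j}_m(z^j_{im},z_i)$ for all $i,j$, $z_i\ne z_{i'}$ for $i<i'$, and $y\ne z_i$ for $y\in Y$. - $\le'$: if $(\exists^{\le n}\mathcal R.C)(x)\in\mathcal A$ and $x$ has $p>n$ $\mathcal R$-successors $y_1,\dots,y_p$ with all $C(y_i)\in\mathcal A$ and with $y_i\ne y_j$ not in $\mathcal A$ for some $i<j$, choose such a pair $i<j$ and replace $y_i$ by $y_j$ everywhere in $\mathcal A$. - choose$'$: if $(\exists^{\ge n}\mathcal R.C)(x)\in\mathcal A$ or $(\exists^{\le n}\mathcal R.C)(x)\in\mathcal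 A$ and $y$ is an $\mathcal R$-successor of $x$ with $\{C(y),\sim C(y)\}\cap\mathcal A=\emptyset$, add $C(y)$ or $\sim C(y)$. $\mathcal A$ is complete if no rule is applicable. The algorithm, on input $C_0$, starts from the ABox consisting of the normal form of $C_0$ asserted of one individual $x_0$, applies rules until the ABox is complete, and answers "satisfiable" iff a complete and clash-free ABox can be generated. **Theorem.** (1) Concept satisfiability and subsumption are decidable for this language. (2) The tableau algorithm is an effective decision procedure for them: its steps (the initial ABox; testing completeness and listing the possible results of an applicable rule; testing for a clash) are computable; for every concept $C_0$ of the language no run of the algorithm is infinite, in whatever way the rules are applied; and for every strategy of selecting, in an ABox that is not complete, the rule instance to apply, the nondeterministic choices inside the rules can be made so that a complete and clash-free ABox is generated if and only if $C_0$ is satisfiable. Consequently $D$ subsumes $C$ if and only if no complete and clash-free ABox can be generated from $C\sqcap\neg D$. -/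

import Mathlib

/-! Concept names, role names and individual names are three countably infinite sets of names,
each represented by `ℕ`. -/

universe u

namespace DL

/-- A role chain `R₁ ∘ ⋯ ∘ Rₘ`. -/
abbrev Chain := List ℕ

/-- A union of intersections of role chains,
`⊔ (i = 1 … M), ⊓ (j = 1 … Nᵢ), Rᵢⱼ₁ ∘ ⋯ ∘ Rᵢⱼₘ`, as the list of its disjuncts, each of which is
the list of its conjuncts. -/
abbrev RoleExpr := List (List Chain)

/-- All chains in the role expression have the same length `m ≥ 1`; there are `M ≥ 1` disjuncts,
each of `Nᵢ ≥ 1` conjuncts. -/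
def RoleExpr.WF (R : RoleExpr) : Prop :=
  ∃ m : ℕ, 1 ≤ m ∧ R ≠ [] ∧ ∀ K ∈ R, K ≠ [] ∧ ∀ ρ ∈ K, ρ.length = m

/-- Concept descriptions. An unqualified number restriction is a qualified one with `C = ⊤`. -/
inductive Concept : Type
  | top : Concept
  | bot : Concept
  | atom (a : ℕ) : Concept
  | neg (C : Concept) : Concept
  | and (C D : Concept) : Concept
  | or (C D : Concept) : Concept
  | all (R : RoleExpr) (C : Concept) : Concept
  | ex (R : RoleExpr) (C : Concept) : Concept
  | atLeast (n : ℕ) (R : RoleExpr) (C : Concept) : Concept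
  | atMost (n : ℕ) (R : RoleExpr) (C : Concept) : Concept
  deriving DecidableEq

namespace Concept

/-- The concept belongs to the language: every role expression in it is a disjunctive normal form
of chains of one length. (Different role expressions may have different lengths.) -/
def WF : Concept → Prop
  | top => True
  | bot => True
  | atom _ => True
  | neg C => C.WF
  | and C D => C.WF ∧ D.WF
  | or C D => C.WF ∧ D.WF
  | all R C => R.WF ∧ C.WF
  | ex R C => R.WF ∧ C.WF
  | atLeast _ R C => R.WF ∧ C.WF
  | atMost _ R C => R.WF ∧ C.WF

/-! ### Coding of concepts by natural numbers, used to speak of computability -/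

/-- The code of a concept: constructor number and arguments, through the pairing function. -/
def toNat : Concept → ℕ
  | top => 0
  | bot => 1
  | atom a => 8 * a + 2
  | neg C => 8 * C.toNat + 1 + 2
  | and C D => 8 * Nat.pair C.toNat D.toNat + 2 + 2
  | or C D => 8 * Nat.pair C.toNat D.toNat + 3 + 2
  | all R C => 8 * Nat.pair (Encodable.encode R) C.toNat + 4 + 2
  | ex R C => 8 * Nat.pair (Encodable.encode R) C.toNat + 5 + 2
  | atLeast n R C => 8 * Nat.pair n (Nat.pair (Encodable.encode R) C.toNat) + 6 + 2
  | atMost n R C => 8 * Nat.pair n (Nat.pair (Encodable.encode R) C.toNat) + 7 + 2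

/-- The concept with a given code. -/
def ofNat : ℕ → Concept
  | 0 => top
  | 1 => bot
  | n + 2 =>
    have h0 : n / 8 < n + 2 := by omega
    have h1 : (n / 8).unpair.1 < n + 2 := lt_of_le_of_lt (Nat.unpair_left_le _) h0
    have h2 : (n / 8).unpair.2 < n + 2 := lt_of_le_of_lt (Nat.unpair_right_le _) h0
    have h3 : (n / 8).unpair.2.unpair.2 < n + 2 := lt_of_le_of_lt (Nat.unpair_right_le _) h2
    match n % 8 with
    | 0 => atom (n / 8)
    | 1 => neg (ofNat (n / 8))
    | 2 => and (ofNat (n / 8).unpair.1) (ofNat (n / 8).unpair.2)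
    | 3 => or (ofNat (n / 8).unpair.1) (ofNat (n / 8).unpair.2)
    | 4 => all (Denumerable.ofNat RoleExpr (n / 8).unpair.1) (ofNat (n / 8).unpair.2)
    | 5 => ex (Denumerable.ofNat RoleExpr (n / 8).unpair.1) (ofNat (n / 8).unpair.2)
    | 6 => atLeast (n / 8).unpair.1 (Denumerable.ofNat RoleExpr (n / 8).unpair.2.unpair.1)
        (ofNat (n / 8).unpair.2.unpair.2)
    | _ => atMost (n / 8).unpair.1 (Denumerable.ofNat RoleExpr (n / 8).unpair.2.unpair.1)
        (ofNat (n / 8).unpair.2.unpair.2)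

theorem ofNat_toNat (C : Concept) : ofNat C.toNat = C := by
  have e : ∀ q r : ℕ, r < 8 → (8 * q + r) / 8 = q ∧ (8 * q + r) % 8 = r := by
    intro q r h; omega
  induction C with
  | top => simp [toNat, ofNat]
  | bot => simp [toNat, ofNat]
  | atom a => simp [toNat, ofNat]
  | neg C ih => simp [toNat, ofNat, e, ih]
  | and C D ihC ihD => simp [toNat, ofNat, e, ihC, ihD]
  | or C D ihC ihD => simp [toNat, ofNat, e, ihC, ihD]
  | all R C ih => simp [toNat, ofNat, e, ih]
  | ex R C ih => simp [toNat, ofNat, e, ih]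
  | atLeast n R C ih => simp [toNat, ofNat, e, ih]
  | atMost n R C ih => simp [toNat, ofNat, e, ih]

theorem toNat_ofNat (n : ℕ) : (ofNat n).toNat = n := by
  induction n using Nat.strong_induction_on with
  | _ n ih =>
    match n with
    | 0 => simp [ofNat, toNat]
    | 1 => simp [ofNat, toNat]
    | n + 2 =>
      have h0 : n / 8 < n + 2 := by omega
      have h1 : (n / 8).unpair.1 < n + 2 := lt_of_le_of_lt (Nat.unpair_left_le _) h0
      have h2 : (n / 8).unpair.2 < n + 2 := lt_of_le_of_lt (Nat.unpair_right_le _) h0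
      have h3 : (n / 8).unpair.2.unpair.2 < n + 2 := lt_of_le_of_lt (Nat.unpair_right_le _) h2
      have i0 := ih _ h0
      have i1 := ih _ h1
      have i2 := ih _ h2
      have i3 := ih _ h3
      have hm := Nat.div_add_mod n 8
      have hl := Nat.mod_lt n (by norm_num : 8 > 0)
      rw [ofNat]
      generalize hr : n % 8 = r at hm hl
      interval_cases r <;> simp [toNat, i0, i1, i2, i3] <;> omega

instance : Denumerable Concept :=
  Denumerable.mk' ⟨toNat, ofNat, ofNat_toNat, toNat_ofNat⟩

/-- `nnf C true` is the negation normal form of `C`, `nnf C false` that of `¬ C`, in which negation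
stands before concept names only, and in which value and existential restrictions are
written as number restrictions. -/
def nnf : Concept → Bool → Concept
  | top, true => top
  | top, false => bot
  | bot, true => bot
  | bot, false => top
  | atom a, true => atom a
  | atom a, false => neg (atom a)
  | neg C, b => C.nnf (!b)
  | and C D, true => and (C.nnf true) (D.nnf true)
  | and C D, false => or (C.nnf false) (D.nnf false)
  | or C D, true => or (C.nnf true) (D.nnf true)
  | or C D, false => and (C.nnf false) (D.nnf false)
  | all R C, true => atMost 0 R (C.nnf false)
  | all R C, false => atLeast 1 R (C.nnf false)
  | ex R C, true => atLeast 1 R (C.nnf true)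
  | ex R C, false => atMost 0 R (C.nnf true)
  | atLeast n R C, true => atLeast n R (C.nnf true)
  | atLeast 0 _ _, false => bot
  | atLeast (n + 1) R C, false => atMost n R (C.nnf true)
  | atMost n R C, true => atMost n R (C.nnf true)
  | atMost n R C, false => atLeast (n + 1) R (C.nnf true)

/-- `∼ C`, the normal form of `¬ C`. -/
def sim (C : Concept) : Concept := C.nnf false

end Concept

/-! ### Semantics -/

/-- An interpretation: a non-empty domain, with a subset for each concept name and a binary
relation for each role name. -/
structure Interpretation where
  Dom : Type u
  nonempty : Nonempty Dom
  conc : ℕ → Set Dom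
  role : ℕ → Dom → Dom → Prop

namespace Interpretation

variable (I : Interpretation.{u})

/-- The composition of the roles in a chain. -/
def chainExt : Chain → I.Dom → I.Dom → Prop
  | [], x, y => x = y
  | R :: ρ, x, y => ∃ z, I.role R x z ∧ chainExt ρ z y

/-- The union of the intersections of the chains. -/
def roleExt (R : RoleExpr) (x y : I.Dom) : Prop :=
  ∃ K ∈ R, ∀ ρ ∈ K, I.chainExt ρ x y

/-- The extension of a concept. -/
def ext : Concept → Set I.Dom
  | .top => Set.univ
  | .bot => ∅
  | .atom a => I.conc a
  | .neg C => (ext C)ᶜ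
  | .and C D => ext C ∩ ext D
  | .or C D => ext C ∪ ext D
  | .all R C => {x | ∀ y, I.roleExt R x y → y ∈ ext C}
  | .ex R C => {x | ∃ y, I.roleExt R x y ∧ y ∈ ext C}
  | .atLeast n R C => {x | (n : ℕ∞) ≤ {y | I.roleExt R x y ∧ y ∈ ext C}.encard}
  | .atMost n R C => {x | {y | I.roleExt R x y ∧ y ∈ ext C}.encard ≤ (n : ℕ∞)}

end Interpretation

/-- Some interpretation gives `C` a non-empty extension. -/
def Satisfiable (C : Concept) : Prop :=
  ∃ I : Interpretation.{u}, (I.ext C).Nonempty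

/-- `D` subsumes `C`. -/
def Subsumes (D C : Concept) : Prop :=
  ∀ I : Interpretation.{u}, I.ext C ⊆ I.ext D

/-! ### ABoxes -/

/-- Concept assertions `C(x)`, role assertions `R(x, y)` and inequality assertions `x ≠ y`. -/
inductive Assertion : Type
  | conc (C : Concept) (x : ℕ) : Assertion
  | role (R x y : ℕ) : Assertion
  | diff (x y : ℕ) : Assertion
  deriving DecidableEq

namespace Assertion

/-- Assertions as a disjoint union, used to code them by natural numbers. -/
def equivSum : Assertion ≃ (Concept × ℕ) ⊕ (ℕ × ℕ × ℕ) ⊕ (ℕ × ℕ) where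
  toFun
    | conc C x => Sum.inl (C, x)
    | role R x y => Sum.inr (Sum.inl (R, x, y))
    | diff x y => Sum.inr (Sum.inr (x, y))
  invFun
    | Sum.inl (C, x) => conc C x
    | Sum.inr (Sum.inl (R, x, y)) => role R x y
    | Sum.inr (Sum.inr (x, y)) => diff x y
  left_inv a := by cases a <;> rfl
  right_inv s := by rcases s with ⟨C, x⟩ | ⟨R, x, y⟩ | ⟨x, y⟩ <;> rfl

instance : Primcodable Assertion := Primcodable.ofEquiv _ equivSum

/-- The individual names that occur in an assertion. -/
def names : Assertion → Finset ℕ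
  | conc _ x => {x}
  | role _ x y => {x, y}
  | diff x y => {x, y}

/-- Renaming of the individuals. -/
def rename (f : ℕ → ℕ) : Assertion → Assertion
  | conc C x => conc C (f x)
  | role R x y => role R (f x) (f y)
  | diff x y => diff (f x) (f y)

end Assertion

/-- An ABox is a finite set of assertions. -/
abbrev ABox := Finset Assertion

namespace ABox

/-- The individual names that occur in an ABox. -/
def names (A : ABox) : Finset ℕ := A.biUnion Assertion.names

/-- `x ≠ y` is in the ABox; inequality assertions are symmetric. -/
def Diff (A : ABox) (x y : ℕ) : Prop :=
  Assertion.diff x y ∈ A ∨ Assertion.diff y x ∈ A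

/-- `[y / y'] A`: each occurrence of `y` is replaced by `y'`. -/
def subst (A : ABox) (y y' : ℕ) : ABox :=
  A.image (Assertion.rename fun v => if v = y then y' else v)

/-- `y` is a `ρ`-successor of `x` in `A`, for a role chain `ρ`. -/
def ChainSucc (A : ABox) : Chain → ℕ → ℕ → Prop
  | [], x, y => x = y
  | R :: ρ, x, y => ∃ z, Assertion.role R x z ∈ A ∧ ChainSucc A ρ z y

/-- `y` is an `R`-successor of `x` in `A`: for one of the disjuncts, `y` is reached from `x` through
all the chains of that disjunct. -/
def Succ (A : ABox) (R : RoleExpr) (x y : ℕ) : Prop :=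
  ∃ K ∈ R, ∀ ρ ∈ K, A.ChainSucc ρ x y

/-- `Y` is a set of `R`-successors `y` of `x` with `C(y)` in `A`, and `A` has `y ≠ y'` for all
distinct `y, y'` in `Y`. -/
def DistinctSuccs (A : ABox) (R : RoleExpr) (C : Concept) (x : ℕ) (Y : Finset ℕ) : Prop :=
  (∀ y ∈ Y, A.Succ R x y ∧ Assertion.conc C y ∈ A) ∧
    ∀ y ∈ Y, ∀ y' ∈ Y, y ≠ y' → A.Diff y y'

/-- A clash: `⊥(x)`, or `A(x)` and `¬ A(x)` for a concept name `A`, or an at-most restriction at `x`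
that more than `n` explicitly distinct successors violate. -/
def Clash (A : ABox) : Prop :=
  (∃ x, Assertion.conc .bot x ∈ A) ∨
  (∃ a x, Assertion.conc (.atom a) x ∈ A ∧ Assertion.conc (.neg (.atom a)) x ∈ A) ∨
  ∃ n R C x Y, Assertion.conc (.atMost n R C) x ∈ A ∧ A.DistinctSuccs R C x Y ∧ n < Y.card

/-- The assertions `R₁(x, w₀), R₂(w₀, w₁), …, Rₘ(wₘ₋₂, z)`. -/
def path : Chain → ℕ → (ℕ → ℕ) → ℕ → List Assertion
  | [], _, _, _ => []
  | [R], x, _, z => [Assertion.role R x z]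
  | R :: R' :: ρ, x, w, z =>
    Assertion.role R x (w 0) :: path (R' :: ρ) (w 0) (fun k => w (k + 1)) z

/-- The result of the rule for at-least restrictions, which adds `q` new successors of `x`:
`K i` is the disjunct chosen for the `i`-th of them, `fresh (i, 0, 0)` is its name `zᵢ`, and
`fresh (i, j + 1, k)` is the `k`-th inner individual on the `j`-th chain from `x` to `zᵢ`. -/
def addSuccs (A : ABox) (C : Concept) (x : ℕ) (Y : Finset ℕ) (q : ℕ)
    (K : Fin q → List Chain) (fresh : ℕ × ℕ × ℕ → ℕ) : ABox :=
  A ∪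
  (Finset.univ.biUnion fun i : Fin q => Finset.univ.biUnion fun j : Fin (K i).length =>
    (path ((K i).get j) x (fun k => fresh (i, j + 1, k)) (fresh (i, 0, 0))).toFinset) ∪
  (Finset.univ.image fun i : Fin q => Assertion.conc C (fresh (i, 0, 0))) ∪
  (((Finset.univ : Finset (Fin q × Fin q)).filter fun p => p.1 < p.2).image fun p =>
    Assertion.diff (fresh (p.1, 0, 0)) (fresh (p.2, 0, 0))) ∪
  ((Y ×ˢ (Finset.univ : Finset (Fin q))).image fun p =>
    Assertion.diff p.1 (fresh (p.2, 0, 0)))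

/-- The completion rules. `Rule A S` says that some instance of a rule is applicable to `A`, and
that `S` is the set of its possible results (one for each nondeterministic choice). -/
inductive Rule (A : ABox) : Set ABox → Prop
  | and (C D : Concept) (x : ℕ) (h : Assertion.conc (.and C D) x ∈ A)
      (h' : ¬ (Assertion.conc C x ∈ A ∧ Assertion.conc D x ∈ A)) :
      Rule A {A ∪ {Assertion.conc C x, Assertion.conc D x}}
  | or (C D : Concept) (x : ℕ) (h : Assertion.conc (.or C D) x ∈ A)
      (hC : Assertion.conc C x ∉ A) (hD : Assertion.conc D x ∉ A) :
      Rule A {A ∪ {Assertion.conc C x}, A ∪ {Assertion.conc D x}}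
  /-- `Y = {y₁, …, yₚ}` is a largest set of explicitly distinct successors, and `p < n`. -/
  | atLeast (n : ℕ) (R : RoleExpr) (C : Concept) (x : ℕ)
      (h : Assertion.conc (.atLeast n R C) x ∈ A)
      (Y : Finset ℕ) (hY : A.DistinctSuccs R C x Y)
      (hmax : ∀ Y', A.DistinctSuccs R C x Y' → Y'.card ≤ Y.card) (hlt : Y.card < n)
      (fresh : ℕ × ℕ × ℕ → ℕ) (hinj : Function.Injective fresh)
      (hfresh : ∀ t, fresh t ∉ A.names) :
      Rule A {B | ∃ K : Fin (n - Y.card) → List Chain,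
        (∀ i, K i ∈ R) ∧ B = A.addSuccs C x Y (n - Y.card) K fresh}
  | atMost (n : ℕ) (R : RoleExpr) (C : Concept) (x : ℕ)
      (h : Assertion.conc (.atMost n R C) x ∈ A)
      (p : ℕ) (hp : n < p) (y : Fin p → ℕ) (hinj : Function.Injective y)
      (hy : ∀ i, A.Succ R x (y i) ∧ Assertion.conc C (y i) ∈ A)
      (hpair : ∃ i j, i < j ∧ ¬ A.Diff (y i) (y j)) :
      Rule A {B | ∃ i j, i < j ∧ ¬ A.Diff (y i) (y j) ∧ B = A.subst (y i) (y j)}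
  | choose (n : ℕ) (R : RoleExpr) (C : Concept) (x y : ℕ)
      (h : Assertion.conc (.atLeast n R C) x ∈ A ∨ Assertion.conc (.atMost n R C) x ∈ A)
      (hy : A.Succ R x y)
      (hC : Assertion.conc C y ∉ A) (hC' : Assertion.conc C.sim y ∉ A) :
      Rule A {A ∪ {Assertion.conc C y}, A ∪ {Assertion.conc C.sim y}}

/-- `B` is obtained from `A` by the application of a completion rule. -/
def Step (A B : ABox) : Prop := ∃ S, Rule A S ∧ B ∈ S

/-- No completion rule is applicable. -/
def Complete (A : ABox) : Prop := ∀ S, ¬ Rule A S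

end ABox

/-! ### The tableau algorithm -/

/-- The algorithm starts from the normal form of the concept, asserted of one individual. -/
def initial (C : Concept) : ABox := {Assertion.conc (C.nnf true) 0}

/-- However the rules are applied, no run of the algorithm on `C` is infinite. -/
def Terminates (C : Concept) : Prop :=
  ¬ ∃ A : ℕ → ABox, A 0 = initial C ∧ ∀ k, ABox.Step (A k) (A (k + 1))

/-- A strategy picks, for every ABox that is not complete, an applicable instance of a rule; it is
given by the set of the possible results of that instance. -/
def IsStrategy (σ : ABox → Set ABox) : Prop :=
  ∀ A : ABox, ¬ A.Complete → A.Rule (σ A)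

/-- Under the strategy `σ` the nondeterministic algorithm can generate, from the initial ABox of `C`,
a complete and clash-free ABox, that is, it answers that `C` is satisfiable. -/
def Accepts (σ : ABox → Set ABox) (C : Concept) : Prop :=
  ∃ B : ABox, Relation.ReflTransGen (fun A A' : ABox => ¬ A.Complete ∧ A' ∈ σ A) (initial C) B ∧
    B.Complete ∧ ¬ B.Clash

/-- The steps of the algorithm can be carried out effectively, on ABoxes given as lists of
assertions: the initial ABox is computable; a computable function finds out whether
an ABox (with concepts of the language) is complete and, if it is not, lists the possible results of
an applicable instance of a rule; and it is decidable whether an ABox has a clash. -/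
def EffectiveSteps : Prop :=
  (∃ init : Concept → List Assertion, Computable init ∧
    ∀ C, (init C).toFinset = initial C) ∧
  (∃ next : List Assertion → Option (List (List Assertion)), Computable next ∧
    ∀ L : List Assertion, (∀ C x, Assertion.conc C x ∈ L → C.WF) →
      (next L = none ↔ ABox.Complete L.toFinset) ∧
      ∀ Bs, next L = some Bs → ABox.Rule L.toFinset {B | ∃ l ∈ Bs, l.toFinset = B}) ∧
  ComputablePred fun L : List Assertion => ABox.Clash L.toFinset

end DL

/-!
The tableau algorithm is correct for three reasons.

*Termination.* All the chains of a role expression have the same length, so individuals can be put on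
levels such that role assertions lead from one level to the next: the successors of an individual
that the rule for at-most restrictions may identify lie on one level (`ABox.Layered.succ`). A concept
asserted at level `l` has role depth at most `D - l`, where `D` is the depth of the input, and it
belongs to the finite set of subconcepts of the input and their negations. At each individual only
finitely many things remain to be done: asserting these concepts, and fulfilling at-least
restrictions. What has been done stays done, as identification never merges individuals that are
explicitly different (`ABox.DistinctSuccs.subst`). Every rule either does one of these things without
new individuals, or removes an individual, or fulfils an at-least restriction at the price of
boundedly many individuals on deeper levels. Hence the sum over the individuals of one plus the number
of things to be done there, weighted by a power of a large base that decreases with the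
level, drops in every step (`ABox.Layered.step`).

*Correctness.* If an ABox has a model, then so has some result of every applicable rule instance
(`ABox.Rule.exists_holds`), and it has no clash. Conversely, a complete and clash-free ABox is true
in the interpretation whose elements are its individuals (`ABox.ext_canonical`): the choice rule and
the rule for at-most restrictions make sure that no restriction is violated by successors about which
the ABox says nothing. With termination, this holds under every strategy
(`satisfiable_iff_accepts`).

*Effectiveness.* On lists of assertions all the steps are primitive recursive. Closure properties of
primitive recursive functions are made available to `fun_prop`, recursion on concepts is
course-of-values recursion on their codes (`Concept.primrec_of_table`), and the rules are described
by list operations. To decide satisfiability, all the results of the rules found in this way are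
followed in parallel until all ABoxes are complete (`satisfiable_iff_frontier`); the number of
rounds is found by unbounded search, which succeeds by termination.
-/

namespace DL

/-! ### Primitive recursive functions -/

/-! Conditions are stated as functions with values in `Bool`, and functions of several arguments as
functions of a tuple, so that `fun_prop` proves that compositions are primitive recursive. -/

attribute [fun_prop] Primrec
attribute [fun_prop] Primrec.id Primrec.const Primrec.comp Primrec.pair Primrec.fst Primrec.snd

namespace Prim

variable {α β γ σ : Type*} [Primcodable α] [Primcodable β] [Primcodable γ] [Primcodable σ]

@[fun_prop]
theorem add {f g : α → ℕ} (hf : Primrec f) (hg : Primrec g) : Primrec fun a => f a + g a :=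
  Primrec.nat_add.comp hf hg

@[fun_prop]
theorem sub {f g : α → ℕ} (hf : Primrec f) (hg : Primrec g) : Primrec fun a => f a - g a :=
  Primrec.nat_sub.comp hf hg

@[fun_prop]
theorem mul {f g : α → ℕ} (hf : Primrec f) (hg : Primrec g) : Primrec fun a => f a * g a :=
  Primrec.nat_mul.comp hf hg

@[fun_prop]
theorem div {f g : α → ℕ} (hf : Primrec f) (hg : Primrec g) : Primrec fun a => f a / g a :=
  Primrec.nat_div.comp hf hg

@[fun_prop]
theorem mod {f g : α → ℕ} (hf : Primrec f) (hg : Primrec g) : Primrec fun a => f a % g a :=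
  Primrec.nat_mod.comp hf hg

@[fun_prop]
theorem max {f g : α → ℕ} (hf : Primrec f) (hg : Primrec g) : Primrec fun a => max (f a) (g a) :=
  Primrec.nat_max.comp hf hg

@[fun_prop]
theorem natPair {f g : α → ℕ} (hf : Primrec f) (hg : Primrec g) :
    Primrec fun a => Nat.pair (f a) (g a) :=
  Primrec₂.natPair.comp hf hg

@[fun_prop]
theorem unpair {f : α → ℕ} (hf : Primrec f) : Primrec fun a => (f a).unpair :=
  Primrec.unpair.comp hf

@[fun_prop]
theorem encode {f : α → β} (hf : Primrec f) : Primrec fun a => Encodable.encode (f a) :=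
  Primrec.encode.comp hf

@[fun_prop]
theorem lt {f g : α → ℕ} (hf : Primrec f) (hg : Primrec g) :
    Primrec fun a => decide (f a < g a) :=
  Primrec.nat_lt.decide.comp hf hg

@[fun_prop]
theorem eq [DecidableEq β] {f g : α → β} (hf : Primrec f) (hg : Primrec g) :
    Primrec fun a => decide (f a = g a) :=
  Primrec.eq.decide.comp hf hg

@[fun_prop]
theorem cond {c : α → Bool} {f g : α → β} (hc : Primrec c) (hf : Primrec f) (hg : Primrec g) :
    Primrec fun a => bif c a then f a else g a :=
  Primrec.cond hc hf hg

@[fun_prop]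
theorem and {f g : α → Bool} (hf : Primrec f) (hg : Primrec g) : Primrec fun a => f a && g a :=
  Primrec.and.comp hf hg

@[fun_prop]
theorem or {f g : α → Bool} (hf : Primrec f) (hg : Primrec g) : Primrec fun a => f a || g a :=
  Primrec.or.comp hf hg

@[fun_prop]
theorem not {f : α → Bool} (hf : Primrec f) : Primrec fun a => !f a :=
  Primrec.not.comp hf

@[fun_prop]
theorem cons {f : α → β} {g : α → List β} (hf : Primrec f) (hg : Primrec g) :
    Primrec fun a => f a :: g a :=
  Primrec.list_cons.comp hf hg

@[fun_prop]
theorem append {f g : α → List β} (hf : Primrec f) (hg : Primrec g) :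
    Primrec fun a => f a ++ g a :=
  Primrec.list_append.comp hf hg

@[fun_prop]
theorem length {f : α → List β} (hf : Primrec f) : Primrec fun a => (f a).length :=
  Primrec.list_length.comp hf

@[fun_prop]
theorem range {f : α → ℕ} (hf : Primrec f) : Primrec fun a => List.range (f a) :=
  Primrec.list_range.comp hf

@[fun_prop]
theorem getD {f : α → List β} {g : α → ℕ} {d : β} (hf : Primrec f) (hg : Primrec g) :
    Primrec fun a => (f a).getD (g a) d :=
  (Primrec.list_getD d).comp hf hg

@[fun_prop]
theorem head? {f : α → List β} (hf : Primrec f) : Primrec fun a => (f a).head? :=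
  Primrec.list_head?.comp hf

@[fun_prop]
theorem optionGetD {f : α → Option β} {g : α → β} (hf : Primrec f) (hg : Primrec g) :
    Primrec fun a => (f a).getD (g a) :=
  Primrec.option_getD.comp hf hg

@[fun_prop]
theorem map {f : α → List β} {g : α → β → σ} (hf : Primrec f)
    (hg : Primrec fun p : α × β => g p.1 p.2) : Primrec fun a => (f a).map (g a) :=
  Primrec.list_map hf hg

@[fun_prop]
theorem flatMap {f : α → List β} {g : α → β → List σ} (hf : Primrec f)
    (hg : Primrec fun p : α × β => g p.1 p.2) : Primrec fun a => (f a).flatMap (g a) :=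
  Primrec.list_flatMap hf hg

@[fun_prop]
theorem foldr {f : α → List β} {g : α → σ} {h : α → β → σ → σ} (hf : Primrec f)
    (hg : Primrec g) (hh : Primrec fun p : α × β × σ => h p.1 p.2.1 p.2.2) :
    Primrec fun a => (f a).foldr (fun b s => h a b s) (g a) :=
  Primrec.list_foldr hf hg (h := fun a p => h a p.1 p.2) hh

@[fun_prop]
theorem foldl {f : α → List β} {g : α → σ} {h : α → σ → β → σ} (hf : Primrec f)
    (hg : Primrec g) (hh : Primrec fun p : α × σ × β => h p.1 p.2.1 p.2.2) :
    Primrec fun a => (f a).foldl (fun s b => h a s b) (g a) :=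
  Primrec.list_foldl hf hg (h := fun a p => h a p.1 p.2) hh

@[fun_prop]
theorem any {f : α → List β} {g : α → β → Bool} (hf : Primrec f)
    (hg : Primrec fun p : α × β => g p.1 p.2) : Primrec fun a => (f a).any (g a) := by
  have : Primrec fun a => (f a).foldr (fun b s => g a b || s) false := by fun_prop
  refine this.of_eq fun a => ?_
  induction f a <;> simp_all

@[fun_prop]
theorem all {f : α → List β} {g : α → β → Bool} (hf : Primrec f)
    (hg : Primrec fun p : α × β => g p.1 p.2) : Primrec fun a => (f a).all (g a) := by
  have : Primrec fun a => (f a).foldr (fun b s => g a b && s) true := by fun_prop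
  refine this.of_eq fun a => ?_
  induction f a <;> simp_all

@[fun_prop]
theorem filter {f : α → List β} {g : α → β → Bool} (hf : Primrec f)
    (hg : Primrec fun p : α × β => g p.1 p.2) : Primrec fun a => (f a).filter (g a) := by
  have : Primrec fun a => (f a).flatMap (fun b => bif g a b then [b] else []) := by fun_prop
  refine this.of_eq fun a => ?_
  induction f a with
  | nil => rfl
  | cons b l ih => cases h : g a b <;> simp [List.flatMap_cons, ih, h]

@[fun_prop]
theorem mem [DecidableEq β] {f : α → β} {g : α → List β} (hf : Primrec f) (hg : Primrec g) :
    Primrec fun a => decide (f a ∈ g a) := by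
  have : Primrec fun a => (g a).any (fun b => decide (f a = b)) := by fun_prop
  refine this.of_eq fun a => ?_
  rw [Bool.eq_iff_iff]
  simp

@[fun_prop]
theorem natRec {n : α → ℕ} {f : α → β} {g : α → ℕ → β → β} (hn : Primrec n) (hf : Primrec f)
    (hg : Primrec fun p : α × ℕ × β => g p.1 p.2.1 p.2.2) :
    Primrec fun a => Nat.rec (motive := fun _ => β) (f a) (fun k b => g a k b) (n a) :=
  Primrec.nat_rec' hn hf (h := fun a p => g a p.1 p.2) hg

end Prim

/-! ### Effective syntax of concepts -/

namespace Concept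

/-- The constructor number of a concept; `top` and `bot` have numbers 0 and 1. -/
def kind (C : Concept) : ℕ :=
  bif decide (Encodable.encode C < 2) then Encodable.encode C else (Encodable.encode C - 2) % 8 + 2

/-- The code of the arguments of the outermost constructor. -/
def arg (C : Concept) : ℕ := (Encodable.encode C - 2) / 8

theorem encode_eq (C : Concept) : Encodable.encode C = C.toNat := rfl

theorem denumerable_ofNat_eq (n : ℕ) : Denumerable.ofNat Concept n = ofNat n := rfl

theorem encode_lt_neg (C : Concept) : Encodable.encode C < Encodable.encode (neg C) := by
  simp only [encode_eq, toNat]; omega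

@[fun_prop]
theorem primrec_kind {α : Type*} [Primcodable α] {f : α → Concept} (hf : Primrec f) :
    Primrec fun a => (f a).kind := by
  unfold kind; fun_prop

@[fun_prop]
theorem primrec_arg {α : Type*} [Primcodable α] {f : α → Concept} (hf : Primrec f) :
    Primrec fun a => (f a).arg := by
  unfold arg; fun_prop

@[fun_prop]
theorem _root_.DL.Prim.ofNat {α β : Type*} [Primcodable α] [Denumerable β] {f : α → ℕ}
    (hf : Primrec f) : Primrec fun a => Denumerable.ofNat β (f a) :=
  (Primrec.ofNat β).comp hf

/-- The bound of a number restriction. -/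
def num (C : Concept) : ℕ := C.arg.unpair.1

/-- The role expression of a number restriction. -/
def rel (C : Concept) : RoleExpr := Denumerable.ofNat RoleExpr C.arg.unpair.2.unpair.1

/-- The filler of a number restriction. -/
def filler (C : Concept) : Concept := Denumerable.ofNat Concept C.arg.unpair.2.unpair.2

/-- The first argument of a conjunction or disjunction. -/
def left (C : Concept) : Concept := Denumerable.ofNat Concept C.arg.unpair.1

/-- The second argument of a conjunction or disjunction, and the filler of a value or existential
restriction. -/
def right (C : Concept) : Concept := Denumerable.ofNat Concept C.arg.unpair.2

/-- The role expression of a value or existential restriction. -/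
def qrel (C : Concept) : RoleExpr := Denumerable.ofNat RoleExpr C.arg.unpair.1

/-- The argument of a negation. -/
def inner (C : Concept) : Concept := Denumerable.ofNat Concept C.arg

section
variable {α : Type*} [Primcodable α]

@[fun_prop]
theorem primrec_num {f : α → Concept} (hf : Primrec f) : Primrec fun a => (f a).num := by
  unfold num; fun_prop

@[fun_prop]
theorem primrec_rel {f : α → Concept} (hf : Primrec f) : Primrec fun a => (f a).rel := by
  unfold rel; fun_prop

@[fun_prop]
theorem primrec_filler {f : α → Concept} (hf : Primrec f) : Primrec fun a => (f a).filler := by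
  unfold filler; fun_prop

@[fun_prop]
theorem primrec_left {f : α → Concept} (hf : Primrec f) : Primrec fun a => (f a).left := by
  unfold left; fun_prop

@[fun_prop]
theorem primrec_right {f : α → Concept} (hf : Primrec f) : Primrec fun a => (f a).right := by
  unfold right; fun_prop

@[fun_prop]
theorem primrec_qrel {f : α → Concept} (hf : Primrec f) : Primrec fun a => (f a).qrel := by
  unfold qrel; fun_prop

@[fun_prop]
theorem primrec_inner {f : α → Concept} (hf : Primrec f) : Primrec fun a => (f a).inner := by
  unfold inner; fun_prop

end

section
variable (n a : ℕ) (R : RoleExpr) (C D : Concept)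

/-! Each constructor `r + 2` is coded as `8 * q + r + 2`, where `q` codes its arguments. -/

theorem kind_of {C : Concept} {q r : ℕ} (hr : r < 8) (h : C.toNat = 8 * q + r + 2) :
    C.kind = r + 2 := by
  have : ¬ C.toNat < 2 := by omega
  simp only [kind, encode_eq, this, decide_false, cond_false]
  omega

theorem arg_of {C : Concept} {q r : ℕ} (hr : r < 8) (h : C.toNat = 8 * q + r + 2) :
    C.arg = q := by
  simp only [arg, encode_eq]
  omega

@[simp] theorem kind_top : kind top = 0 := rfl
@[simp] theorem kind_bot : kind bot = 1 := rfl
@[simp] theorem kind_atom : kind (atom a) = 2 := kind_of (q := a) (r := 0) (by decide) rfl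
@[simp] theorem kind_neg : kind (neg C) = 3 := kind_of (r := 1) (by decide) rfl
@[simp] theorem kind_and : kind (and C D) = 4 := kind_of (r := 2) (by decide) rfl
@[simp] theorem kind_or : kind (or C D) = 5 := kind_of (r := 3) (by decide) rfl
@[simp] theorem kind_all : kind (all R C) = 6 := kind_of (r := 4) (by decide) rfl
@[simp] theorem kind_ex : kind (ex R C) = 7 := kind_of (r := 5) (by decide) rfl
@[simp] theorem kind_atLeast : kind (atLeast n R C) = 8 := kind_of (r := 6) (by decide) rfl
@[simp] theorem kind_atMost : kind (atMost n R C) = 9 := kind_of (r := 7) (by decide) rfl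

theorem arg_neg : arg (neg C) = C.toNat := arg_of (r := 1) (by decide) rfl
theorem arg_and : arg (and C D) = Nat.pair C.toNat D.toNat := arg_of (r := 2) (by decide) rfl
theorem arg_or : arg (or C D) = Nat.pair C.toNat D.toNat := arg_of (r := 3) (by decide) rfl
theorem arg_all : arg (all R C) = Nat.pair (Encodable.encode R) C.toNat :=
  arg_of (r := 4) (by decide) rfl
theorem arg_ex : arg (ex R C) = Nat.pair (Encodable.encode R) C.toNat :=
  arg_of (r := 5) (by decide) rfl
theorem arg_atLeast :
    arg (atLeast n R C) = Nat.pair n (Nat.pair (Encodable.encode R) C.toNat) :=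
  arg_of (r := 6) (by decide) rfl
theorem arg_atMost :
    arg (atMost n R C) = Nat.pair n (Nat.pair (Encodable.encode R) C.toNat) :=
  arg_of (r := 7) (by decide) rfl

@[simp] theorem inner_neg : inner (neg C) = C := by
  simp [inner, arg_neg, denumerable_ofNat_eq, ofNat_toNat]
@[simp] theorem left_and : left (and C D) = C := by
  simp [left, arg_and, denumerable_ofNat_eq, ofNat_toNat]
@[simp] theorem right_and : right (and C D) = D := by
  simp [right, arg_and, denumerable_ofNat_eq, ofNat_toNat]
@[simp] theorem left_or : left (or C D) = C := by
  simp [left, arg_or, denumerable_ofNat_eq, ofNat_toNat]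
@[simp] theorem right_or : right (or C D) = D := by
  simp [right, arg_or, denumerable_ofNat_eq, ofNat_toNat]
@[simp] theorem qrel_all : qrel (all R C) = R := by
  simp [qrel, arg_all]
@[simp] theorem right_all : right (all R C) = C := by
  simp [right, arg_all, denumerable_ofNat_eq, ofNat_toNat]
@[simp] theorem qrel_ex : qrel (ex R C) = R := by
  simp [qrel, arg_ex]
@[simp] theorem right_ex : right (ex R C) = C := by
  simp [right, arg_ex, denumerable_ofNat_eq, ofNat_toNat]
@[simp] theorem num_atLeast : num (atLeast n R C) = n := by
  simp [num, arg_atLeast]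
@[simp] theorem rel_atLeast : rel (atLeast n R C) = R := by
  simp [rel, arg_atLeast]
@[simp] theorem filler_atLeast : filler (atLeast n R C) = C := by
  simp [filler, arg_atLeast, denumerable_ofNat_eq, ofNat_toNat]
@[simp] theorem num_atMost : num (atMost n R C) = n := by
  simp [num, arg_atMost]
@[simp] theorem rel_atMost : rel (atMost n R C) = R := by
  simp [rel, arg_atMost]
@[simp] theorem filler_atMost : filler (atMost n R C) = C := by
  simp [filler, arg_atMost, denumerable_ofNat_eq, ofNat_toNat]

end

section
variable {α : Type*} [Primcodable α]

@[fun_prop]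
theorem primrec_neg {f : α → Concept} (hf : Primrec f) : Primrec fun a => neg (f a) := by
  have : Primrec fun a => 8 * Encodable.encode (f a) + 1 + 2 := by fun_prop
  exact Primrec.encode_iff.1 this

@[fun_prop]
theorem primrec_and {f g : α → Concept} (hf : Primrec f) (hg : Primrec g) :
    Primrec fun a => and (f a) (g a) := by
  have : Primrec fun a =>
      8 * Nat.pair (Encodable.encode (f a)) (Encodable.encode (g a)) + 2 + 2 := by fun_prop
  exact Primrec.encode_iff.1 this

@[fun_prop]
theorem primrec_or {f g : α → Concept} (hf : Primrec f) (hg : Primrec g) :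
    Primrec fun a => or (f a) (g a) := by
  have : Primrec fun a =>
      8 * Nat.pair (Encodable.encode (f a)) (Encodable.encode (g a)) + 3 + 2 := by fun_prop
  exact Primrec.encode_iff.1 this

@[fun_prop]
theorem primrec_atLeast {n : α → ℕ} {R : α → RoleExpr} {f : α → Concept} (hn : Primrec n)
    (hR : Primrec R) (hf : Primrec f) : Primrec fun a => atLeast (n a) (R a) (f a) := by
  have : Primrec fun a => 8 * Nat.pair (n a) (Nat.pair (Encodable.encode (R a))
      (Encodable.encode (f a))) + 6 + 2 := by fun_prop
  exact Primrec.encode_iff.1 this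

@[fun_prop]
theorem primrec_atMost {n : α → ℕ} {R : α → RoleExpr} {f : α → Concept} (hn : Primrec n)
    (hR : Primrec R) (hf : Primrec f) : Primrec fun a => atMost (n a) (R a) (f a) := by
  have : Primrec fun a => 8 * Nat.pair (n a) (Nat.pair (Encodable.encode (R a))
      (Encodable.encode (f a))) + 7 + 2 := by fun_prop
  exact Primrec.encode_iff.1 this

end

/-- The list of the values of `f` at all concepts whose code is smaller than that of `C`. -/
def table {σ : Type*} (f : Concept → σ) (C : Concept) : List σ :=
  (List.range (Encodable.encode C)).map fun k => f (Denumerable.ofNat Concept k)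

/-- The entry for the concept `D` in a list indexed by the codes of concepts. -/
def lookup {σ : Type*} (l : List σ) (d : σ) (D : Concept) : σ := l.getD (Encodable.encode D) d

@[fun_prop]
theorem primrec_lookup {α σ : Type*} [Primcodable α] [Primcodable σ] {f : α → List σ} {d : σ}
    {g : α → Concept} (hf : Primrec f) (hg : Primrec g) :
    Primrec fun a => lookup (f a) d (g a) := by
  unfold lookup; fun_prop

theorem lookup_table {σ : Type*} (f : Concept → σ) (d : σ) {C D : Concept}
    (h : Encodable.encode D < Encodable.encode C) : lookup (table f C) d D = f D := by
  simp [lookup, table, List.getD_eq_getElem?_getD, List.getElem?_map, List.getElem?_range h]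

/-- Course-of-values recursion on concepts: `g` computes the value of `f` at a concept from the list
of its values at all concepts with a smaller code. -/
theorem primrec_of_table {σ : Type*} [Primcodable σ] (f : Concept → σ)
    (g : Concept → List σ → σ) (hg : Primrec fun p : Concept × List σ => g p.1 p.2)
    (H : ∀ C : Concept, g C (table f C) = f C) :
    Primrec f := by
  have h1 : Primrec₂ fun (_ : Unit) (n : ℕ) => f (Denumerable.ofNat Concept n) := by
    refine Primrec.nat_strong_rec _
      (g := fun _ l => some (g (Denumerable.ofNat Concept l.length) l)) ?_ ?_
    · refine Primrec.option_some.comp ?_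
      exact hg.comp (f := fun p : Concept × List σ => g p.1 p.2)
        (g := fun p : Unit × List σ => (Denumerable.ofNat Concept p.2.length, p.2)) (by fun_prop)
    · intro _ n
      have := H (Denumerable.ofNat Concept n)
      rw [table, Denumerable.encode_ofNat] at this
      simpa using this
  have h2 : Primrec fun C : Concept => f (Denumerable.ofNat Concept (Encodable.encode C)) :=
    h1.comp (Primrec.const ()) Primrec.encode
  simpa using h2

section
variable (n : ℕ) (R : RoleExpr) (C D : Concept)

theorem encode_lt_and_left : Encodable.encode C < Encodable.encode (and C D) := by
  have := Nat.left_le_pair C.toNat D.toNat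
  simp only [encode_eq, toNat]; omega

theorem encode_lt_and_right : Encodable.encode D < Encodable.encode (and C D) := by
  have := Nat.right_le_pair C.toNat D.toNat
  simp only [encode_eq, toNat]; omega

theorem encode_lt_or_left : Encodable.encode C < Encodable.encode (or C D) := by
  have := Nat.left_le_pair C.toNat D.toNat
  simp only [encode_eq, toNat]; omega

theorem encode_lt_or_right : Encodable.encode D < Encodable.encode (or C D) := by
  have := Nat.right_le_pair C.toNat D.toNat
  simp only [encode_eq, toNat]; omega

theorem encode_lt_all : Encodable.encode C < Encodable.encode (all R C) := by
  have := Nat.right_le_pair (Encodable.encode R) C.toNat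
  simp only [encode_eq, toNat]; omega

theorem encode_lt_ex : Encodable.encode C < Encodable.encode (ex R C) := by
  have := Nat.right_le_pair (Encodable.encode R) C.toNat
  simp only [encode_eq, toNat]; omega

theorem encode_lt_atLeast : Encodable.encode C < Encodable.encode (atLeast n R C) := by
  have := Nat.right_le_pair (Encodable.encode R) C.toNat
  have := Nat.right_le_pair n (Nat.pair (Encodable.encode R) C.toNat)
  simp only [encode_eq, toNat]; omega

theorem encode_lt_atMost : Encodable.encode C < Encodable.encode (atMost n R C) := by
  have := Nat.right_le_pair (Encodable.encode R) C.toNat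
  have := Nat.right_le_pair n (Nat.pair (Encodable.encode R) C.toNat)
  simp only [encode_eq, toNat]; omega

end

/-- One step of the recursion for the negation normal forms of a concept and of its negation. -/
def nnfStep (C : Concept) (l : List (Concept × Concept)) : Concept × Concept :=
  bif decide (C.kind = 0) then (top, bot)
  else bif decide (C.kind = 1) then (bot, top)
  else bif decide (C.kind = 2) then (C, neg C)
  else bif decide (C.kind = 3) then ((lookup l (top, top) C.inner).2, (lookup l (top, top) C.inner).1)
  else bif decide (C.kind = 4) then
    (and (lookup l (top, top) C.left).1 (lookup l (top, top) C.right).1, or (lookup l (top, top) C.left).2 (lookup l (top, top) C.right).2)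
  else bif decide (C.kind = 5) then
    (or (lookup l (top, top) C.left).1 (lookup l (top, top) C.right).1, and (lookup l (top, top) C.left).2 (lookup l (top, top) C.right).2)
  else bif decide (C.kind = 6) then
    (atMost 0 C.qrel (lookup l (top, top) C.right).2, atLeast 1 C.qrel (lookup l (top, top) C.right).2)
  else bif decide (C.kind = 7) then
    (atLeast 1 C.qrel (lookup l (top, top) C.right).1, atMost 0 C.qrel (lookup l (top, top) C.right).1)
  else bif decide (C.kind = 8) then
    (atLeast C.num C.rel (lookup l (top, top) C.filler).1,
      bif decide (C.num = 0) then bot else atMost (C.num - 1) C.rel (lookup l (top, top) C.filler).1)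
  else (atMost C.num C.rel (lookup l (top, top) C.filler).1, atLeast (C.num + 1) C.rel (lookup l (top, top) C.filler).1)

theorem primrec_nnfStep :
    Primrec fun p : Concept × List (Concept × Concept) => nnfStep p.1 p.2 := by
  unfold nnfStep
  fun_prop

theorem primrec_nnf_pair : Primrec fun C : Concept => (C.nnf true, C.nnf false) := by
  refine primrec_of_table _ nnfStep primrec_nnfStep fun C => ?_
  cases C with
  | atLeast n R C => cases n <;> simp [nnfStep, nnf, lookup_table, encode_lt_atLeast]
  | _ => simp [nnfStep, nnf, lookup_table, encode_lt_neg, encode_lt_and_left,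
    encode_lt_and_right, encode_lt_or_left, encode_lt_or_right, encode_lt_all, encode_lt_ex,
    encode_lt_atMost]

section
variable {α : Type*} [Primcodable α]

@[fun_prop]
theorem primrec_nnf_true {f : α → Concept} (hf : Primrec f) : Primrec fun a => (f a).nnf true :=
  Primrec.fst.comp (primrec_nnf_pair.comp hf)

@[fun_prop]
theorem primrec_sim {f : α → Concept} (hf : Primrec f) : Primrec fun a => (f a).sim :=
  Primrec.snd.comp (primrec_nnf_pair.comp hf)

end

end Concept

/-- The common length of the chains of a well-formed role expression. -/
def RoleExpr.len (R : RoleExpr) : ℕ := ((R.getD 0 []).getD 0 []).length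

@[fun_prop]
theorem RoleExpr.primrec_len {α : Type*} [Primcodable α] {f : α → RoleExpr} (hf : Primrec f) :
    Primrec fun a => (f a).len := by
  unfold RoleExpr.len; fun_prop

/-- Decides whether a role expression is well-formed. -/
def RoleExpr.wf (R : RoleExpr) : Bool :=
  decide (0 < R.len) && decide (0 < R.length) &&
    R.all fun K => decide (0 < K.length) && K.all fun ρ => decide (ρ.length = R.len)

@[fun_prop]
theorem RoleExpr.primrec_wf {α : Type*} [Primcodable α] {f : α → RoleExpr} (hf : Primrec f) :
    Primrec fun a => (f a).wf := by
  unfold RoleExpr.wf; fun_prop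

theorem RoleExpr.WF.length_eq {R : RoleExpr} (h : R.WF) {K : List Chain} (hK : K ∈ R) {ρ : Chain}
    (hρ : ρ ∈ K) : ρ.length = R.len := by
  obtain ⟨m, -, hR, hm⟩ := h
  have : R.len = m := by
    cases R with
    | nil => simp at hR
    | cons K₀ R =>
      have h0 := hm K₀ (by simp)
      cases K₀ with
      | nil => simp at h0
      | cons ρ₀ K₀ => exact h0.2 ρ₀ (by simp)
  rw [this]
  exact (hm K hK).2 ρ hρ

theorem RoleExpr.WF.ne_nil {R : RoleExpr} (h : R.WF) {K : List Chain} (hK : K ∈ R) : K ≠ [] := by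
  obtain ⟨m, -, hR, hm⟩ := h
  exact (hm K hK).1

theorem RoleExpr.WF.len_pos {R : RoleExpr} (h : R.WF) : 0 < R.len := by
  have h' := h
  obtain ⟨m, h1, hR, hm⟩ := h'
  obtain ⟨K, hK⟩ := List.exists_mem_of_ne_nil _ hR
  obtain ⟨ρ, hρ⟩ := List.exists_mem_of_ne_nil _ (hm K hK).1
  rw [← h.length_eq hK hρ, (hm K hK).2 ρ hρ]
  exact h1

theorem RoleExpr.wf_iff (R : RoleExpr) : R.wf = true ↔ R.WF := by
  constructor
  · intro h
    simp only [RoleExpr.wf, Bool.and_eq_true, decide_eq_true_eq, List.all_eq_true] at h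
    exact ⟨R.len, h.1.1, List.ne_nil_of_length_pos h.1.2, fun K hK =>
      ⟨List.ne_nil_of_length_pos (h.2 K hK).1, (h.2 K hK).2⟩⟩
  · intro h
    simp only [RoleExpr.wf, Bool.and_eq_true, decide_eq_true_eq, List.all_eq_true]
    refine ⟨⟨h.len_pos, List.length_pos_of_ne_nil ?_⟩, fun K hK =>
      ⟨List.length_pos_of_ne_nil (h.ne_nil hK), fun ρ hρ => h.length_eq hK hρ⟩⟩
    obtain ⟨m, -, hR, -⟩ := h
    exact hR

namespace Concept

/-- One step of the recursion that decides whether a concept is well-formed. -/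
def wfStep (C : Concept) (l : List Bool) : Bool :=
  bif decide (C.kind < 3) then true
  else bif decide (C.kind = 3) then lookup l true C.inner
  else bif decide (C.kind < 6) then lookup l true C.left && lookup l true C.right
  else bif decide (C.kind < 8) then C.qrel.wf && lookup l true C.right
  else C.rel.wf && lookup l true C.filler

/-- Decides whether a concept is well-formed. -/
def wf : Concept → Bool
  | top => true
  | bot => true
  | atom _ => true
  | neg C => C.wf
  | and C D => C.wf && D.wf
  | or C D => C.wf && D.wf
  | all R C => R.wf && C.wf
  | ex R C => R.wf && C.wf
  | atLeast _ R C => R.wf && C.wf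
  | atMost _ R C => R.wf && C.wf

theorem wf_iff (C : Concept) : C.wf = true ↔ C.WF := by
  induction C <;> simp_all [wf, WF, RoleExpr.wf_iff]

theorem primrec_wf : Primrec wf := by
  have h : Primrec fun p : Concept × List Bool => wfStep p.1 p.2 := by
    unfold wfStep; fun_prop
  refine primrec_of_table _ wfStep h fun C => ?_
  cases C <;> simp [wfStep, wf, lookup_table, encode_lt_neg, encode_lt_and_left,
    encode_lt_and_right, encode_lt_or_left, encode_lt_or_right, encode_lt_all, encode_lt_ex,
    encode_lt_atMost, encode_lt_atLeast]

end Concept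

/-! ### Effective syntax of assertions -/

namespace Assertion

/-- The constructor number of an assertion with its arguments; absent arguments are replaced by
default values. -/
def fields : Assertion → ℕ × Concept × ℕ × ℕ × ℕ
  | conc C x => (0, C, 0, x, 0)
  | role R x y => (1, .top, R, x, y)
  | diff x y => (2, .top, 0, x, y)

theorem primrec_fields : Primrec fields := by
  have h : Primrec fun s : (Concept × ℕ) ⊕ (ℕ × ℕ × ℕ) ⊕ (ℕ × ℕ) =>
      Sum.casesOn (motive := fun _ => ℕ × Concept × ℕ × ℕ × ℕ) s (fun p => (0, p.1, 0, p.2, 0))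
        fun t => Sum.casesOn (motive := fun _ => ℕ × Concept × ℕ × ℕ × ℕ) t
          (fun p => (1, .top, p.1, p.2.1, p.2.2)) fun p => (2, .top, 0, p.1, p.2) := by
    refine Primrec.sumCasesOn Primrec.id ?_ (Primrec.sumCasesOn Primrec.snd ?_ ?_)
    · exact (by fun_prop : Primrec fun q : ((Concept × ℕ) ⊕ (ℕ × ℕ × ℕ) ⊕ (ℕ × ℕ)) × (Concept × ℕ) =>
        (0, q.2.1, 0, q.2.2, 0))
    · exact (by fun_prop : Primrec fun q : (((Concept × ℕ) ⊕ (ℕ × ℕ × ℕ) ⊕ (ℕ × ℕ)) ×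
        ((ℕ × ℕ × ℕ) ⊕ (ℕ × ℕ))) × (ℕ × ℕ × ℕ) => (1, Concept.top, q.2.1, q.2.2.1, q.2.2.2))
    · exact (by fun_prop : Primrec fun q : (((Concept × ℕ) ⊕ (ℕ × ℕ × ℕ) ⊕ (ℕ × ℕ)) ×
        ((ℕ × ℕ × ℕ) ⊕ (ℕ × ℕ))) × (ℕ × ℕ) => (2, Concept.top, 0, q.2.1, q.2.2))
  exact (h.comp (Primrec.of_equiv (e := equivSum))).of_eq fun a => by cases a <;> rfl

/-- The constructor number of an assertion. -/
def tag (a : Assertion) : ℕ := a.fields.1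

/-- The concept that is asserted. -/
def concept (a : Assertion) : Concept := a.fields.2.1

/-- The role name that is asserted. -/
def roleName (a : Assertion) : ℕ := a.fields.2.2.1

/-- The first individual of an assertion. -/
def src (a : Assertion) : ℕ := a.fields.2.2.2.1

/-- The second individual of an assertion. -/
def tgt (a : Assertion) : ℕ := a.fields.2.2.2.2

section
variable (C : Concept) (R x y : ℕ)

@[simp] theorem tag_conc : tag (conc C x) = 0 := rfl
@[simp] theorem tag_role : tag (role R x y) = 1 := rfl
@[simp] theorem tag_diff : tag (diff x y) = 2 := rfl
@[simp] theorem concept_conc : concept (conc C x) = C := rfl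
@[simp] theorem roleName_role : roleName (role R x y) = R := rfl
@[simp] theorem src_conc : src (conc C x) = x := rfl
@[simp] theorem src_role : src (role R x y) = x := rfl
@[simp] theorem src_diff : src (diff x y) = x := rfl
@[simp] theorem tgt_role : tgt (role R x y) = y := rfl
@[simp] theorem tgt_diff : tgt (diff x y) = y := rfl

end

section
variable {α : Type*} [Primcodable α]

@[fun_prop]
theorem primrec_tag {f : α → Assertion} (hf : Primrec f) : Primrec fun a => (f a).tag :=
  Primrec.fst.comp (primrec_fields.comp hf)

@[fun_prop]
theorem primrec_concept {f : α → Assertion} (hf : Primrec f) : Primrec fun a => (f a).concept := by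
  have := primrec_fields.comp hf
  unfold concept; fun_prop

@[fun_prop]
theorem primrec_roleName {f : α → Assertion} (hf : Primrec f) :
    Primrec fun a => (f a).roleName := by
  have := primrec_fields.comp hf
  unfold roleName; fun_prop

@[fun_prop]
theorem primrec_src {f : α → Assertion} (hf : Primrec f) : Primrec fun a => (f a).src := by
  have := primrec_fields.comp hf
  unfold src; fun_prop

@[fun_prop]
theorem primrec_tgt {f : α → Assertion} (hf : Primrec f) : Primrec fun a => (f a).tgt := by
  have := primrec_fields.comp hf
  unfold tgt; fun_prop

@[fun_prop]
theorem primrec_conc {f : α → Concept} {x : α → ℕ} (hf : Primrec f) (hx : Primrec x) :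
    Primrec fun a => conc (f a) (x a) :=
  (Primrec.of_equiv_symm (e := equivSum)).comp (Primrec.sumInl.comp (hf.pair hx))

@[fun_prop]
theorem primrec_role {R x y : α → ℕ} (hR : Primrec R) (hx : Primrec x) (hy : Primrec y) :
    Primrec fun a => role (R a) (x a) (y a) :=
  (Primrec.of_equiv_symm (e := equivSum)).comp
    (Primrec.sumInr.comp (Primrec.sumInl.comp (hR.pair (hx.pair hy))))

@[fun_prop]
theorem primrec_diff {x y : α → ℕ} (hx : Primrec x) (hy : Primrec y) :
    Primrec fun a => diff (x a) (y a) :=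
  (Primrec.of_equiv_symm (e := equivSum)).comp
    (Primrec.sumInr.comp (Primrec.sumInr.comp (hx.pair hy)))

end

end Assertion

/-! ### The tableau rules on lists of assertions -/

namespace ListABox

open Assertion

/-- The individual names in a list of assertions, with repetitions. -/
def names (L : List Assertion) : List ℕ :=
  L.flatMap fun a => bif decide (a.tag = 0) then [a.src] else [a.src, a.tgt]

/-- The successors of `x` along the chain `ρ`. -/
def chainSuccs (L : List Assertion) (ρ : Chain) (x : ℕ) : List ℕ :=
  ρ.foldl (fun S R => L.flatMap fun a =>
    bif decide (a.tag = 1) && decide (a.roleName = R) && decide (a.src ∈ S) then [a.tgt] else [])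
    [x]

/-- Decides whether `y` is an `R`-successor of `x`. -/
def isSucc (L : List Assertion) (R : RoleExpr) (x y : ℕ) : Bool :=
  R.any fun K => K.all fun ρ => decide (y ∈ chainSuccs L ρ x)

/-- Decides whether the inequality of `x` and `y` is asserted. -/
def isDiff (L : List Assertion) (x y : ℕ) : Bool :=
  decide (diff x y ∈ L) || decide (diff y x ∈ L)

/-- A list without repetitions with the same elements. -/
def nub (l : List ℕ) : List ℕ :=
  l.foldr (fun a s => bif decide (a ∈ s) then s else a :: s) []

/-- The `R`-successors of `x` of which `C` is asserted, without repetitions. -/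
def succs (L : List Assertion) (R : RoleExpr) (C : Concept) (x : ℕ) : List ℕ :=
  nub ((names L).filter fun y => isSucc L R x y && decide (conc C y ∈ L))

/-- The sublists of `l` whose entries are asserted to be different from each other. -/
def distincts (L : List Assertion) (l : List ℕ) : List (List ℕ) :=
  l.foldr (fun a t => t ++ (t.filter fun s => s.all fun b => isDiff L a b).map fun s => a :: s) [[]]

/-- A longest list among those given. -/
def longest (t : List (List ℕ)) : List ℕ :=
  t.foldr (fun s m => bif decide (m.length < s.length) then s else m) []

/-- Decides whether there is a clash. -/
def clash (L : List Assertion) : Bool :=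
  L.any fun a => decide (a.tag = 0) &&
    (decide (a.concept.kind = 1) ||
      (decide (a.concept.kind = 2) && decide (conc (.neg a.concept) a.src ∈ L)) ||
      (decide (a.concept.kind = 9) &&
        (distincts L (succs L a.concept.rel a.concept.filler a.src)).any fun s =>
          decide (a.concept.num < s.length)))

/-- A number that is larger than all names. -/
def bound (L : List Assertion) : ℕ := (names L).foldr (fun a m => max (a + 1) m) 0

/-- The fresh names. -/
def fresh (b : ℕ) (t : ℕ × ℕ × ℕ) : ℕ := b + Nat.pair t.1 (Nat.pair t.2.1 t.2.2)

/-- The assertions along the chain `ρ` from `x` to the `i`-th new successor, with the fresh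
individuals `fresh b (i, j + 1, k)` between them. -/
def chainPath (ρ : Chain) (x b i j : ℕ) : List Assertion :=
  (List.range ρ.length).map fun k => role (ρ.getD k 0)
    (bif decide (k = 0) then x else fresh b (i, j + 1, k - 1))
    (bif decide (k + 1 = ρ.length) then fresh b (i, 0, 0) else fresh b (i, j + 1, k))

/-- The result of the rule for at-least restrictions, for the list `ks` of chosen disjuncts. -/
def addSuccs (L : List Assertion) (C : Concept) (x : ℕ) (Y : List ℕ) (ks : List (List Chain)) :
    List Assertion :=
  L ++
  ((List.range ks.length).flatMap fun i => (List.range (ks.getD i []).length).flatMap fun j =>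
    chainPath ((ks.getD i []).getD j []) x (bound L) i j) ++
  ((List.range ks.length).map fun i => conc C (fresh (bound L) (i, 0, 0))) ++
  ((List.range ks.length).flatMap fun i' => (List.range i').map fun i =>
    diff (fresh (bound L) (i, 0, 0)) (fresh (bound L) (i', 0, 0))) ++
  (Y.flatMap fun y => (List.range ks.length).map fun i => diff y (fresh (bound L) (i, 0, 0)))

/-- All lists of length `q` with entries in `R`. -/
def choices (R : RoleExpr) (q : ℕ) : List (List (List Chain)) :=
  Nat.rec (motive := fun _ => List (List (List Chain))) [[]]
    (fun _ t => t.flatMap fun ks => R.map fun K => K :: ks) q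

/-- Replaces `y` by `y'`. -/
def subst (L : List Assertion) (y y' : ℕ) : List Assertion :=
  L.map fun a =>
    bif decide (a.tag = 0) then conc a.concept (bif decide (a.src = y) then y' else a.src)
    else bif decide (a.tag = 1) then role a.roleName (bif decide (a.src = y) then y' else a.src)
      (bif decide (a.tgt = y) then y' else a.tgt)
    else diff (bif decide (a.src = y) then y' else a.src)
      (bif decide (a.tgt = y) then y' else a.tgt)

/-- The pairs of entries, the earlier one first, that are not asserted to be different. -/
def pairs (L : List Assertion) (l : List ℕ) : List (ℕ × ℕ) :=
  (List.range l.length).flatMap fun j => (List.range j).flatMap fun i =>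
    bif isDiff L (l.getD i 0) (l.getD j 0) then [] else [(l.getD i 0, l.getD j 0)]

/-! For each rule, the list of its applicable instances for the assertion `a`; an instance is given
by the list of its possible results. -/

/-- The instances of the rule for conjunctions. -/
def andRule (L : List Assertion) (a : Assertion) : List (List (List Assertion)) :=
  bif decide (a.tag = 0) && (decide (a.concept.kind = 4) &&
    !(decide (conc a.concept.left a.src ∈ L) && decide (conc a.concept.right a.src ∈ L)))
  then [[conc a.concept.left a.src :: conc a.concept.right a.src :: L]] else []

/-- The instances of the rule for disjunctions. -/
def orRule (L : List Assertion) (a : Assertion) : List (List (List Assertion)) :=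
  bif decide (a.tag = 0) && (decide (a.concept.kind = 5) &&
    (!decide (conc a.concept.left a.src ∈ L) && !decide (conc a.concept.right a.src ∈ L)))
  then [[conc a.concept.left a.src :: L, conc a.concept.right a.src :: L]] else []

/-- A largest set of explicitly distinct successors, as a list. -/
def largest (L : List Assertion) (R : RoleExpr) (C : Concept) (x : ℕ) : List ℕ :=
  longest (distincts L (succs L R C x))

/-- The instances of the rule for at-least restrictions. -/
def atLeastRule (L : List Assertion) (a : Assertion) : List (List (List Assertion)) :=
  bif decide (a.tag = 0) && (decide (a.concept.kind = 8) &&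
    decide ((largest L a.concept.rel a.concept.filler a.src).length < a.concept.num))
  then [(choices a.concept.rel
    (a.concept.num - (largest L a.concept.rel a.concept.filler a.src).length)).map fun ks =>
      addSuccs L a.concept.filler a.src (largest L a.concept.rel a.concept.filler a.src) ks]
  else []

/-- The instances of the rule for at-most restrictions; all the successors are taken, as this
instance is applicable as soon as any is. -/
def atMostRule (L : List Assertion) (a : Assertion) : List (List (List Assertion)) :=
  bif decide (a.tag = 0) && (decide (a.concept.kind = 9) &&
    (decide (a.concept.num < (succs L a.concept.rel a.concept.filler a.src).length) &&
      decide (0 < (pairs L (succs L a.concept.rel a.concept.filler a.src)).length)))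
  then [(pairs L (succs L a.concept.rel a.concept.filler a.src)).map fun p => subst L p.1 p.2]
  else []

/-- The instances of the choice rule. -/
def chooseRule (L : List Assertion) (a : Assertion) : List (List (List Assertion)) :=
  bif decide (a.tag = 0) && (decide (a.concept.kind = 8) || decide (a.concept.kind = 9))
  then ((names L).filter fun y => isSucc L a.concept.rel a.src y &&
    (!decide (conc a.concept.filler y ∈ L) && !decide (conc a.concept.filler.sim y ∈ L))).map
      fun y => [conc a.concept.filler y :: L, conc a.concept.filler.sim y :: L]
  else []

/-- Applicable instances of all the rules. -/
def rules (L : List Assertion) : List (List (List Assertion)) :=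
  L.flatMap fun a => andRule L a ++ (orRule L a ++ (atLeastRule L a ++
    (atMostRule L a ++ chooseRule L a)))

/-- The possible results of an applicable instance of a rule, if there is one. -/
def next (L : List Assertion) : Option (List (List Assertion)) := (rules L).head?

section
variable {α : Type*} [Primcodable α] {L : α → List Assertion}

@[fun_prop]
theorem primrec_names (hL : Primrec L) : Primrec fun a => names (L a) := by
  unfold names; fun_prop

@[fun_prop]
theorem primrec_chainSuccs {ρ : α → Chain} {x : α → ℕ} (hL : Primrec L) (hρ : Primrec ρ)
    (hx : Primrec x) : Primrec fun a => chainSuccs (L a) (ρ a) (x a) := by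
  unfold chainSuccs; fun_prop

@[fun_prop]
theorem primrec_isSucc {R : α → RoleExpr} {x y : α → ℕ} (hL : Primrec L) (hR : Primrec R)
    (hx : Primrec x) (hy : Primrec y) : Primrec fun a => isSucc (L a) (R a) (x a) (y a) := by
  unfold isSucc; fun_prop

@[fun_prop]
theorem primrec_isDiff {x y : α → ℕ} (hL : Primrec L) (hx : Primrec x) (hy : Primrec y) :
    Primrec fun a => isDiff (L a) (x a) (y a) := by
  unfold isDiff; fun_prop

@[fun_prop]
theorem primrec_nub {l : α → List ℕ} (hl : Primrec l) : Primrec fun a => nub (l a) := by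
  unfold nub; fun_prop

@[fun_prop]
theorem primrec_succs {R : α → RoleExpr} {C : α → Concept} {x : α → ℕ} (hL : Primrec L)
    (hR : Primrec R) (hC : Primrec C) (hx : Primrec x) :
    Primrec fun a => succs (L a) (R a) (C a) (x a) := by
  unfold succs; fun_prop

@[fun_prop]
theorem primrec_distincts {l : α → List ℕ} (hL : Primrec L) (hl : Primrec l) :
    Primrec fun a => distincts (L a) (l a) := by
  unfold distincts; fun_prop

@[fun_prop]
theorem primrec_longest {t : α → List (List ℕ)} (ht : Primrec t) :
    Primrec fun a => longest (t a) := by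
  unfold longest; fun_prop

@[fun_prop]
theorem primrec_clash (hL : Primrec L) : Primrec fun a => clash (L a) := by
  unfold clash; fun_prop

@[fun_prop]
theorem primrec_bound (hL : Primrec L) : Primrec fun a => bound (L a) := by
  unfold bound; fun_prop

@[fun_prop]
theorem primrec_fresh {b : α → ℕ} {t : α → ℕ × ℕ × ℕ} (hb : Primrec b) (ht : Primrec t) :
    Primrec fun a => fresh (b a) (t a) := by
  unfold fresh; fun_prop

@[fun_prop]
theorem primrec_chainPath {ρ : α → Chain} {x b i j : α → ℕ} (hρ : Primrec ρ) (hx : Primrec x)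
    (hb : Primrec b) (hi : Primrec i) (hj : Primrec j) :
    Primrec fun a => chainPath (ρ a) (x a) (b a) (i a) (j a) := by
  unfold chainPath; fun_prop

@[fun_prop]
theorem primrec_addSuccs {C : α → Concept} {x : α → ℕ} {Y : α → List ℕ}
    {ks : α → List (List Chain)} (hL : Primrec L) (hC : Primrec C) (hx : Primrec x)
    (hY : Primrec Y) (hks : Primrec ks) :
    Primrec fun a => addSuccs (L a) (C a) (x a) (Y a) (ks a) := by
  unfold addSuccs; fun_prop

@[fun_prop]
theorem primrec_choices {R : α → RoleExpr} {q : α → ℕ} (hR : Primrec R) (hq : Primrec q) :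
    Primrec fun a => choices (R a) (q a) := by
  unfold choices; fun_prop

@[fun_prop]
theorem primrec_subst {y y' : α → ℕ} (hL : Primrec L) (hy : Primrec y) (hy' : Primrec y') :
    Primrec fun a => subst (L a) (y a) (y' a) := by
  unfold subst; fun_prop

@[fun_prop]
theorem primrec_pairs {l : α → List ℕ} (hL : Primrec L) (hl : Primrec l) :
    Primrec fun a => pairs (L a) (l a) := by
  unfold pairs; fun_prop

@[fun_prop]
theorem primrec_largest {R : α → RoleExpr} {C : α → Concept} {x : α → ℕ} (hL : Primrec L)
    (hR : Primrec R) (hC : Primrec C) (hx : Primrec x) :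
    Primrec fun a => largest (L a) (R a) (C a) (x a) := by
  unfold largest; fun_prop

variable {f : α → Assertion}

@[fun_prop]
theorem primrec_andRule (hL : Primrec L) (hf : Primrec f) :
    Primrec fun a => andRule (L a) (f a) := by
  unfold andRule; fun_prop

@[fun_prop]
theorem primrec_orRule (hL : Primrec L) (hf : Primrec f) :
    Primrec fun a => orRule (L a) (f a) := by
  unfold orRule; fun_prop

@[fun_prop]
theorem primrec_atLeastRule (hL : Primrec L) (hf : Primrec f) :
    Primrec fun a => atLeastRule (L a) (f a) := by
  unfold atLeastRule; fun_prop

@[fun_prop]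
theorem primrec_atMostRule (hL : Primrec L) (hf : Primrec f) :
    Primrec fun a => atMostRule (L a) (f a) := by
  unfold atMostRule; fun_prop

@[fun_prop]
theorem primrec_chooseRule (hL : Primrec L) (hf : Primrec f) :
    Primrec fun a => chooseRule (L a) (f a) := by
  unfold chooseRule; fun_prop

theorem primrec_rules : Primrec rules := by
  unfold rules; fun_prop

theorem primrec_next : Primrec next := by
  have := primrec_rules
  unfold next; fun_prop

end

end ListABox

/-! ### Correctness of the rules on lists of assertions -/

theorem RoleExpr.WF.exists_chain {R : RoleExpr} (h : R.WF) {K : List Chain} (hK : K ∈ R) :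
    ∃ ρ ∈ K, ρ ≠ [] := by
  obtain ⟨ρ, hρ⟩ := List.exists_mem_of_ne_nil _ (h.ne_nil hK)
  refine ⟨ρ, hρ, List.ne_nil_of_length_pos ?_⟩
  rw [h.length_eq hK hρ]
  exact h.len_pos

namespace ABox

theorem mem_names_of_conc {A : ABox} {C : Concept} {x : ℕ} (h : Assertion.conc C x ∈ A) :
    x ∈ A.names :=
  Finset.mem_biUnion.2 ⟨_, h, by simp [Assertion.names]⟩

theorem mem_names_of_role {A : ABox} {R x y : ℕ} (h : Assertion.role R x y ∈ A) :
    x ∈ A.names ∧ y ∈ A.names :=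
  ⟨Finset.mem_biUnion.2 ⟨_, h, by simp [Assertion.names]⟩,
    Finset.mem_biUnion.2 ⟨_, h, by simp [Assertion.names]⟩⟩

theorem ChainSucc.mem_names {A : ABox} {ρ : Chain} (hρ : ρ ≠ []) {x y : ℕ}
    (h : A.ChainSucc ρ x y) : y ∈ A.names := by
  induction ρ generalizing x with
  | nil => exact absurd rfl hρ
  | cons R ρ ih =>
    obtain ⟨z, hz, h⟩ := h
    rcases ρ with _ | ⟨R', ρ⟩
    · cases h
      exact (mem_names_of_role hz).2
    · exact ih (by simp) h

theorem Succ.mem_names {A : ABox} {R : RoleExpr} (hR : R.WF) {x y : ℕ} (h : A.Succ R x y) :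
    y ∈ A.names := by
  obtain ⟨K, hK, h⟩ := h
  obtain ⟨ρ, hρ, hne⟩ := hR.exists_chain hK
  exact (h ρ hρ).mem_names hne

end ABox

namespace ListABox

open Assertion

variable {L : List Assertion}

theorem mem_names {x : ℕ} : x ∈ names L ↔ x ∈ ABox.names L.toFinset := by
  simp only [names, ABox.names, List.mem_flatMap, Finset.mem_biUnion, List.mem_toFinset]
  refine exists_congr fun a => and_congr_right fun _ => ?_
  cases a <;> simp [Assertion.names]

theorem mem_foldl_chainSuccs {ρ : Chain} {S : List ℕ} {y : ℕ} :
    y ∈ ρ.foldl (fun S R => L.flatMap fun a =>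
      bif decide (a.tag = 1) && decide (a.roleName = R) && decide (a.src ∈ S) then [a.tgt] else [])
      S ↔ ∃ x ∈ S, ABox.ChainSucc L.toFinset ρ x y := by
  induction ρ generalizing S with
  | nil => simp [ABox.ChainSucc]
  | cons R ρ ih =>
    rw [List.foldl_cons, ih]
    simp only [ABox.ChainSucc, List.mem_flatMap, List.mem_toFinset]
    constructor
    · rintro ⟨z, ⟨a, ha, hz⟩, h⟩
      cases a with
      | role R' x w =>
        by_cases hc : R' = R ∧ x ∈ S
        · obtain ⟨rfl, hx⟩ := hc
          simp [hx] at hz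
          subst hz
          exact ⟨x, hx, z, ha, h⟩
        · rw [not_and_or] at hc
          rcases hc with hc | hc <;> simp [hc] at hz
      | _ => simp at hz
    · rintro ⟨x, hx, z, ha, h⟩
      exact ⟨z, ⟨_, ha, by simp [hx]⟩, h⟩

theorem mem_chainSuccs {ρ : Chain} {x y : ℕ} :
    y ∈ chainSuccs L ρ x ↔ ABox.ChainSucc L.toFinset ρ x y := by
  simp [chainSuccs, mem_foldl_chainSuccs]

theorem isSucc_iff {R : RoleExpr} {x y : ℕ} :
    isSucc L R x y = true ↔ ABox.Succ L.toFinset R x y := by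
  simp [isSucc, ABox.Succ, mem_chainSuccs]

theorem isDiff_iff {x y : ℕ} : isDiff L x y = true ↔ ABox.Diff L.toFinset x y := by
  simp [isDiff, ABox.Diff]

theorem mem_nub {l : List ℕ} {x : ℕ} : x ∈ nub l ↔ x ∈ l := by
  induction l generalizing x with
  | nil => simp [nub]
  | cons a l ih =>
    have e : nub (a :: l) = bif decide (a ∈ nub l) then nub l else a :: nub l := rfl
    rw [e, List.mem_cons]
    by_cases h : a ∈ nub l
    · simp only [h, decide_true, cond_true]
      rw [ih]
      exact ⟨Or.inr, fun h' => h'.elim (fun h' => h' ▸ ih.1 h) id⟩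
    · simp [h, ih]

theorem nodup_nub (l : List ℕ) : (nub l).Nodup := by
  induction l with
  | nil => simp [nub]
  | cons a l ih =>
    have e : nub (a :: l) = bif decide (a ∈ nub l) then nub l else a :: nub l := rfl
    rw [e]
    by_cases h : a ∈ nub l
    · simpa [h] using ih
    · simpa [h] using ih

theorem mem_succs {R : RoleExpr} {C : Concept} {x y : ℕ} :
    y ∈ succs L R C x ↔ ABox.Succ L.toFinset R x y ∧ conc C y ∈ L := by
  simp only [succs, mem_nub, List.mem_filter, Bool.and_eq_true, decide_eq_true_eq, isSucc_iff]
  refine ⟨And.right, fun h => ⟨mem_names.2 ?_, h⟩⟩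
  exact ABox.mem_names_of_conc (List.mem_toFinset.2 h.2)

theorem nodup_succs {R : RoleExpr} {C : Concept} {x : ℕ} : (succs L R C x).Nodup :=
  nodup_nub _

theorem mem_distincts {l s : List ℕ} :
    s ∈ distincts L l ↔ s.Sublist l ∧ s.Pairwise (ABox.Diff L.toFinset) := by
  induction l generalizing s with
  | nil => simp +contextual [distincts]
  | cons a l ih =>
    have e : distincts L (a :: l) = distincts L l ++
      ((distincts L l).filter fun s => s.all fun b => isDiff L a b).map fun s => a :: s := rfl
    rw [e, List.mem_append, ih, List.mem_map, List.sublist_cons_iff]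
    simp only [List.mem_filter, ih, List.all_eq_true, isDiff_iff]
    constructor
    · rintro (h | ⟨r, ⟨⟨h1, h2⟩, h3⟩, rfl⟩)
      · exact ⟨Or.inl h.1, h.2⟩
      · exact ⟨Or.inr ⟨r, rfl, h1⟩, List.pairwise_cons.2 ⟨h3, h2⟩⟩
    · rintro ⟨h1 | ⟨r, rfl, h1⟩, h2⟩
      · exact Or.inl ⟨h1, h2⟩
      · rw [List.pairwise_cons] at h2
        exact Or.inr ⟨r, ⟨⟨h1, h2.2⟩, h2.1⟩, rfl⟩

theorem distinctSuccs_of_mem {R : RoleExpr} {C : Concept} {x : ℕ} {s : List ℕ}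
    (h : s ∈ distincts L (succs L R C x)) :
    ABox.DistinctSuccs L.toFinset R C x s.toFinset ∧ s.toFinset.card = s.length := by
  obtain ⟨h1, h2⟩ := mem_distincts.1 h
  refine ⟨⟨fun y hy => ?_, fun y hy y' hy' hne => ?_⟩,
    List.toFinset_card_of_nodup (nodup_succs.sublist h1)⟩
  · have := mem_succs.1 (h1.subset (List.mem_toFinset.1 hy))
    exact ⟨this.1, List.mem_toFinset.2 this.2⟩
  · have : Std.Symm (ABox.Diff L.toFinset) := ⟨fun _ _ => Or.symm⟩
    exact h2.forall (List.mem_toFinset.1 hy) (List.mem_toFinset.1 hy') hne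

theorem exists_mem_distincts {R : RoleExpr} {C : Concept} {x : ℕ} {Y : Finset ℕ}
    (h : ABox.DistinctSuccs L.toFinset R C x Y) :
    ∃ s ∈ distincts L (succs L R C x), s.length = Y.card := by
  have hsub := List.filter_sublist (p := fun y => decide (y ∈ Y)) (l := succs L R C x)
  refine ⟨(succs L R C x).filter (fun y => decide (y ∈ Y)), mem_distincts.2 ⟨hsub, ?_⟩, ?_⟩
  · have : ((succs L R C x).filter (fun y => decide (y ∈ Y))).Nodup := nodup_succs.sublist hsub
    refine this.imp_of_mem ?_
    intro a b ha hb hne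
    simp only [List.mem_filter, decide_eq_true_eq] at ha hb
    exact h.2 a ha.2 b hb.2 hne
  · rw [← List.toFinset_card_of_nodup (nodup_succs.sublist hsub)]
    congr 1
    ext y
    simp only [List.mem_toFinset, List.mem_filter, decide_eq_true_eq, mem_succs]
    refine ⟨And.right, fun hy => ⟨⟨(h.1 y hy).1, List.mem_toFinset.1 (h.1 y hy).2⟩, hy⟩⟩

theorem length_le_longest {t : List (List ℕ)} {s : List ℕ} (h : s ∈ t) :
    s.length ≤ (longest t).length := by
  induction t with
  | nil => simp at h
  | cons r t ih =>
    have e : longest (r :: t) =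
      bif decide ((longest t).length < r.length) then r else longest t := rfl
    rw [e]
    by_cases hr : (longest t).length < r.length
    · simp only [hr, decide_true, cond_true]
      rcases List.mem_cons.1 h with rfl | h
      · exact le_rfl
      · exact (ih h).trans hr.le
    · simp only [hr, decide_false, cond_false]
      rcases List.mem_cons.1 h with rfl | h
      · omega
      · exact ih h

theorem longest_mem {t : List (List ℕ)} (h : [] ∈ t) : longest t ∈ t := by
  have : longest t ∈ t ∨ longest t = [] := by
    clear h
    induction t with
    | nil => exact Or.inr rfl
    | cons r t ih =>
      have e : longest (r :: t) =
        bif decide ((longest t).length < r.length) then r else longest t := rfl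
      rw [e]
      by_cases hr : (longest t).length < r.length
      · simp [hr]
      · simp only [hr, decide_false, cond_false, List.mem_cons]
        tauto
  rcases this with h' | h'
  · exact h'
  · rwa [h']

theorem largest_mem (R : RoleExpr) (C : Concept) (x : ℕ) :
    largest L R C x ∈ distincts L (succs L R C x) :=
  longest_mem (mem_distincts.2 ⟨List.nil_sublist _, List.Pairwise.nil⟩)

theorem card_le_largest {R : RoleExpr} {C : Concept} {x : ℕ} {Y : Finset ℕ}
    (h : ABox.DistinctSuccs L.toFinset R C x Y) : Y.card ≤ (largest L R C x).length := by
  obtain ⟨s, hs, e⟩ := exists_mem_distincts h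
  rw [← e]
  exact length_le_longest hs

theorem clash_iff : clash L = true ↔ ABox.Clash L.toFinset := by
  simp only [clash, List.any_eq_true, Bool.and_eq_true, Bool.or_eq_true, decide_eq_true_eq]
  constructor
  · rintro ⟨a, ha, ht, h⟩
    cases a with
    | conc C x =>
      cases C <;> simp at h
      · exact Or.inl ⟨x, List.mem_toFinset.2 ha⟩
      · exact Or.inr (Or.inl ⟨_, x, List.mem_toFinset.2 ha, List.mem_toFinset.2 h⟩)
      · obtain ⟨s, hs, h⟩ := h
        obtain ⟨h1, h2⟩ := distinctSuccs_of_mem hs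
        exact Or.inr (Or.inr ⟨_, _, _, x, _, List.mem_toFinset.2 ha, h1, h2 ▸ h⟩)
    | _ => simp at ht
  · rintro (⟨x, h⟩ | ⟨a, x, h, h'⟩ | ⟨n, R, C, x, Y, h, hY, hn⟩)
    · exact ⟨_, List.mem_toFinset.1 h, by simp⟩
    · exact ⟨_, List.mem_toFinset.1 h, by simpa using h'⟩
    · obtain ⟨s, hs, e⟩ := exists_mem_distincts hY
      refine ⟨_, List.mem_toFinset.1 h, rfl, Or.inr ⟨by simp, s, by simpa using hs, ?_⟩⟩
      simpa [e] using hn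

theorem lt_bound {x : ℕ} (h : x ∈ names L) : x < bound L := by
  unfold bound
  generalize names L = l at h ⊢
  induction l with
  | nil => simp at h
  | cons a l ih =>
    rw [List.foldr_cons]
    rcases List.mem_cons.1 h with rfl | h
    · exact lt_of_lt_of_le (Nat.lt_succ_self _) (le_max_left _ _)
    · exact lt_of_lt_of_le (ih h) (le_max_right _ _)

theorem fresh_injective (b : ℕ) : Function.Injective (fresh b) := by
  rintro ⟨i, j, k⟩ ⟨i', j', k'⟩ h
  simpa [fresh] using h

theorem fresh_notMem (t : ℕ × ℕ × ℕ) : fresh (bound L) t ∉ ABox.names L.toFinset := by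
  intro h
  have := lt_bound (mem_names.2 h)
  unfold fresh at this
  omega

theorem path_eq (ρ : Chain) (x : ℕ) (w : ℕ → ℕ) (z : ℕ) :
    ABox.path ρ x w z = (List.range ρ.length).map fun k => role (ρ.getD k 0)
      (bif decide (k = 0) then x else w (k - 1))
      (bif decide (k + 1 = ρ.length) then z else w k) := by
  induction ρ generalizing x w with
  | nil => rfl
  | cons R ρ ih =>
    cases ρ with
    | nil => rfl
    | cons R' ρ =>
      rw [ABox.path, ih, List.length_cons (a := R), List.range_succ_eq_map, List.map_cons,
        List.map_map]
      congr 1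
      refine List.map_congr_left fun k _ => ?_
      rcases k with _ | k <;> simp

theorem chainPath_eq (ρ : Chain) (x b i j : ℕ) :
    chainPath ρ x b i j =
      ABox.path ρ x (fun k => fresh b (i, j + 1, k)) (fresh b (i, 0, 0)) := by
  rw [path_eq]; rfl

theorem toFinset_addSuccs (C : Concept) (x : ℕ) (Y : List ℕ) {q : ℕ}
    (K : Fin q → List Chain) :
    (addSuccs L C x Y (List.ofFn K)).toFinset =
      ABox.addSuccs L.toFinset C x Y.toFinset q K (fresh (bound L)) := by
  have hlen : (List.ofFn K).length = q := List.length_ofFn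
  have hget : ∀ i (h : i < q), (List.ofFn K).getD i [] = K ⟨i, h⟩ := fun i h => by
    simp [List.getD_eq_getElem?_getD, h]
  ext a
  simp only [addSuccs, ABox.addSuccs, List.toFinset_append, Finset.mem_union, hlen]
  refine or_congr (or_congr (or_congr (or_congr Iff.rfl ?_) ?_) ?_) ?_
  · simp only [List.mem_toFinset, List.mem_flatMap, List.mem_range, Finset.mem_biUnion,
      Finset.mem_univ, true_and]
    constructor
    · rintro ⟨i, hi, j, hj, h⟩
      rw [hget i hi] at hj h
      refine ⟨⟨i, hi⟩, ⟨j, hj⟩, ?_⟩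
      rw [List.getD_eq_getElem _ _ hj, chainPath_eq] at h
      exact h
    · rintro ⟨⟨i, hi⟩, ⟨j, hj⟩, h⟩
      refine ⟨i, hi, j, ?_, ?_⟩
      · rwa [hget i hi]
      · rw [hget i hi, List.getD_eq_getElem _ _ hj, chainPath_eq]
        exact h
  · simp only [List.mem_toFinset, List.mem_map, List.mem_range, Finset.mem_image,
      Finset.mem_univ, true_and]
    exact ⟨fun ⟨i, hi, h⟩ => ⟨⟨i, hi⟩, h⟩, fun ⟨i, h⟩ => ⟨i, i.2, h⟩⟩
  · simp only [List.mem_toFinset, List.mem_flatMap, List.mem_map, List.mem_range,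
      Finset.mem_image, Finset.mem_filter, Finset.mem_univ, true_and, Prod.exists]
    exact ⟨fun ⟨j, hj, i, hi, h⟩ => ⟨⟨i, hi.trans hj⟩, ⟨j, hj⟩, hi, h⟩,
      fun ⟨i, j, hi, h⟩ => ⟨j, j.2, i, hi, h⟩⟩
  · simp only [List.mem_toFinset, List.mem_flatMap, List.mem_map, List.mem_range,
      Finset.mem_image, Finset.mem_product, Finset.mem_univ, and_true, Prod.exists]
    exact ⟨fun ⟨y, hy, i, hi, h⟩ => ⟨y, ⟨i, hi⟩, hy, h⟩,
      fun ⟨y, i, hy, h⟩ => ⟨y, hy, i, i.2, h⟩⟩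

theorem mem_choices {R : RoleExpr} {q : ℕ} {ks : List (List Chain)} :
    ks ∈ choices R q ↔ ks.length = q ∧ ∀ K ∈ ks, K ∈ R := by
  induction q generalizing ks with
  | zero =>
    have e : choices R 0 = [[]] := rfl
    rw [e, List.mem_singleton]
    constructor
    · rintro rfl; simp
    · rintro ⟨h, -⟩; exact List.length_eq_zero_iff.1 h
  | succ q ih =>
    have e : choices R (q + 1) = (choices R q).flatMap fun ks => R.map fun K => K :: ks := rfl
    simp only [e, List.mem_flatMap, List.mem_map, ih]
    constructor
    · rintro ⟨r, ⟨h1, h2⟩, K, hK, rfl⟩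
      simp [h1, hK]; exact h2
    · rintro ⟨h1, h2⟩
      cases ks with
      | nil => simp at h1
      | cons K r =>
        simp only [List.mem_cons, forall_eq_or_imp] at h2
        exact ⟨r, ⟨by simpa using h1, h2.2⟩, K, h2.1, rfl⟩

theorem toFinset_subst (y y' : ℕ) : (subst L y y').toFinset = ABox.subst L.toFinset y y' := by
  ext b
  simp only [subst, ABox.subst, List.mem_toFinset, List.mem_map, Finset.mem_image]
  refine exists_congr fun a => and_congr_right fun _ => Eq.congr_left ?_
  cases a <;> simp only [Assertion.rename, Bool.cond_decide] <;> simp <;> grind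

theorem mem_pairs {l : List ℕ} {p : ℕ × ℕ} :
    p ∈ pairs L l ↔ ∃ i j : Fin l.length, i < j ∧
      ¬ ABox.Diff L.toFinset (l.get i) (l.get j) ∧ p = (l.get i, l.get j) := by
  simp only [pairs, List.mem_flatMap, List.mem_range]
  constructor
  · rintro ⟨j, hj, i, hi, h⟩
    rw [List.getD_eq_getElem _ _ hj, List.getD_eq_getElem _ _ (hi.trans hj)] at h
    refine ⟨⟨i, hi.trans hj⟩, ⟨j, hj⟩, hi, ?_⟩
    rw [← isDiff_iff]
    simp only [List.get_eq_getElem]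
    cases hd : isDiff L (l[i]'(hi.trans hj)) l[j] <;> simp [hd] at h ⊢
    exact h
  · rintro ⟨⟨i, hi⟩, ⟨j, hj⟩, hij, h, rfl⟩
    refine ⟨j, hj, i, hij, ?_⟩
    rw [List.getD_eq_getElem _ _ hj, List.getD_eq_getElem _ _ hi]
    rw [← isDiff_iff] at h
    simp only [List.get_eq_getElem] at h ⊢
    simp [h]

/-- The set of ABoxes that a list of lists of assertions represents. -/
def toSet (Bs : List (List Assertion)) : Set ABox := {B | ∃ l ∈ Bs, l.toFinset = B}

theorem rule_of_mem_andRule {a : Assertion} (ha : a ∈ L) {Bs : List (List Assertion)}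
    (h : Bs ∈ andRule L a) : ABox.Rule L.toFinset (toSet Bs) := by
  cases a with
  | conc E x =>
    cases E with
    | and C D =>
      by_cases hc : conc C x ∈ L ∧ conc D x ∈ L
      · simp [andRule, hc] at h
      · have h' : Bs = [conc C x :: conc D x :: L] := by
          rw [not_and_or] at hc
          rcases hc with hc | hc <;> simpa [andRule, hc] using h
        subst h'
        convert ABox.Rule.and C D x (List.mem_toFinset.2 ha) (by simpa using hc) using 1
        ext B
        simp only [toSet, List.mem_singleton, exists_eq_left, Set.mem_ofPred_eq,
          Set.mem_singleton_iff]
        rw [eq_comm]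
        refine Eq.congr_right ?_
        ext b
        simp
    | _ => simp [andRule] at h
  | _ => simp [andRule] at h

theorem toSet_pair (a b : Assertion) :
    toSet [a :: L, b :: L] = {L.toFinset ∪ {a}, L.toFinset ∪ {b}} := by
  ext B
  simp only [toSet, List.mem_cons, List.not_mem_nil, or_false, exists_eq_or_imp, exists_eq_left,
    List.toFinset_cons, Set.mem_ofPred_eq, Set.mem_insert_iff, Set.mem_singleton_iff,
    Finset.union_comm L.toFinset, ← Finset.insert_eq]
  rw [eq_comm (a := B), eq_comm (a := B)]

theorem rule_of_mem_orRule {a : Assertion} (ha : a ∈ L) {Bs : List (List Assertion)}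
    (h : Bs ∈ orRule L a) : ABox.Rule L.toFinset (toSet Bs) := by
  cases a with
  | conc E x =>
    cases E with
    | or C D =>
      by_cases hC : conc C x ∈ L
      · simp [orRule, hC] at h
      by_cases hD : conc D x ∈ L
      · simp [orRule, hD] at h
      have h' : Bs = [conc C x :: L, conc D x :: L] := by simpa [orRule, hC, hD] using h
      rw [h', toSet_pair]
      exact ABox.Rule.or C D x (List.mem_toFinset.2 ha) (by simpa using hC) (by simpa using hD)
    | _ => simp [orRule] at h
  | _ => simp [orRule] at h

theorem rule_of_mem_atLeastRule {a : Assertion} (ha : a ∈ L) {Bs : List (List Assertion)}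
    (h : Bs ∈ atLeastRule L a) : ABox.Rule L.toFinset (toSet Bs) := by
  cases a with
  | conc E x =>
    cases E with
    | atLeast n R C =>
      by_cases hn : (largest L R C x).length < n
      · have h' : Bs = (choices R (n - (largest L R C x).length)).map fun ks =>
            addSuccs L C x (largest L R C x) ks := by simpa [atLeastRule, hn] using h
        obtain ⟨h1, h2⟩ := distinctSuccs_of_mem (largest_mem (L := L) R C x)
        convert ABox.Rule.atLeast n R C x (List.mem_toFinset.2 ha) (largest L R C x).toFinset h1
          (fun Y hY => h2 ▸ card_le_largest hY) (h2 ▸ hn) (fresh (bound L)) (fresh_injective _)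
          fresh_notMem using 1
        ext B
        simp only [toSet, h', List.mem_map, mem_choices, Set.mem_ofPred_eq, ← h2]
        constructor
        · rintro ⟨l, ⟨ks, ⟨hl, hks⟩, rfl⟩, rfl⟩
          generalize n - (largest L R C x).toFinset.card = q at hl ⊢
          subst hl
          refine ⟨ks.get, fun i => hks _ (List.get_mem _ _), ?_⟩
          rw [← toFinset_addSuccs, List.ofFn_get]
        · rintro ⟨K, hK, rfl⟩
          refine ⟨_, ⟨List.ofFn K, ⟨by simp, ?_⟩, rfl⟩, toFinset_addSuccs _ _ _ _⟩
          simpa [List.mem_ofFn] using hK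
      · simp [atLeastRule, hn] at h
    | _ => simp [atLeastRule] at h
  | _ => simp [atLeastRule] at h

theorem rule_of_mem_atMostRule {a : Assertion} (ha : a ∈ L) {Bs : List (List Assertion)}
    (h : Bs ∈ atMostRule L a) : ABox.Rule L.toFinset (toSet Bs) := by
  cases a with
  | conc E x =>
    cases E with
    | atMost n R C =>
      by_cases hn : n < (succs L R C x).length ∧ 0 < (pairs L (succs L R C x)).length
      · have h' : Bs = (pairs L (succs L R C x)).map fun p => subst L p.1 p.2 := by
          simpa [atMostRule, hn.1, hn.2] using h
        obtain ⟨p, hp⟩ := List.exists_mem_of_length_pos hn.2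
        obtain ⟨i, j, hij, hd, -⟩ := mem_pairs.1 hp
        convert ABox.Rule.atMost n R C x (List.mem_toFinset.2 ha) _ hn.1 (succs L R C x).get
          (List.nodup_iff_injective_get.1 nodup_succs)
          (fun i => ?_) ⟨i, j, hij, hd⟩ using 1
        · ext B
          simp only [toSet, h', List.mem_map, mem_pairs, Set.mem_ofPred_eq]
          constructor
          · rintro ⟨l, ⟨p, ⟨i, j, hij, hd, rfl⟩, rfl⟩, rfl⟩
            exact ⟨i, j, hij, hd, toFinset_subst _ _⟩
          · rintro ⟨i, j, hij, hd, rfl⟩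
            exact ⟨_, ⟨_, ⟨i, j, hij, hd, rfl⟩, rfl⟩, toFinset_subst _ _⟩
        · simpa using mem_succs.1 (List.get_mem (succs L R C x) i)
      · rw [not_and_or] at hn
        rcases hn with hn | hn
        · simp [atMostRule, hn] at h
        · have e : decide (0 < (pairs L (succs L R C x)).length) = false := decide_eq_false hn
          simp [atMostRule, e] at h
    | _ => simp [atMostRule] at h
  | _ => simp [atMostRule] at h

theorem rule_of_mem_chooseRule {a : Assertion} (ha : a ∈ L) {Bs : List (List Assertion)}
    (h : Bs ∈ chooseRule L a) : ABox.Rule L.toFinset (toSet Bs) := by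
  cases a with
  | conc E x =>
    cases E with
    | atLeast n R C =>
      simp only [chooseRule, tag_conc, concept_conc, Concept.kind_atLeast, decide_true,
        Bool.true_or, Bool.and_self, cond_true, List.mem_map, List.mem_filter, src_conc,
        Bool.and_eq_true, isSucc_iff, Bool.not_eq_true', decide_eq_false_iff_not,
        Concept.rel_atLeast, Concept.filler_atLeast] at h
      obtain ⟨y, ⟨-, h1, h2, h3⟩, rfl⟩ := h
      rw [toSet_pair]
      exact ABox.Rule.choose n R C x y (Or.inl (List.mem_toFinset.2 ha)) h1 (by simpa using h2)
        (by simpa using h3)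
    | atMost n R C =>
      simp only [chooseRule, tag_conc, concept_conc, Concept.kind_atMost, decide_true,
        Bool.or_true, Bool.and_self, cond_true, List.mem_map, List.mem_filter, src_conc,
        Bool.and_eq_true, isSucc_iff, Bool.not_eq_true', decide_eq_false_iff_not,
        Concept.rel_atMost, Concept.filler_atMost] at h
      obtain ⟨y, ⟨-, h1, h2, h3⟩, rfl⟩ := h
      rw [toSet_pair]
      exact ABox.Rule.choose n R C x y (Or.inr (List.mem_toFinset.2 ha)) h1 (by simpa using h2)
        (by simpa using h3)
    | _ => simp [chooseRule] at h
  | _ => simp [chooseRule] at h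

theorem rule_of_mem_rules {Bs : List (List Assertion)} (h : Bs ∈ rules L) :
    ABox.Rule L.toFinset (toSet Bs) := by
  simp only [rules, List.mem_flatMap, List.mem_append] at h
  obtain ⟨a, ha, h | h | h | h | h⟩ := h
  · exact rule_of_mem_andRule ha h
  · exact rule_of_mem_orRule ha h
  · exact rule_of_mem_atLeastRule ha h
  · exact rule_of_mem_atMostRule ha h
  · exact rule_of_mem_chooseRule ha h

/-- If some rule is applicable, then one is found. The restriction to concepts of the language makes
the successors that the choice rule considers occur in the ABox. -/
theorem rules_ne_nil (hL : ∀ C x, conc C x ∈ L → C.WF) {S : Set ABox}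
    (h : ABox.Rule L.toFinset S) : rules L ≠ [] := by
  suffices ∃ a ∈ L, andRule L a ≠ [] ∨ orRule L a ≠ [] ∨ atLeastRule L a ≠ [] ∨
      atMostRule L a ≠ [] ∨ chooseRule L a ≠ [] by
    obtain ⟨a, ha, h⟩ := this
    intro h'
    rw [rules, List.flatMap_eq_nil_iff] at h'
    have := h' a ha
    simp only [List.append_eq_nil_iff] at this
    tauto
  have hchoose : ∀ a ∈ L, ∀ n R C x y, (a = conc (.atLeast n R C) x ∨ a = conc (.atMost n R C) x) →
      ABox.Succ L.toFinset R x y → conc C y ∉ L → conc C.sim y ∉ L → chooseRule L a ≠ [] := by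
    intro a ha n R C x y he hs hC hC' h'
    have hR : R.WF := by
      rcases he with rfl | rfl
      · exact (hL _ _ ha).1
      · exact (hL _ _ ha).1
    have hy := mem_names.2 (hs.mem_names hR)
    rcases he with rfl | rfl
    · simp [chooseRule] at h'
      exact hC' (h' y hy (isSucc_iff.2 hs) hC)
    · simp [chooseRule] at h'
      exact hC' (h' y hy (isSucc_iff.2 hs) hC)
  cases h with
  | and C D x h h' =>
    refine ⟨_, List.mem_toFinset.1 h, Or.inl ?_⟩
    simp only [List.mem_toFinset, not_and_or] at h'
    rcases h' with h' | h' <;> simp [andRule, h']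
  | or C D x h hC hD =>
    refine ⟨_, List.mem_toFinset.1 h, Or.inr (Or.inl ?_)⟩
    simp only [List.mem_toFinset] at hC hD
    simp [orRule, hC, hD]
  | atLeast n R C x h Y hY hmax hlt _ _ _ =>
    refine ⟨_, List.mem_toFinset.1 h, Or.inr (Or.inr (Or.inl ?_))⟩
    obtain ⟨h1, h2⟩ := distinctSuccs_of_mem (largest_mem (L := L) R C x)
    have : (largest L R C x).length < n := h2 ▸ (hmax _ h1).trans_lt hlt
    simp [atLeastRule, this]
  | atMost n R C x h p hp y hinj hy hpair =>
    refine ⟨_, List.mem_toFinset.1 h, Or.inr (Or.inr (Or.inr (Or.inl ?_)))⟩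
    have hmem : ∀ i, y i ∈ succs L R C x := fun i =>
      mem_succs.2 ⟨(hy i).1, List.mem_toFinset.1 (hy i).2⟩
    have h1 : n < (succs L R C x).length := by
      rw [← List.toFinset_card_of_nodup nodup_succs]
      refine hp.trans_le ?_
      calc p = (Finset.univ.image y).card := by
            rw [Finset.card_image_of_injective _ hinj, Finset.card_univ, Fintype.card_fin]
        _ ≤ _ := Finset.card_le_card fun z hz => by
            obtain ⟨i, -, rfl⟩ := Finset.mem_image.1 hz
            exact List.mem_toFinset.2 (hmem i)
    have h2 : 0 < (pairs L (succs L R C x)).length := by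
      obtain ⟨i, j, hij, hd⟩ := hpair
      obtain ⟨i', hi'⟩ := List.get_of_mem (hmem i)
      obtain ⟨j', hj'⟩ := List.get_of_mem (hmem j)
      have hne : i' ≠ j' := by
        rintro rfl
        exact hij.ne (hinj (hi'.symm.trans hj'))
      rcases lt_or_gt_of_ne hne with hlt | hlt
      · exact List.length_pos_of_mem (mem_pairs.2 ⟨i', j', hlt, by rwa [hi', hj'], rfl⟩)
      · refine List.length_pos_of_mem (mem_pairs.2 ⟨j', i', hlt, ?_, rfl⟩)
        rw [hi', hj']
        exact fun h => hd h.symm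
    have e : decide (0 < (pairs L (succs L R C x)).length) = true := decide_eq_true h2
    simp [atMostRule, e, h1]
  | choose n R C x y h hy hC hC' =>
    simp only [List.mem_toFinset] at h hC hC'
    rcases h with h | h
    · exact ⟨_, h, Or.inr (Or.inr (Or.inr (Or.inr
        (hchoose _ h n R C x y (Or.inl rfl) hy hC hC'))))⟩
    · exact ⟨_, h, Or.inr (Or.inr (Or.inr (Or.inr
        (hchoose _ h n R C x y (Or.inr rfl) hy hC hC'))))⟩

theorem rule_of_next {Bs : List (List Assertion)} (h : next L = some Bs) :
    ABox.Rule L.toFinset (toSet Bs) :=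
  rule_of_mem_rules (List.mem_of_mem_head? h)

theorem next_eq_none_iff (hL : ∀ C x, conc C x ∈ L → C.WF) :
    next L = none ↔ ABox.Complete L.toFinset := by
  rw [next, List.head?_eq_none_iff]
  constructor
  · exact fun h S hS => rules_ne_nil hL hS h
  · intro h
    by_contra hne
    obtain ⟨Bs, hBs⟩ := List.exists_mem_of_ne_nil _ hne
    exact h _ (rule_of_mem_rules hBs)

end ListABox

theorem computablePred_of_primrec {α : Type*} [Primcodable α] {p : α → Prop} {f : α → Bool}
    (hf : Primrec f) (h : ∀ a, f a = true ↔ p a) : ComputablePred p := by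
  classical
  refine ⟨inferInstance, hf.to_comp.of_eq fun a => ?_⟩
  rw [Bool.eq_iff_iff, h]
  simp

theorem effectiveSteps : EffectiveSteps := by
  refine ⟨⟨fun C => [Assertion.conc (C.nnf true) 0], ?_, fun C => rfl⟩,
    ⟨ListABox.next, ListABox.primrec_next.to_comp, fun L hL =>
      ⟨ListABox.next_eq_none_iff hL, fun Bs h => ListABox.rule_of_next h⟩⟩,
    computablePred_of_primrec (f := ListABox.clash) (by fun_prop) fun _ => ListABox.clash_iff⟩
  exact Primrec.to_comp (by fun_prop)

/-! ### Negation normal forms -/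

namespace Concept

/-- The role depth of a concept, in which a role expression counts with the length of its chains. -/
def depth : Concept → ℕ
  | top => 0
  | bot => 0
  | atom _ => 0
  | neg C => C.depth
  | and C D => max C.depth D.depth
  | or C D => max C.depth D.depth
  | all R C => R.len + C.depth
  | ex R C => R.len + C.depth
  | atLeast _ R C => R.len + C.depth
  | atMost _ R C => R.len + C.depth

/-- The concept is in negation normal form. -/
def IsNNF : Concept → Prop
  | neg (atom _) => True
  | neg _ => False
  | and C D => C.IsNNF ∧ D.IsNNF
  | or C D => C.IsNNF ∧ D.IsNNF
  | all _ _ => False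
  | ex _ _ => False
  | atLeast _ _ C => C.IsNNF
  | atMost _ _ C => C.IsNNF
  | _ => True

theorem depth_nnf_le (C : Concept) (b : Bool) : (C.nnf b).depth ≤ C.depth := by
  induction C generalizing b with
  | atLeast n R C ih => rcases n with _ | n <;> cases b <;> simp [nnf, depth, ih]
  | and C D ihC ihD => cases b <;> exact max_le_max (ihC _) (ihD _)
  | or C D ihC ihD => cases b <;> exact max_le_max (ihC _) (ihD _)
  | _ => cases b <;> simp_all [nnf, depth]

theorem isNNF_nnf (C : Concept) (b : Bool) : (C.nnf b).IsNNF := by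
  induction C generalizing b with
  | atLeast n R C ih => rcases n with _ | n <;> cases b <;> simp [nnf, IsNNF, ih]
  | _ => cases b <;> simp_all [nnf, IsNNF]

theorem WF.nnf {C : Concept} (h : C.WF) (b : Bool) : (C.nnf b).WF := by
  induction C generalizing b with
  | atLeast n R C ih => rcases n with _ | n <;> cases b <;> simp_all [Concept.nnf, WF]
  | _ => cases b <;> simp_all [Concept.nnf, WF]

theorem IsNNF.nnf_eq {C : Concept} (h : C.IsNNF) : C.nnf true = C := by
  induction C with
  | neg C => cases C <;> simp_all [nnf, IsNNF]
  | _ => simp_all [nnf, IsNNF]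

/-- The concepts that the rules may assert on account of the concept: the arguments of a conjunction
or disjunction, and the filler of a number restriction with its negation. -/
def parts : Concept → Finset Concept
  | and C D => {C, D}
  | or C D => {C, D}
  | atLeast _ _ C => {C, C.sim}
  | atMost _ _ C => {C, C.sim}
  | _ => ∅

/-- A set of well-formed concepts in negation normal form that contains the parts of its members. -/
def Closed (F : Finset Concept) : Prop :=
  ∀ E ∈ F, E.IsNNF ∧ E.WF ∧ E.parts ⊆ F

/-- The subconcepts of a concept in negation normal form, and their negations. -/
def closure : Concept → Finset Concept
  | and C D => {and C D, (and C D).sim} ∪ (closure C ∪ closure D)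
  | or C D => {or C D, (or C D).sim} ∪ (closure C ∪ closure D)
  | atLeast n R C => {atLeast n R C, (atLeast n R C).sim} ∪ closure C
  | atMost n R C => {atMost n R C, (atMost n R C).sim} ∪ closure C
  | C => {C, C.sim}

theorem self_mem_closure (C : Concept) : C ∈ C.closure := by
  cases C <;> simp [closure]

theorem sim_mem_closure (C : Concept) : C.sim ∈ C.closure := by
  cases C <;> simp [closure]

theorem Closed.union {F G : Finset Concept} (hF : Closed F) (hG : Closed G) : Closed (F ∪ G) := by
  intro E hE
  rcases Finset.mem_union.1 hE with h | h
  · exact ⟨(hF E h).1, (hF E h).2.1, (hF E h).2.2.trans Finset.subset_union_left⟩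
  · exact ⟨(hG E h).1, (hG E h).2.1, (hG E h).2.2.trans Finset.subset_union_right⟩

theorem Closed.pair_union {F : Finset Concept} (hF : Closed F) {C : Concept} (hC : C.IsNNF)
    (hwf : C.WF) (h : C.parts ⊆ F) (h' : C.sim.parts ⊆ F) : Closed ({C, C.sim} ∪ F) := by
  intro E hE
  simp only [Finset.mem_union, Finset.mem_insert, Finset.mem_singleton] at hE
  rcases hE with (rfl | rfl) | hE
  · exact ⟨hC, hwf, h.trans Finset.subset_union_right⟩
  · exact ⟨isNNF_nnf _ _, hwf.nnf _, h'.trans Finset.subset_union_right⟩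
  · exact ⟨(hF E hE).1, (hF E hE).2.1, (hF E hE).2.2.trans Finset.subset_union_right⟩

theorem closed_closure {C : Concept} (hC : C.IsNNF) (hwf : C.WF) : Closed C.closure := by
  have hbase : ∀ C : Concept, C.IsNNF → C.WF → C.parts = ∅ → C.sim.parts = ∅ →
      Closed {C, C.sim} := by
    intro C hC hwf h h'
    have := Closed.pair_union (F := ∅) (by simp [Closed]) hC hwf (by simp [h]) (by simp [h'])
    simpa using this
  induction C with
  | top => exact hbase _ hC hwf rfl rfl
  | bot => exact hbase _ hC hwf rfl rfl
  | atom a => exact hbase _ hC hwf rfl rfl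
  | neg C =>
    cases C with
    | atom a => exact hbase _ hC hwf rfl rfl
    | _ => simp [IsNNF] at hC
  | all R C => simp [IsNNF] at hC
  | ex R C => simp [IsNNF] at hC
  | and C D ihC ihD =>
    have hC' : C.IsNNF ∧ D.IsNNF := by simpa [IsNNF] using hC
    refine Closed.pair_union ((ihC hC'.1 hwf.1).union (ihD hC'.2 hwf.2)) hC hwf ?_ ?_
    · simp [parts, Finset.insert_subset_iff, self_mem_closure]
    · have e : (and C D).sim = or C.sim D.sim := rfl
      simp [e, parts, Finset.insert_subset_iff, sim_mem_closure]
  | or C D ihC ihD =>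
    have hC' : C.IsNNF ∧ D.IsNNF := by simpa [IsNNF] using hC
    refine Closed.pair_union ((ihC hC'.1 hwf.1).union (ihD hC'.2 hwf.2)) hC hwf ?_ ?_
    · simp [parts, Finset.insert_subset_iff, self_mem_closure]
    · have e : (or C D).sim = and C.sim D.sim := rfl
      simp [e, parts, Finset.insert_subset_iff, sim_mem_closure]
  | atLeast n R C ih =>
    have hC' : C.IsNNF := by simpa [IsNNF] using hC
    refine Closed.pair_union (ih hC' hwf.2) hC hwf ?_ ?_
    · simp [parts, Finset.insert_subset_iff, self_mem_closure, sim_mem_closure]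
    · cases n with
      | zero => simp [sim, nnf, parts]
      | succ n =>
        have e : (atLeast (n + 1) R C).sim = atMost n R C := by simp [sim, nnf, hC'.nnf_eq]
        simp [e, parts, Finset.insert_subset_iff, self_mem_closure, sim_mem_closure]
  | atMost n R C ih =>
    have hC' : C.IsNNF := by simpa [IsNNF] using hC
    refine Closed.pair_union (ih hC' hwf.2) hC hwf ?_ ?_
    · simp [parts, Finset.insert_subset_iff, self_mem_closure, sim_mem_closure]
    · have e : (atMost n R C).sim = atLeast (n + 1) R C := by simp [sim, nnf, hC'.nnf_eq]
      simp [e, parts, Finset.insert_subset_iff, self_mem_closure, sim_mem_closure]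

end Concept

/-! ### Successors under extension and renaming of ABoxes -/

namespace ABox

variable {A B : ABox}

theorem ChainSucc.mono (hAB : A ⊆ B) {ρ : Chain} {x y : ℕ} (h : A.ChainSucc ρ x y) :
    B.ChainSucc ρ x y := by
  induction ρ generalizing x with
  | nil => exact h
  | cons R ρ ih =>
    obtain ⟨z, hz, h⟩ := h
    exact ⟨z, hAB hz, ih h⟩

theorem Succ.mono (hAB : A ⊆ B) {R : RoleExpr} {x y : ℕ} (h : A.Succ R x y) : B.Succ R x y := by
  obtain ⟨K, hK, h⟩ := h
  exact ⟨K, hK, fun ρ hρ => (h ρ hρ).mono hAB⟩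

theorem Diff.mono (hAB : A ⊆ B) {x y : ℕ} (h : A.Diff x y) : B.Diff x y :=
  h.imp (fun h => hAB h) fun h => hAB h

theorem DistinctSuccs.mono (hAB : A ⊆ B) {R : RoleExpr} {C : Concept} {x : ℕ} {Y : Finset ℕ}
    (h : A.DistinctSuccs R C x Y) : B.DistinctSuccs R C x Y :=
  ⟨fun y hy => ⟨(h.1 y hy).1.mono hAB, hAB (h.1 y hy).2⟩,
    fun y hy y' hy' hne => (h.2 y hy y' hy' hne).mono hAB⟩

theorem names_mono (hAB : A ⊆ B) : A.names ⊆ B.names :=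
  Finset.biUnion_subset_biUnion_of_subset_left _ hAB

/-- The renaming that replaces `a` by `b`. -/
def repl (a b v : ℕ) : ℕ := if v = a then b else v

theorem repl_of_ne {a b v : ℕ} (h : v ≠ a) : repl a b v = v := if_neg h

theorem rename_mem_subst {a b : ℕ} {s : Assertion} (h : s ∈ A) :
    s.rename (repl a b) ∈ A.subst a b :=
  Finset.mem_image_of_mem _ h

theorem ChainSucc.subst (a b : ℕ) {ρ : Chain} {x y : ℕ} (h : A.ChainSucc ρ x y) :
    (A.subst a b).ChainSucc ρ (repl a b x) (repl a b y) := by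
  induction ρ generalizing x with
  | nil => exact congrArg _ h
  | cons R ρ ih =>
    obtain ⟨z, hz, h⟩ := h
    exact ⟨_, rename_mem_subst hz, ih h⟩

theorem Succ.subst (a b : ℕ) {R : RoleExpr} {x y : ℕ} (h : A.Succ R x y) :
    (A.subst a b).Succ R (repl a b x) (repl a b y) := by
  obtain ⟨K, hK, h⟩ := h
  exact ⟨K, hK, fun ρ hρ => (h ρ hρ).subst a b⟩

theorem Diff.subst (a b : ℕ) {x y : ℕ} (h : A.Diff x y) :
    (A.subst a b).Diff (repl a b x) (repl a b y) :=
  h.imp (fun h => rename_mem_subst h) fun h => rename_mem_subst h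

theorem Diff.symm {x y : ℕ} (h : A.Diff x y) : A.Diff y x := Or.symm h

/-- Identification of two individuals that are not asserted to be different does not make a set of
explicitly distinct successors smaller. -/
theorem DistinctSuccs.subst {a b : ℕ} (hab : ¬ A.Diff a b) (hne : a ≠ b) {R : RoleExpr}
    {C : Concept} {x : ℕ} {Y : Finset ℕ} (h : A.DistinctSuccs R C x Y) :
    (A.subst a b).DistinctSuccs R C (repl a b x) (Y.image (repl a b)) ∧
      (Y.image (repl a b)).card = Y.card := by
  refine ⟨⟨fun y hy => ?_, fun y hy y' hy' hyy => ?_⟩, Finset.card_image_of_injOn ?_⟩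
  · obtain ⟨y, hyY, rfl⟩ := Finset.mem_image.1 hy
    exact ⟨(h.1 y hyY).1.subst a b, rename_mem_subst (h.1 y hyY).2⟩
  · obtain ⟨y, hyY, rfl⟩ := Finset.mem_image.1 hy
    obtain ⟨y', hyY', rfl⟩ := Finset.mem_image.1 hy'
    exact (h.2 y hyY y' hyY' fun e => hyy (e ▸ rfl)).subst a b
  · have key : a ∈ Y → b ∉ Y := fun ha hb => hab (h.2 a ha b hb hne)
    intro y hy y' hy' e
    simp only [Finset.mem_coe] at hy hy'
    unfold repl at e
    split_ifs at e with h1 h2 h2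
    · rw [h1, h2]
    · subst h1; subst e; exact absurd hy' (key hy)
    · subst h2; subst e; exact absurd hy (key hy')
    · exact e

theorem names_subst {a b : ℕ} (hb : b ∈ A.names) (hne : a ≠ b) :
    (A.subst a b).names ⊆ A.names.erase a := by
  intro v hv
  obtain ⟨s, hs, hv⟩ := Finset.mem_biUnion.1 hv
  obtain ⟨s, hsA, rfl⟩ := Finset.mem_image.1 hs
  have hv' : ∃ u ∈ s.names, v = repl a b u := by
    cases s <;> simpa [Assertion.names, Assertion.rename, repl] using hv
  obtain ⟨u, hu, rfl⟩ := hv'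
  have hu' : u ∈ A.names := Finset.mem_biUnion.2 ⟨s, hsA, hu⟩
  rw [Finset.mem_erase]
  unfold repl
  split_ifs with h
  · exact ⟨hne.symm, hb⟩
  · exact ⟨h, hu'⟩

theorem mem_path {ρ : Chain} {x : ℕ} {w : ℕ → ℕ} {z : ℕ} {s : Assertion} :
    s ∈ path ρ x w z ↔ ∃ k < ρ.length, s = Assertion.role (ρ.getD k 0)
      (if k = 0 then x else w (k - 1)) (if k + 1 = ρ.length then z else w k) := by
  rw [ListABox.path_eq]
  simp [eq_comm, Bool.cond_decide]

theorem chainSucc_of_path {ρ : Chain} (hρ : ρ ≠ []) {x : ℕ} {w : ℕ → ℕ} {z : ℕ}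
    (h : ∀ s ∈ path ρ x w z, s ∈ A) : A.ChainSucc ρ x z := by
  induction ρ generalizing x w with
  | nil => exact absurd rfl hρ
  | cons R ρ ih =>
    cases ρ with
    | nil => exact ⟨z, h _ (by simp [path]), rfl⟩
    | cons R' ρ =>
      rw [path, List.forall_mem_cons] at h
      exact ⟨w 0, h.1, ih (by simp) h.2⟩

section addSuccs

variable {C : Concept} {x : ℕ} {Y : Finset ℕ} {q : ℕ} {K : Fin q → List Chain}
  {fresh : ℕ × ℕ × ℕ → ℕ}

theorem mem_addSuccs {s : Assertion} : s ∈ A.addSuccs C x Y q K fresh ↔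
    s ∈ A ∨
    (∃ (i : Fin q) (j : Fin (K i).length) (k : ℕ), k < ((K i).get j).length ∧
      s = Assertion.role (((K i).get j).getD k 0)
        (if k = 0 then x else fresh (i, j + 1, k - 1))
        (if k + 1 = ((K i).get j).length then fresh (i, 0, 0) else fresh (i, j + 1, k))) ∨
    (∃ i : Fin q, s = Assertion.conc C (fresh (i, 0, 0))) ∨
    (∃ i j : Fin q, i < j ∧ s = Assertion.diff (fresh (i, 0, 0)) (fresh (j, 0, 0))) ∨
    (∃ y ∈ Y, ∃ i : Fin q, s = Assertion.diff y (fresh (i, 0, 0))) := by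
  unfold addSuccs
  simp only [Finset.mem_union, Finset.mem_biUnion, Finset.mem_univ, true_and, List.mem_toFinset,
    mem_path, Finset.mem_image, Finset.mem_filter, Finset.mem_product, and_true, Prod.exists,
    or_assoc, eq_comm (b := s), exists_and_left]

theorem subset_addSuccs : A ⊆ A.addSuccs C x Y q K fresh := fun _ h => mem_addSuccs.2 (Or.inl h)

/-- The new individuals are successors of `x`. -/
theorem succ_addSuccs {R : RoleExpr} (hR : R.WF) (hK : ∀ i, K i ∈ R) (i : Fin q) :
    (A.addSuccs C x Y q K fresh).Succ R x (fresh (i, 0, 0)) := by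
  refine ⟨K i, hK i, fun ρ hρ => ?_⟩
  obtain ⟨j, rfl⟩ := List.get_of_mem hρ
  have hne : (K i).get j ≠ [] := List.ne_nil_of_length_pos <| by
    rw [hR.length_eq (hK i) hρ]; exact hR.len_pos
  refine chainSucc_of_path (w := fun k => fresh (i, j + 1, k)) hne fun s hs => ?_
  obtain ⟨k, hk, rfl⟩ := mem_path.1 hs
  exact mem_addSuccs.2 (Or.inr (Or.inl ⟨i, j, k, hk, rfl⟩))

/-- Together with the old ones, the new individuals are explicitly distinct successors. -/
theorem distinctSuccs_addSuccs {R : RoleExpr} (hR : R.WF) (hK : ∀ i, K i ∈ R)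
    (hinj : Function.Injective fresh) (hfresh : ∀ t, fresh t ∉ A.names)
    (hY : A.DistinctSuccs R C x Y) :
    ∃ Z, (A.addSuccs C x Y q K fresh).DistinctSuccs R C x Z ∧ Z.card = Y.card + q := by
  have hold : ∀ y ∈ Y, ∀ i : Fin q,
      (A.addSuccs C x Y q K fresh).Diff y (fresh (i, 0, 0)) := fun y hy i =>
    Or.inl (mem_addSuccs.2 (Or.inr (Or.inr (Or.inr (Or.inr ⟨y, hy, i, rfl⟩)))))
  have hnew : ∀ i j : Fin q, i < j →
      (A.addSuccs C x Y q K fresh).Diff (fresh (i, 0, 0)) (fresh (j, 0, 0)) := fun i j hij =>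
    Or.inl (mem_addSuccs.2 (Or.inr (Or.inr (Or.inr (Or.inl ⟨i, j, hij, rfl⟩)))))
  refine ⟨Y ∪ Finset.univ.image fun i : Fin q => fresh (i, 0, 0), ⟨fun y hy => ?_,
    fun y hy y' hy' hne => ?_⟩, ?_⟩
  · simp only [Finset.mem_union, Finset.mem_image, Finset.mem_univ, true_and] at hy
    rcases hy with hy | ⟨i, rfl⟩
    · exact (hY.mono subset_addSuccs).1 y hy
    · exact ⟨succ_addSuccs hR hK i, mem_addSuccs.2 (Or.inr (Or.inr (Or.inl ⟨i, rfl⟩)))⟩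
  · simp only [Finset.mem_union, Finset.mem_image, Finset.mem_univ, true_and] at hy hy'
    rcases hy with hy | ⟨i, rfl⟩ <;> rcases hy' with hy' | ⟨j, rfl⟩
    · exact (hY.mono subset_addSuccs).2 y hy y' hy' hne
    · exact hold y hy j
    · exact (hold y' hy' i).symm
    · have hij : i ≠ j := fun e => hne (e ▸ rfl)
      rcases lt_or_gt_of_ne hij with h | h
      · exact hnew i j h
      · exact (hnew j i h).symm
  · rw [Finset.card_union_of_disjoint, Finset.card_image_of_injective, Finset.card_univ,
      Fintype.card_fin]
    · intro i j h
      have := hinj h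
      simpa [Fin.ext_iff] using this
    · rw [Finset.disjoint_left]
      rintro y hy hy'
      obtain ⟨i, -, rfl⟩ := Finset.mem_image.1 hy'
      exact hfresh _ (mem_names_of_conc (hY.1 _ hy).2)

/-- The indices of the individuals that the rule for `∃≥n R` may introduce. -/
def freshIndices (n : ℕ) (R : RoleExpr) : Finset (ℕ × ℕ × ℕ) :=
  Finset.range n ×ˢ Finset.range (R.flatten.length + 1) ×ˢ Finset.range R.len

theorem names_addSuccs {R : RoleExpr} (hR : R.WF) (hK : ∀ i, K i ∈ R) (hx : x ∈ A.names)
    (hY : Y ⊆ A.names) {n : ℕ} (hn : q ≤ n) :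
    (A.addSuccs C x Y q K fresh).names ⊆ A.names ∪ (freshIndices n R).image fresh := by
  have h0 : ∀ i : Fin q, fresh (i, 0, 0) ∈ (freshIndices n R).image fresh := fun i =>
    Finset.mem_image_of_mem _ (by simp [freshIndices, i.2.trans_le hn, hR.len_pos])
  have h1 : ∀ (i : Fin q) (j : Fin (K i).length) (k : ℕ), k < ((K i).get j).length →
      fresh (i, j + 1, k) ∈ (freshIndices n R).image fresh := fun i j k hk => by
    refine Finset.mem_image_of_mem _ ?_
    rw [hR.length_eq (hK i) (List.get_mem _ _)] at hk
    have hj : (j : ℕ) < R.flatten.length :=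
      j.2.trans_le (List.sublist_flatten_of_mem (hK i)).length_le
    simp only [freshIndices, Finset.mem_product, Finset.mem_range]
    exact ⟨i.2.trans_le hn, by omega, hk⟩
  intro v hv
  obtain ⟨s, hs, hv⟩ := Finset.mem_biUnion.1 hv
  rw [Finset.mem_union]
  rcases mem_addSuccs.1 hs with hs | ⟨i, j, k, hk, rfl⟩ | ⟨i, rfl⟩ | ⟨i, j, -, rfl⟩ |
    ⟨y, hy, i, rfl⟩
  · exact Or.inl (Finset.mem_biUnion.2 ⟨s, hs, hv⟩)
  · simp only [Assertion.names, Finset.mem_insert, Finset.mem_singleton] at hv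
    rcases hv with rfl | rfl
    · split_ifs
      · exact Or.inl hx
      · exact Or.inr (h1 i j _ (by omega))
    · split_ifs
      · exact Or.inr (h0 i)
      · exact Or.inr (h1 i j k hk)
  · rw [Assertion.names, Finset.mem_singleton] at hv
    exact Or.inr (hv ▸ h0 i)
  · simp only [Assertion.names, Finset.mem_insert, Finset.mem_singleton] at hv
    rcases hv with rfl | rfl
    · exact Or.inr (h0 i)
    · exact Or.inr (h0 j)
  · simp only [Assertion.names, Finset.mem_insert, Finset.mem_singleton] at hv
    rcases hv with rfl | rfl
    · exact Or.inl (hY hy)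
    · exact Or.inr (h0 i)

end addSuccs

end ABox

/-! ### Termination -/

namespace ABox

/-- `lev` assigns levels to the individuals such that role assertions lead from one level to the
next, and a concept asserted at level `l` belongs to `F` and has at most the role depth `D - l`. -/
structure Layered (F : Finset Concept) (D : ℕ) (A : ABox) (lev : ℕ → ℕ) : Prop where
  conc : ∀ C x, Assertion.conc C x ∈ A → C ∈ F ∧ lev x + C.depth ≤ D
  role : ∀ R x y, Assertion.role R x y ∈ A → lev y = lev x + 1

/-- The concept is an at-least restriction with enough explicitly distinct successors of `x`. -/
def Fulfilled (A : ABox) (E : Concept) (x : ℕ) : Prop :=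
  ∃ n R C Y, E = .atLeast n R C ∧ A.DistinctSuccs R C x Y ∧ n ≤ Y.card

open Classical in
/-- The number of things that may still be done at `x`: concepts may be asserted, and at-least
restrictions fulfilled. -/
noncomputable def todo (F : Finset Concept) (A : ABox) (x : ℕ) : ℕ :=
  (F.filter fun E => Assertion.conc E x ∉ A).card + (F.filter fun E => ¬ A.Fulfilled E x).card

/-- A bound for the number of individuals that one rule application introduces. -/
def maxNew (F : Finset Concept) : ℕ :=
  F.sup fun E => match E with
    | .atLeast n R _ => (freshIndices n R).card
    | _ => 0

/-- The ratio of the weights of consecutive levels. One individual outweighs all the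
individuals of deeper levels that one rule application introduces. -/
def ratio (F : Finset Concept) : ℕ := maxNew F * (1 + 2 * F.card) + 1

/-- The potential of an ABox, which every rule application decreases. -/
noncomputable def potential (F : Finset Concept) (D : ℕ) (A : ABox) (lev : ℕ → ℕ) : ℕ :=
  ∑ x ∈ A.names, ratio F ^ (D - lev x) * (1 + todo F A x)

variable {F : Finset Concept} {D : ℕ} {A B : ABox} {lev : ℕ → ℕ}

theorem ratio_pos : 0 < ratio F := Nat.succ_pos _

theorem todo_le (x : ℕ) : todo F A x ≤ 2 * F.card := by
  have h1 := Finset.card_filter_le F fun E => Assertion.conc E x ∉ A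
  classical
  have h2 := Finset.card_filter_le F fun E => ¬ A.Fulfilled E x
  unfold todo
  convert (add_le_add h1 h2).trans_eq (two_mul _).symm

theorem todo_le_todo {x y : ℕ}
    (h1 : ∀ E ∈ F, Assertion.conc E x ∈ A → Assertion.conc E y ∈ B)
    (h2 : ∀ E ∈ F, A.Fulfilled E x → B.Fulfilled E y) : todo F B y ≤ todo F A x := by
  classical
  unfold todo
  refine add_le_add (Finset.card_le_card fun E hE => ?_) (Finset.card_le_card fun E hE => ?_)
  · rw [Finset.mem_filter] at hE ⊢
    exact ⟨hE.1, fun h => hE.2 (h1 E hE.1 h)⟩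
  · rw [Finset.mem_filter] at hE ⊢
    exact ⟨hE.1, fun h => hE.2 (h2 E hE.1 h)⟩

theorem Fulfilled.mono (hAB : A ⊆ B) {E : Concept} {x : ℕ} (h : A.Fulfilled E x) :
    B.Fulfilled E x := by
  obtain ⟨n, R, C, Y, rfl, hY, hn⟩ := h
  exact ⟨n, R, C, Y, rfl, hY.mono hAB, hn⟩

theorem todo_mono (hAB : A ⊆ B) (x : ℕ) : todo F B x ≤ todo F A x :=
  todo_le_todo (fun _ _ h => hAB h) fun _ _ h => h.mono hAB

theorem todo_lt_of_conc (hAB : A ⊆ B) {x : ℕ} {E : Concept} (hE : E ∈ F)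
    (h : Assertion.conc E x ∉ A) (h' : Assertion.conc E x ∈ B) : todo F B x < todo F A x := by
  classical
  unfold todo
  refine add_lt_add_of_lt_of_le (Finset.card_lt_card ?_) (Finset.card_le_card fun E hE => ?_)
  · refine Finset.ssubset_iff_of_subset (fun E hE => ?_) |>.2 ⟨E, ?_, ?_⟩
    · rw [Finset.mem_filter] at hE ⊢
      exact ⟨hE.1, fun h => hE.2 (hAB h)⟩
    · exact Finset.mem_filter.2 ⟨hE, h⟩
    · exact fun h'' => (Finset.mem_filter.1 h'').2 h'
  · rw [Finset.mem_filter] at hE ⊢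
    exact ⟨hE.1, fun h => hE.2 (h.mono hAB)⟩

theorem todo_lt_of_fulfilled (hAB : A ⊆ B) {x : ℕ} {E : Concept} (hE : E ∈ F)
    (h : ¬ A.Fulfilled E x) (h' : B.Fulfilled E x) : todo F B x < todo F A x := by
  classical
  unfold todo
  refine add_lt_add_of_le_of_lt (Finset.card_le_card fun E hE => ?_) (Finset.card_lt_card ?_)
  · rw [Finset.mem_filter] at hE ⊢
    exact ⟨hE.1, fun h => hE.2 (hAB h)⟩
  · refine Finset.ssubset_iff_of_subset (fun E hE => ?_) |>.2 ⟨E, ?_, ?_⟩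
    · rw [Finset.mem_filter] at hE ⊢
      exact ⟨hE.1, fun h => hE.2 (h.mono hAB)⟩
    · exact Finset.mem_filter.2 ⟨hE, h⟩
    · exact fun h'' => (Finset.mem_filter.1 h'').2 h'

theorem sum_add_le {s : Finset ℕ} {f g : ℕ → ℕ} (h : ∀ v ∈ s, f v ≤ g v) {x c : ℕ} (hx : x ∈ s)
    (hc : f x + c ≤ g x) : ∑ v ∈ s, f v + c ≤ ∑ v ∈ s, g v := by
  rw [← Finset.add_sum_erase s f hx, ← Finset.add_sum_erase s g hx]
  have := Finset.sum_le_sum fun v hv => h v (Finset.mem_of_mem_erase (a := x) hv)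
  omega

/-- If something has been done at `x`, then the individuals of `A` lose at least the
weight of the level of `x`. -/
theorem sum_add_weight_le {lev' : ℕ → ℕ} (hlev : ∀ v ∈ A.names, lev' v = lev v)
    (hle : ∀ v ∈ A.names, todo F B v ≤ todo F A v) {x : ℕ} (hx : x ∈ A.names)
    (hlt : todo F B x < todo F A x) :
    ∑ v ∈ A.names, ratio F ^ (D - lev' v) * (1 + todo F B v) + ratio F ^ (D - lev x) ≤
      potential F D A lev := by
  refine sum_add_le (fun v hv => ?_) hx ?_
  · rw [hlev v hv]
    exact Nat.mul_le_mul_left _ (Nat.add_le_add_left (hle v hv) _)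
  · rw [hlev x hx, ← Nat.mul_succ]
    exact Nat.mul_le_mul_left _ (by omega)

theorem names_union_of_conc {S : Finset Assertion} {x : ℕ} (hx : x ∈ A.names)
    (hS : ∀ s ∈ S, ∃ E, s = Assertion.conc E x) : (A ∪ S).names = A.names := by
  refine subset_antisymm (fun v hv => ?_) (names_mono Finset.subset_union_left)
  obtain ⟨s, hs, hv⟩ := Finset.mem_biUnion.1 hv
  rcases Finset.mem_union.1 hs with hs | hs
  · exact Finset.mem_biUnion.2 ⟨s, hs, hv⟩
  · obtain ⟨E, rfl⟩ := hS s hs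
    rw [Assertion.names, Finset.mem_singleton] at hv
    rwa [hv]

/-- The rules that assert further concepts of an individual decrease the potential. -/
theorem Layered.union_conc (h : Layered F D A lev) {S : Finset Assertion} {x : ℕ}
    (hx : x ∈ A.names)
    (hS : ∀ s ∈ S, ∃ E, s = Assertion.conc E x ∧ E ∈ F ∧ lev x + E.depth ≤ D)
    (hnew : ∃ s ∈ S, s ∉ A) :
    Layered F D (A ∪ S) lev ∧ potential F D (A ∪ S) lev < potential F D A lev := by
  refine ⟨⟨fun C y hy => ?_, fun R y z hy => ?_⟩, ?_⟩
  · rcases Finset.mem_union.1 hy with hy | hy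
    · exact h.conc C y hy
    · obtain ⟨E, he, hE⟩ := hS _ hy
      cases he
      exact hE
  · rcases Finset.mem_union.1 hy with hy | hy
    · exact h.role R y z hy
    · obtain ⟨E, he, -⟩ := hS _ hy
      cases he
  · obtain ⟨s, hs, hsA⟩ := hnew
    obtain ⟨E, rfl, hE, -⟩ := hS s hs
    have hsub : A ⊆ A ∪ S := Finset.subset_union_left
    have := sum_add_weight_le (D := D) (lev := lev) (lev' := lev) (fun _ _ => rfl)
      (fun v _ => todo_mono hsub v) hx
      (todo_lt_of_conc hsub hE hsA (Finset.mem_union_right _ hs))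
    have hpos : 0 < ratio F ^ (D - lev x) := pow_pos ratio_pos _
    unfold potential at *
    rw [names_union_of_conc hx fun s hs => (hS s hs).imp fun _ h => h.1]
    omega

theorem Layered.chainSucc (h : Layered F D A lev) {ρ : Chain} {x y : ℕ}
    (hs : A.ChainSucc ρ x y) : lev y = lev x + ρ.length := by
  induction ρ generalizing x with
  | nil => cases hs; rfl
  | cons R ρ ih =>
    obtain ⟨z, hz, hs⟩ := hs
    rw [ih hs, h.role R x z hz, List.length_cons]
    omega

/-- As all the chains of a role expression have the same length, all the successors are on one
level. -/
theorem Layered.succ (h : Layered F D A lev) {R : RoleExpr} (hR : R.WF) {x y : ℕ}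
    (hs : A.Succ R x y) : lev y = lev x + R.len := by
  obtain ⟨K, hK, hs⟩ := hs
  obtain ⟨ρ, hρ, -⟩ := hR.exists_chain hK
  rw [h.chainSucc (hs ρ hρ), hR.length_eq hK hρ]

/-- The identification of two individuals of one level decreases the potential. -/
theorem Layered.subst (h : Layered F D A lev) {a b : ℕ} (ha : a ∈ A.names) (hb : b ∈ A.names)
    (hne : a ≠ b) (hab : ¬ A.Diff a b) (hlev : lev a = lev b) :
    Layered F D (A.subst a b) lev ∧ potential F D (A.subst a b) lev < potential F D A lev := by
  have hl : ∀ v, lev (repl a b v) = lev v := fun v => by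
    unfold repl
    split_ifs with hv
    · rw [hv, hlev]
    · rfl
  refine ⟨⟨fun C y hy => ?_, fun R y z hy => ?_⟩, ?_⟩
  · obtain ⟨s, hs, he⟩ := Finset.mem_image.1 hy
    cases s with
    | conc C' y' =>
      simp only [Assertion.rename, Assertion.conc.injEq] at he
      obtain ⟨rfl, rfl⟩ := he
      have := hl y'
      unfold repl at this
      rw [this]
      exact h.conc _ _ hs
    | _ => simp [Assertion.rename] at he
  · obtain ⟨s, hs, he⟩ := Finset.mem_image.1 hy
    cases s with
    | role R' y' z' =>
      simp only [Assertion.rename, Assertion.role.injEq] at he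
      obtain ⟨rfl, rfl, rfl⟩ := he
      have h1 := hl y'
      have h2 := hl z'
      unfold repl at h1 h2
      rw [h1, h2]
      exact h.role _ _ _ hs
    | _ => simp [Assertion.rename] at he
  · have hle : ∀ v ∈ A.names.erase a, ratio F ^ (D - lev v) * (1 + todo F (A.subst a b) v) ≤
        ratio F ^ (D - lev v) * (1 + todo F A v) := fun v hv => by
      have hv' : repl a b v = v := repl_of_ne (Finset.ne_of_mem_erase hv)
      refine Nat.mul_le_mul_left _ (Nat.add_le_add_left (todo_le_todo (fun E _ hE => ?_)
        fun E _ hE => ?_) _)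
      · have := rename_mem_subst (a := a) (b := b) hE
        rwa [Assertion.rename, hv'] at this
      · obtain ⟨n, R, C, Y, rfl, hY, hn⟩ := hE
        obtain ⟨h1, h2⟩ := hY.subst hab hne
        rw [hv'] at h1
        exact ⟨n, R, C, _, rfl, h1, h2 ▸ hn⟩
    have hpos : 0 < ratio F ^ (D - lev a) * (1 + todo F A a) :=
      Nat.mul_pos (pow_pos ratio_pos _) (by omega)
    calc potential F D (A.subst a b) lev
        ≤ ∑ v ∈ A.names.erase a, ratio F ^ (D - lev v) * (1 + todo F (A.subst a b) v) :=
          Finset.sum_le_sum_of_subset (names_subst hb hne)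
      _ ≤ ∑ v ∈ A.names.erase a, ratio F ^ (D - lev v) * (1 + todo F A v) :=
          Finset.sum_le_sum hle
      _ < ratio F ^ (D - lev a) * (1 + todo F A a) +
          ∑ v ∈ A.names.erase a, ratio F ^ (D - lev v) * (1 + todo F A v) := by omega
      _ = potential F D A lev := Finset.add_sum_erase A.names
          (fun v => ratio F ^ (D - lev v) * (1 + todo F A v)) ha

/-- The levels after new successors of an individual of level `l` have been added by chains of
length `m`. -/
noncomputable def extendLevels (lev : ℕ → ℕ) (fresh : ℕ × ℕ × ℕ → ℕ) (l m : ℕ) : ℕ → ℕ :=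
  Function.extend fresh (fun t => if t.2.1 = 0 then l + m else l + t.2.2 + 1) lev

/-- The rule for at-least restrictions decreases the potential: an unfulfilled restriction becomes
fulfilled, and the new individuals are on deeper levels. -/
theorem Layered.addSuccs (hF : Concept.Closed F) (h : Layered F D A lev) {n : ℕ} {R : RoleExpr}
    {C : Concept} {x : ℕ} (hmem : Assertion.conc (.atLeast n R C) x ∈ A) {Y : Finset ℕ}
    (hY : A.DistinctSuccs R C x Y) (hmax : ∀ Y', A.DistinctSuccs R C x Y' → Y'.card ≤ Y.card)
    (hlt : Y.card < n) {fresh : ℕ × ℕ × ℕ → ℕ} (hinj : Function.Injective fresh)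
    (hfresh : ∀ t, fresh t ∉ A.names) {K : Fin (n - Y.card) → List Chain} (hK : ∀ i, K i ∈ R) :
    ∃ lev', Layered F D (A.addSuccs C x Y (n - Y.card) K fresh) lev' ∧
      potential F D (A.addSuccs C x Y (n - Y.card) K fresh) lev' < potential F D A lev := by
  obtain ⟨hE, hD⟩ := h.conc _ _ hmem
  obtain ⟨-, ⟨hR, -⟩, hparts⟩ := hF _ hE
  have hCF : C ∈ F := hparts (by simp [Concept.parts])
  rw [Concept.depth] at hD
  have hm := hR.len_pos
  have hx : x ∈ A.names := mem_names_of_conc hmem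
  have hYA : Y ⊆ A.names := fun y hy => mem_names_of_conc (hY.1 y hy).2
  have hold : ∀ v ∈ A.names, extendLevels lev fresh (lev x) R.len v = lev v := fun v hv =>
    Function.extend_apply' _ _ _ (by rintro ⟨t, rfl⟩; exact hfresh t hv)
  have hnew : ∀ t, extendLevels lev fresh (lev x) R.len (fresh t) =
      if t.2.1 = 0 then lev x + R.len else lev x + t.2.2 + 1 := fun t =>
    hinj.extend_apply _ _ _
  have hsub : A ⊆ A.addSuccs C x Y (n - Y.card) K fresh := subset_addSuccs
  refine ⟨extendLevels lev fresh (lev x) R.len, ⟨fun C' y hy => ?_, fun R' y z hy => ?_⟩, ?_⟩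
  · rcases mem_addSuccs.1 hy with hy | ⟨i, j, k, hk, he⟩ | ⟨i, he⟩ | ⟨i, j, -, he⟩ | ⟨y, -, i, he⟩
    · rw [hold y (mem_names_of_conc hy)]
      exact h.conc _ _ hy
    · cases he
    · cases he
      rw [hnew, if_pos rfl]
      exact ⟨hCF, by omega⟩
    · cases he
    · cases he
  · rcases mem_addSuccs.1 hy with hy | ⟨i, j, k, hk, he⟩ | ⟨i, he⟩ | ⟨i, j, -, he⟩ | ⟨y, -, i, he⟩
    · rw [hold y (mem_names_of_role hy).1, hold z (mem_names_of_role hy).2]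
      exact h.role _ _ _ hy
    · simp only [Assertion.role.injEq] at he
      obtain ⟨-, rfl, rfl⟩ := he
      rw [hR.length_eq (hK i) (List.get_mem _ _)] at hk ⊢
      have h1 : extendLevels lev fresh (lev x) R.len
          (if k = 0 then x else fresh (i, j + 1, k - 1)) = lev x + k := by
        split_ifs with hk0
        · rw [hold x hx, hk0, add_zero]
        · rw [hnew, if_neg (by simp)]
          simp only
          omega
      have h2 : extendLevels lev fresh (lev x) R.len
          (if k + 1 = R.len then fresh (i, 0, 0) else fresh (i, j + 1, k)) = lev x + k + 1 := by
        split_ifs with hk1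
        · rw [hnew, if_pos rfl]
          omega
        · rw [hnew, if_neg (by simp)]
      rw [h1, h2]
    · cases he
    · cases he
    · cases he
  · have hnot : ¬ A.Fulfilled (.atLeast n R C) x := by
      rintro ⟨n', R', C', Y', he, hY', hn'⟩
      cases he
      exact absurd (hn'.trans (hmax _ hY')) (not_le.2 hlt)
    have hful : (A.addSuccs C x Y (n - Y.card) K fresh).Fulfilled (.atLeast n R C) x := by
      obtain ⟨Z, hZ, hc⟩ := distinctSuccs_addSuccs hR hK hinj hfresh hY
      exact ⟨n, R, C, Z, rfl, hZ, by omega⟩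
    have hsum := sum_add_weight_le (D := D) (lev := lev) hold (fun v _ => todo_mono hsub v) hx
      (todo_lt_of_fulfilled hsub hE hnot hful)
    set B := A.addSuccs C x Y (n - Y.card) K fresh with hB
    set lev' := extendLevels lev fresh (lev x) R.len with hlev'
    have hcard : ((freshIndices n R).image fresh).card ≤ maxNew F :=
      Finset.card_image_le.trans (Finset.le_sup (f := fun E => match E with
        | .atLeast n R _ => (freshIndices n R).card
        | _ => 0) hE)
    have hsmall : ∑ v ∈ (freshIndices n R).image fresh,
        ratio F ^ (D - lev' v) * (1 + todo F B v) < ratio F ^ (D - lev x) := by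
      have hle : ∀ v ∈ (freshIndices n R).image fresh,
          ratio F ^ (D - lev' v) * (1 + todo F B v) ≤
            ratio F ^ (D - lev x - 1) * (1 + 2 * F.card) := fun v hv => by
        obtain ⟨t, -, rfl⟩ := Finset.mem_image.1 hv
        refine Nat.mul_le_mul (Nat.pow_le_pow_right ratio_pos ?_)
          (Nat.add_le_add_left (todo_le _) _)
        rw [hnew]
        split_ifs <;> omega
      have hexp : D - lev x = (D - lev x - 1) + 1 := by omega
      calc _ ≤ ((freshIndices n R).image fresh).card *
            (ratio F ^ (D - lev x - 1) * (1 + 2 * F.card)) := by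
            simpa using Finset.sum_le_card_nsmul _ _ _ hle
        _ ≤ maxNew F * (ratio F ^ (D - lev x - 1) * (1 + 2 * F.card)) :=
            Nat.mul_le_mul_right _ hcard
        _ = ratio F ^ (D - lev x - 1) * (maxNew F * (1 + 2 * F.card)) := by ring
        _ < ratio F ^ (D - lev x - 1) * ratio F :=
            Nat.mul_lt_mul_of_pos_left (Nat.lt_succ_self _) (pow_pos ratio_pos _)
        _ = ratio F ^ (D - lev x) := by rw [← pow_succ, ← hexp]
    calc potential F D B lev'
        ≤ ∑ v ∈ A.names ∪ (freshIndices n R).image fresh,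
            ratio F ^ (D - lev' v) * (1 + todo F B v) :=
          Finset.sum_le_sum_of_subset (names_addSuccs hR hK hx hYA (Nat.sub_le _ _))
      _ ≤ ∑ v ∈ A.names, ratio F ^ (D - lev' v) * (1 + todo F B v) +
          ∑ v ∈ (freshIndices n R).image fresh, ratio F ^ (D - lev' v) * (1 + todo F B v) := by
          rw [← Finset.sum_union_inter]
          exact Nat.le_add_right _ _
      _ < potential F D A lev := by omega

/-- Every rule application decreases the potential. -/
theorem Layered.step (hF : Concept.Closed F) (h : Layered F D A lev) (hs : A.Step B) :
    ∃ lev', Layered F D B lev' ∧ potential F D B lev' < potential F D A lev := by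
  obtain ⟨S, hr, hB⟩ := hs
  cases hr with
  | and C E x hmem hnot =>
    rw [Set.mem_singleton_iff] at hB
    subst hB
    obtain ⟨hCE, hD⟩ := h.conc _ _ hmem
    have hp := (hF _ hCE).2.2
    rw [Concept.depth] at hD
    refine ⟨lev, h.union_conc (mem_names_of_conc hmem) (fun s hs => ?_) ?_⟩
    · simp only [Finset.mem_insert, Finset.mem_singleton] at hs
      rcases hs with rfl | rfl
      · exact ⟨C, rfl, hp (by simp [Concept.parts]), by omega⟩
      · exact ⟨E, rfl, hp (by simp [Concept.parts]), by omega⟩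
    · rw [not_and_or] at hnot
      rcases hnot with hn | hn
      · exact ⟨_, by simp, hn⟩
      · exact ⟨Assertion.conc E x, by simp, hn⟩
  | or C E x hmem hC hE =>
    obtain ⟨hCE, hD⟩ := h.conc _ _ hmem
    have hp := (hF _ hCE).2.2
    rw [Concept.depth] at hD
    rcases hB with rfl | rfl
    · refine ⟨lev, h.union_conc (mem_names_of_conc hmem) (fun s hs => ?_) ⟨_, by simp, hC⟩⟩
      rw [Finset.mem_singleton] at hs
      exact ⟨C, hs, hp (by simp [Concept.parts]), by omega⟩
    · refine ⟨lev, h.union_conc (mem_names_of_conc hmem) (fun s hs => ?_) ⟨_, by simp, hE⟩⟩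
      rw [Finset.mem_singleton] at hs
      exact ⟨E, hs, hp (by simp [Concept.parts]), by omega⟩
  | atLeast n R C x hmem Y hY hmax hlt fresh hinj hfresh =>
    obtain ⟨K, hK, rfl⟩ := hB
    exact h.addSuccs hF hmem hY hmax hlt hinj hfresh hK
  | atMost n R C x hmem p hp y hinj hy hpair =>
    obtain ⟨i, j, hij, hd, rfl⟩ := hB
    have hR : R.WF := (hF _ (h.conc _ _ hmem).1).2.1.1
    refine ⟨lev, h.subst (mem_names_of_conc (hy i).2) (mem_names_of_conc (hy j).2)
      (hinj.ne hij.ne) hd ?_⟩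
    rw [h.succ hR (hy i).1, h.succ hR (hy j).1]
  | choose n R C x y hmem hy hC hC' =>
    have key : R.WF ∧ C ∈ F ∧ C.sim ∈ F ∧ lev x + (R.len + C.depth) ≤ D := by
      rcases hmem with hmem | hmem <;>
      · obtain ⟨hE, hD⟩ := h.conc _ _ hmem
        obtain ⟨-, hwf, hp⟩ := hF _ hE
        exact ⟨hwf.1, hp (by simp [Concept.parts]), hp (by simp [Concept.parts]), hD⟩
    obtain ⟨hR, hCF, hsF, hD⟩ := key
    have hl := h.succ hR hy
    have hdep := C.depth_nnf_le false
    rcases hB with rfl | rfl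
    · refine ⟨lev, h.union_conc (hy.mem_names hR) (fun s hs => ?_) ⟨_, by simp, hC⟩⟩
      rw [Finset.mem_singleton] at hs
      exact ⟨C, hs, hCF, by omega⟩
    · refine ⟨lev, h.union_conc (hy.mem_names hR) (fun s hs => ?_) ⟨_, by simp, hC'⟩⟩
      rw [Finset.mem_singleton] at hs
      exact ⟨C.sim, hs, hsF, by unfold Concept.sim; omega⟩

end ABox

open ABox

/-- The finite set of all the concepts that a run of the algorithm on `C` may assert. -/
def concepts (C : Concept) : Finset Concept := (C.nnf true).closure

theorem closed_concepts {C : Concept} (hC : C.WF) : Concept.Closed (concepts C) :=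
  Concept.closed_closure (Concept.isNNF_nnf _ _) (hC.nnf _)

theorem layered_initial (C : Concept) :
    Layered (concepts C) (C.nnf true).depth (initial C) fun _ => 0 := by
  refine ⟨fun E x h => ?_, fun R x y h => ?_⟩
  · simp only [initial, Finset.mem_singleton, Assertion.conc.injEq] at h
    rw [h.1]
    exact ⟨Concept.self_mem_closure _, by simp⟩
  · simp [initial] at h

/-- Reachable ABoxes: they are layered, their potential is at most `N`, and they still assert the
normal form of the input concept. -/
def Reach (C : Concept) (A : ABox) (N : ℕ) : Prop :=
  (∃ lev, Layered (concepts C) (C.nnf true).depth A lev ∧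
    potential (concepts C) (C.nnf true).depth A lev ≤ N) ∧
  ∃ x, Assertion.conc (C.nnf true) x ∈ A

theorem exists_reach_initial (C : Concept) : ∃ N, Reach C (initial C) N :=
  ⟨_, ⟨_, layered_initial C, le_rfl⟩, 0, by simp [initial]⟩

theorem ABox.Step.exists_conc {A B : ABox} (h : A.Step B) {C : Concept}
    (hC : ∃ x, Assertion.conc C x ∈ A) : ∃ x, Assertion.conc C x ∈ B := by
  obtain ⟨S, hr, hB⟩ := h
  obtain ⟨x, hx⟩ := hC
  cases hr with
  | and => exact ⟨x, by rw [hB]; exact Finset.mem_union_left _ hx⟩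
  | or => rcases hB with rfl | rfl <;> exact ⟨x, Finset.mem_union_left _ hx⟩
  | atLeast => obtain ⟨K, -, rfl⟩ := hB; exact ⟨x, subset_addSuccs hx⟩
  | atMost => obtain ⟨i, j, -, -, rfl⟩ := hB; exact ⟨_, rename_mem_subst hx⟩
  | choose => rcases hB with rfl | rfl <;> exact ⟨x, Finset.mem_union_left _ hx⟩

theorem Reach.step {C : Concept} (hC : C.WF) {A B : ABox} {N : ℕ} (h : Reach C A N)
    (hs : A.Step B) : ∃ M < N, Reach C B M := by
  obtain ⟨⟨lev, hl, hN⟩, hx⟩ := h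
  obtain ⟨lev', hl', hlt⟩ := hl.step (closed_concepts hC) hs
  exact ⟨_, hlt.trans_le hN, ⟨lev', hl', le_rfl⟩, hs.exists_conc hx⟩

theorem terminates {C : Concept} (hC : C.WF) : Terminates C := by
  rintro ⟨A, h0, hA⟩
  have key : ∀ N k, ¬ Reach C (A k) N := by
    intro N
    induction N using Nat.strong_induction_on with
    | _ N ih =>
      intro k h
      obtain ⟨M, hM, h'⟩ := h.step hC (hA k)
      exact ih M hM _ h'
  obtain ⟨N, hN⟩ := exists_reach_initial C
  exact key N 0 (h0 ▸ hN)

/-! ### Soundness and completeness -/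

/-- The nesting depth of the constructors other than negation. -/
def Concept.height : Concept → ℕ
  | .neg C => C.height
  | .and C D => max C.height D.height + 1
  | .or C D => max C.height D.height + 1
  | .all _ C => C.height + 1
  | .ex _ C => C.height + 1
  | .atLeast _ _ C => C.height + 1
  | .atMost _ _ C => C.height + 1
  | _ => 0

theorem Concept.height_nnf_le (C : Concept) (b : Bool) : (C.nnf b).height ≤ C.height := by
  induction C generalizing b with
  | atLeast n R C ih => rcases n with _ | n <;> cases b <;> simp [nnf, height, ih]
  | and C D ihC ihD => cases b <;> exact Nat.succ_le_succ (max_le_max (ihC _) (ihD _))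
  | or C D ihC ihD => cases b <;> exact Nat.succ_le_succ (max_le_max (ihC _) (ihD _))
  | _ => cases b <;> simp_all [nnf, height]

namespace Interpretation

variable (I : Interpretation.{u})

theorem ext_nnf (C : Concept) : I.ext (C.nnf true) = I.ext C ∧ I.ext (C.nnf false) = (I.ext C)ᶜ := by
  have hlt : ∀ (n : ℕ) (a : ℕ∞), ¬ ((n : ℕ∞) + 1 ≤ a) ↔ a ≤ n := fun n a => by
    rw [← not_iff_not, not_not, not_le, ENat.add_one_le_iff (ENat.natCast_ne_top n)]
  induction C with
  | top => simp [Concept.nnf, ext]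
  | bot => simp [Concept.nnf, ext]
  | atom a => simp [Concept.nnf, ext]
  | neg C ih => simp [Concept.nnf, ext, ih.1, ih.2]
  | and C D ihC ihD => simp [Concept.nnf, ext, ihC, ihD, Set.compl_inter]
  | or C D ihC ihD => simp [Concept.nnf, ext, ihC, ihD, Set.compl_union]
  | all R C ih =>
    have e : ∀ x, {y | I.roleExt R x y ∧ y ∉ I.ext C} = ∅ ↔ ∀ y, I.roleExt R x y → y ∈ I.ext C :=
      fun x => by simp [Set.eq_empty_iff_forall_notMem]
    constructor
    · ext x
      simp [Concept.nnf, ext, ih.2, e]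
    · ext x
      simp only [Concept.nnf, ext, ih.2, Set.mem_ofPred_eq, Set.mem_compl_iff, ← e]
      simp [Set.nonempty_iff_ne_empty, Set.one_le_encard_iff_nonempty]
  | ex R C ih =>
    have e : ∀ x, {y | I.roleExt R x y ∧ y ∈ I.ext C} = ∅ ↔ ¬ ∃ y, I.roleExt R x y ∧ y ∈ I.ext C :=
      fun x => by simp [Set.eq_empty_iff_forall_notMem]
    constructor
    · ext x
      simp only [Concept.nnf, ext, ih.1, Set.mem_ofPred_eq]
      rw [← not_iff_not, ← e]
      simp [Set.nonempty_iff_ne_empty, Set.one_le_encard_iff_nonempty]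
    · ext x
      simp only [Concept.nnf, ext, ih.1, Set.mem_ofPred_eq, Set.mem_compl_iff, ← e]
      simp
  | atLeast n R C ih =>
    cases n with
    | zero => simp [Concept.nnf, ext]
    | succ n =>
      refine ⟨by simp [Concept.nnf, ext, ih.1], ?_⟩
      ext x
      simp only [Concept.nnf, ext, ih.1, Set.mem_ofPred_eq, Set.mem_compl_iff, Nat.cast_add,
        Nat.cast_one, hlt]
  | atMost n R C ih =>
    refine ⟨by simp [Concept.nnf, ext, ih.1], ?_⟩
    ext x
    simp only [Concept.nnf, ext, ih.1, Set.mem_ofPred_eq, Set.mem_compl_iff, Nat.cast_add,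
      Nat.cast_one, ← hlt, not_not]

theorem ext_sim (C : Concept) : I.ext C.sim = (I.ext C)ᶜ := (I.ext_nnf C).2

/-- The assertion holds if the individuals are interpreted by `f`. -/
def Holds (f : ℕ → I.Dom) : Assertion → Prop
  | .conc C x => f x ∈ I.ext C
  | .role R x y => I.role R (f x) (f y)
  | .diff x y => f x ≠ f y

variable {I}

theorem Holds.congr {f g : ℕ → I.Dom} {s : Assertion} (h : I.Holds f s)
    (hfg : ∀ x ∈ s.names, g x = f x) : I.Holds g s := by
  cases s with
  | conc C x => rw [Holds, hfg x (by simp [Assertion.names])]; exact h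
  | role R x y =>
    rw [Holds, hfg x (by simp [Assertion.names]), hfg y (by simp [Assertion.names])]; exact h
  | diff x y =>
    rw [Holds, hfg x (by simp [Assertion.names]), hfg y (by simp [Assertion.names])]; exact h

theorem chainExt_of_chainSucc {f : ℕ → I.Dom} {A : ABox} (hA : ∀ s ∈ A, I.Holds f s) {ρ : Chain}
    {x y : ℕ} (h : A.ChainSucc ρ x y) : I.chainExt ρ (f x) (f y) := by
  induction ρ generalizing x with
  | nil => exact congrArg f h
  | cons R ρ ih =>
    obtain ⟨z, hz, h⟩ := h
    exact ⟨f z, hA _ hz, ih h⟩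

theorem roleExt_of_succ {f : ℕ → I.Dom} {A : ABox} (hA : ∀ s ∈ A, I.Holds f s) {R : RoleExpr}
    {x y : ℕ} (h : A.Succ R x y) : I.roleExt R (f x) (f y) := by
  obtain ⟨K, hK, h⟩ := h
  exact ⟨K, hK, fun ρ hρ => chainExt_of_chainSucc hA (h ρ hρ)⟩

theorem ne_of_diff {f : ℕ → I.Dom} {A : ABox} (hA : ∀ s ∈ A, I.Holds f s) {x y : ℕ}
    (h : A.Diff x y) : f x ≠ f y := by
  rcases h with h | h
  · exact hA _ h
  · exact (hA _ h : f y ≠ f x).symm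

theorem injOn_of_distinctSuccs {f : ℕ → I.Dom} {A : ABox} (hA : ∀ s ∈ A, I.Holds f s)
    {R : RoleExpr} {C : Concept} {x : ℕ} {Y : Finset ℕ} (h : A.DistinctSuccs R C x Y) :
    Set.InjOn f Y := by
  intro y hy y' hy' e
  by_contra hne
  exact ne_of_diff hA (h.2 y hy y' hy' hne) e

theorem image_subset_of_distinctSuccs {f : ℕ → I.Dom} {A : ABox} (hA : ∀ s ∈ A, I.Holds f s)
    {R : RoleExpr} {C : Concept} {x : ℕ} {Y : Finset ℕ} (h : A.DistinctSuccs R C x Y) :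
    f '' Y ⊆ {d | I.roleExt R (f x) d ∧ d ∈ I.ext C} := by
  rintro _ ⟨y, hy, rfl⟩
  exact ⟨roleExt_of_succ hA (h.1 y hy).1, hA _ (h.1 y hy).2⟩

/-- A chain between two elements is witnessed by a sequence of elements. -/
theorem exists_path_of_chainExt {ρ : Chain} {d e : I.Dom} (h : I.chainExt ρ d e) :
    ∃ w : ℕ → I.Dom, w 0 = d ∧ w ρ.length = e ∧
      ∀ k < ρ.length, I.role (ρ.getD k 0) (w k) (w (k + 1)) := by
  induction ρ generalizing d with
  | nil => exact ⟨fun _ => d, rfl, h, by simp⟩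
  | cons R ρ ih =>
    obtain ⟨z, hz, h⟩ := h
    obtain ⟨w, h0, h1, h2⟩ := ih h
    refine ⟨fun k => Nat.casesOn k d w, rfl, h1, fun k hk => ?_⟩
    cases k with
    | zero => simpa [h0] using hz
    | succ k => simpa using h2 k (by simpa using hk)

end Interpretation

namespace ABox

variable {I : Interpretation.{u}} {f : ℕ → I.Dom} {A : ABox}

theorem not_clash_of_holds (hA : ∀ s ∈ A, I.Holds f s) : ¬ A.Clash := by
  rintro (⟨x, h⟩ | ⟨a, x, h, h'⟩ | ⟨n, R, C, x, Y, h, hY, hn⟩)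
  · exact hA _ h
  · exact (hA _ h' : f x ∉ _) (hA _ h)
  · have h1 : Set.encard _ ≤ (n : ℕ∞) := hA _ h
    have h2 := (Set.encard_le_encard (Interpretation.image_subset_of_distinctSuccs hA hY)).trans h1
    rw [(Interpretation.injOn_of_distinctSuccs hA hY).encard_image,
      Set.encard_coe_eq_coe_finsetCard] at h2
    exact absurd (Nat.cast_le.1 h2) (not_le.2 hn)

/-- The rule for at-least restrictions preserves satisfiability: the new individuals are interpreted
by successors that interpret no individual of `Y`, and by elements on chains to them. -/
theorem exists_holds_addSuccs (hA : ∀ s ∈ A, I.Holds f s) {n : ℕ} {R : RoleExpr} {C : Concept}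
    {x : ℕ} (hmem : Assertion.conc (.atLeast n R C) x ∈ A) {Y : Finset ℕ}
    (hY : A.DistinctSuccs R C x Y) {fresh : ℕ × ℕ × ℕ → ℕ} (hinj : Function.Injective fresh)
    (hfresh : ∀ t, fresh t ∉ A.names) :
    ∃ K : Fin (n - Y.card) → List Chain, (∀ i, K i ∈ R) ∧
      ∃ g : ℕ → I.Dom, ∀ s ∈ A.addSuccs C x Y (n - Y.card) K fresh, I.Holds g s := by
  classical
  have hn : (n : ℕ∞) ≤ {d | I.roleExt R (f x) d ∧ d ∈ I.ext C}.encard := hA _ hmem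
  have hcard : ((n - Y.card : ℕ) : ℕ∞) ≤
      ({d | I.roleExt R (f x) d ∧ d ∈ I.ext C} \ f '' Y).encard := by
    have h1 := Set.encard_sdiff_add_encard_of_subset
      (Interpretation.image_subset_of_distinctSuccs hA hY)
    rw [(Interpretation.injOn_of_distinctSuccs hA hY).encard_image,
      Set.encard_coe_eq_coe_finsetCard] at h1
    rw [← h1] at hn
    rw [ENat.natCast_sub]
    exact tsub_le_iff_right.2 hn
  obtain ⟨Z, hZ, hZc⟩ := Set.exists_subset_encard_eq hcard
  have hZf : Z.Finite := Set.finite_of_encard_eq_coe hZc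
  have hZn : hZf.toFinset.card = n - Y.card := by
    rw [hZf.encard_eq_coe_toFinset_card] at hZc
    exact_mod_cast hZc
  -- `d i` interprets the `i`-th new successor
  let d : Fin (n - Y.card) → I.Dom := fun i => (hZf.toFinset.equivFinOfCardEq hZn).symm i
  have hdinj : Function.Injective d := fun i j h =>
    (hZf.toFinset.equivFinOfCardEq hZn).symm.injective (Subtype.ext h)
  have hdZ : ∀ i, d i ∈ {d | I.roleExt R (f x) d ∧ d ∈ I.ext C} \ f '' Y := fun i =>
    hZ (hZf.mem_toFinset.1 ((hZf.toFinset.equivFinOfCardEq hZn).symm i).2)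
  choose K hK hKext using fun i => (hdZ i).1.1
  choose w hw0 hw1 hw using fun (i : Fin (n - Y.card)) (j : Fin (K i).length) =>
    Interpretation.exists_path_of_chainExt (hKext i _ (List.get_mem (K i) j))
  let v : ℕ × ℕ × ℕ → I.Dom := fun t =>
    if hi : t.1 < n - Y.card then
      if t.2.1 = 0 then d ⟨t.1, hi⟩
      else if hj : t.2.1 - 1 < (K ⟨t.1, hi⟩).length then w ⟨t.1, hi⟩ ⟨t.2.1 - 1, hj⟩ (t.2.2 + 1)
      else f x
    else f x
  have hv0 : ∀ i : Fin (n - Y.card), v (i, 0, 0) = d i := fun i => by simp [v]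
  have hv1 : ∀ (i : Fin (n - Y.card)) (j : Fin (K i).length) (k : ℕ),
      v (i, j + 1, k) = w i j (k + 1) := fun i j k => by simp [v]
  let g : ℕ → I.Dom := Function.extend fresh v f
  have hg : ∀ t, g (fresh t) = v t := fun t => hinj.extend_apply _ _ _
  have hgA : ∀ y ∈ A.names, g y = f y := fun y hy =>
    Function.extend_apply' _ _ _ (by rintro ⟨t, rfl⟩; exact hfresh t hy)
  refine ⟨K, hK, g, fun s hs => ?_⟩
  rcases mem_addSuccs.1 hs with hs | ⟨i, j, k, hk, rfl⟩ | ⟨i, rfl⟩ | ⟨i, j, hij, rfl⟩ |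
    ⟨y, hy, i, rfl⟩
  · exact (hA s hs).congr fun y hy => hgA y (Finset.mem_biUnion.2 ⟨s, hs, hy⟩)
  · have h1 : g (if k = 0 then x else fresh (i, j + 1, k - 1)) = w i j k := by
      split_ifs with h0
      · rw [hgA x (mem_names_of_conc hmem), h0, hw0]
      · rw [hg, hv1, Nat.sub_add_cancel (Nat.pos_of_ne_zero h0)]
    have h2 : g (if k + 1 = ((K i).get j).length then fresh (i, 0, 0) else fresh (i, j + 1, k)) =
        w i j (k + 1) := by
      split_ifs with h0
      · rw [hg, hv0, h0, hw1]
      · rw [hg, hv1]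
    rw [Interpretation.Holds, h1, h2]
    exact hw i j k hk
  · rw [Interpretation.Holds, hg, hv0]
    exact (hdZ i).1.2
  · rw [Interpretation.Holds, hg, hg, hv0, hv0]
    exact hdinj.ne hij.ne
  · rw [Interpretation.Holds, hgA y (mem_names_of_conc (hY.1 y hy).2), hg, hv0]
    exact fun e => (hdZ i).2 ⟨y, hy, e⟩

/-- If the ABox is satisfiable, then so is some result of each applicable instance of a rule. -/
theorem Rule.exists_holds {S : Set ABox} (h : A.Rule S) (hA : ∀ s ∈ A, I.Holds f s) :
    ∃ B ∈ S, ∃ g : ℕ → I.Dom, ∀ s ∈ B, I.Holds g s := by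
  cases h with
  | and C D x hmem _ =>
    refine ⟨_, rfl, f, fun s hs => ?_⟩
    simp only [Finset.mem_union, Finset.mem_insert, Finset.mem_singleton] at hs
    rcases hs with hs | rfl | rfl
    · exact hA s hs
    · exact (hA _ hmem : f x ∈ _ ∩ _).1
    · exact (hA _ hmem : f x ∈ _ ∩ _).2
  | or C D x hmem _ _ =>
    rcases (hA _ hmem : f x ∈ I.ext C ∪ I.ext D) with h | h
    · refine ⟨_, Or.inl rfl, f, fun s hs => ?_⟩
      rcases Finset.mem_union.1 hs with hs | hs
      · exact hA s hs
      · rw [Finset.mem_singleton.1 hs]; exact h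
    · refine ⟨_, Or.inr rfl, f, fun s hs => ?_⟩
      rcases Finset.mem_union.1 hs with hs | hs
      · exact hA s hs
      · rw [Finset.mem_singleton.1 hs]; exact h
  | atLeast n R C x hmem Y hY _ _ fresh hinj hfresh =>
    obtain ⟨K, hK, g, hg⟩ := exists_holds_addSuccs hA hmem hY hinj hfresh
    exact ⟨_, ⟨K, hK, rfl⟩, g, hg⟩
  | atMost n R C x hmem p hp y hinj hy _ =>
    -- more than `n` individuals denote at most `n` elements, so two of them denote the same one
    have hle : Set.encard {d | I.roleExt R (f x) d ∧ d ∈ I.ext C} ≤ (n : ℕ∞) := hA _ hmem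
    have hsub : Set.range (fun i => f (y i)) ⊆ {d | I.roleExt R (f x) d ∧ d ∈ I.ext C} := by
      rintro _ ⟨i, rfl⟩
      exact ⟨Interpretation.roleExt_of_succ hA (hy i).1, hA _ (hy i).2⟩
    have hnot : ¬ Function.Injective fun i => f (y i) := fun hinj' => by
      have h1 := (Set.encard_le_encard hsub).trans hle
      rw [← Set.image_univ, hinj'.encard_image, Set.encard_univ, ENat.card_eq_coe_fintype_card,
        Fintype.card_fin] at h1
      exact absurd (Nat.cast_le.1 h1) (not_le.2 hp)
    have hex : ∃ i j, i < j ∧ f (y i) = f (y j) := by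
      simp only [Function.Injective, not_forall] at hnot
      obtain ⟨i, j, e, hne⟩ := hnot
      rcases lt_or_gt_of_ne hne with h | h
      · exact ⟨i, j, h, e⟩
      · exact ⟨j, i, h, e.symm⟩
    obtain ⟨i, j, hij, e⟩ := hex
    refine ⟨_, ⟨i, j, hij, fun h => Interpretation.ne_of_diff hA h e, rfl⟩, f, fun s hs => ?_⟩
    obtain ⟨s, hsA, rfl⟩ := Finset.mem_image.1 hs
    have hf : ∀ z, f (if z = y i then y j else z) = f z := fun z => by
      split_ifs with hz
      · rw [hz, e]
      · rfl
    have := hA s hsA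
    cases s <;> simpa only [Assertion.rename, Interpretation.Holds, hf] using this
  | choose n R C x y _ _ _ _ =>
    by_cases h : f y ∈ I.ext C
    · refine ⟨_, Or.inl rfl, f, fun s hs => ?_⟩
      rcases Finset.mem_union.1 hs with hs | hs
      · exact hA s hs
      · rw [Finset.mem_singleton.1 hs]; exact h
    · refine ⟨_, Or.inr rfl, f, fun s hs => ?_⟩
      rcases Finset.mem_union.1 hs with hs | hs
      · exact hA s hs
      · rw [Finset.mem_singleton.1 hs, Interpretation.Holds, I.ext_sim]; exact h

/-- The canonical interpretation of an ABox: its elements are the individual names, and atomic concepts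
and roles hold exactly where they are asserted. -/
def canonical (A : ABox) : Interpretation.{u} where
  Dom := ULift ℕ
  nonempty := ⟨⟨0⟩⟩
  conc a := {x | Assertion.conc (.atom a) x.down ∈ A}
  role R x y := Assertion.role R x.down y.down ∈ A

theorem canonical_chainExt {ρ : Chain} {x y : ULift.{u} ℕ} :
    (canonical.{u} A).chainExt ρ x y ↔ A.ChainSucc ρ x.down y.down := by
  induction ρ generalizing x with
  | nil => exact ⟨fun h => congrArg _ h, fun h => ULift.ext _ _ h⟩
  | cons R ρ ih =>
    constructor
    · rintro ⟨z, hz, h⟩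
      exact ⟨z.down, hz, ih.1 h⟩
    · rintro ⟨z, hz, h⟩
      exact ⟨⟨z⟩, hz, ih.2 h⟩

theorem canonical_roleExt {R : RoleExpr} {x y : ULift.{u} ℕ} :
    (canonical.{u} A).roleExt R x y ↔ A.Succ R x.down y.down := by
  simp only [Interpretation.roleExt, Succ, canonical_chainExt]

theorem DistinctSuccs.subset_names {R : RoleExpr} {C : Concept} {x : ℕ} {Y : Finset ℕ}
    (h : A.DistinctSuccs R C x Y) : Y ⊆ A.names :=
  fun y hy => mem_names_of_conc (h.1 y hy).2

theorem exists_largest (A : ABox) (R : RoleExpr) (C : Concept) (x : ℕ) :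
    ∃ Y, A.DistinctSuccs R C x Y ∧ ∀ Y', A.DistinctSuccs R C x Y' → Y'.card ≤ Y.card := by
  classical
  obtain ⟨Y, hY, hmax⟩ := (A.names.powerset.filter (A.DistinctSuccs R C x)).exists_max_image
    Finset.card ⟨∅, by simp [DistinctSuccs]⟩
  rw [Finset.mem_filter] at hY
  exact ⟨Y, hY.2, fun Y' hY' => hmax Y' (Finset.mem_filter.2
    ⟨Finset.mem_powerset.2 hY'.subset_names, hY'⟩)⟩

theorem exists_fresh (A : ABox) :
    ∃ fresh : ℕ × ℕ × ℕ → ℕ, Function.Injective fresh ∧ ∀ t, fresh t ∉ A.names := by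
  refine ⟨ListABox.fresh (ListABox.bound A.toList), ListABox.fresh_injective _, fun t => ?_⟩
  simpa using ListABox.fresh_notMem (L := A.toList) t

theorem ext_canonical (hc : A.Complete) (hcl : ¬ A.Clash)
    (hnnf : ∀ C x, Assertion.conc C x ∈ A → C.IsNNF) {C : Concept} {x : ℕ}
    (h : Assertion.conc C x ∈ A) : (⟨x⟩ : ULift.{u} ℕ) ∈ (canonical.{u} A).ext C := by
  classical
  rw [Clash, not_or, not_or] at hcl
  obtain ⟨hbot, hatom, hmost⟩ := hcl
  induction hN : C.height using Nat.strong_induction_on generalizing C x with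
  | _ N ih =>
    subst hN
    cases C with
    | top => trivial
    | bot => exact absurd ⟨x, h⟩ hbot
    | atom a => exact h
    | neg C =>
      cases C with
      | atom a => exact fun h' => hatom ⟨a, x, h', h⟩
      | _ => exact (hnnf _ _ h).elim
    | all R C => exact (hnnf _ _ h).elim
    | ex R C => exact (hnnf _ _ h).elim
    | and C D =>
      have hm : Assertion.conc C x ∈ A ∧ Assertion.conc D x ∈ A := by
        by_contra hnot
        exact hc _ (Rule.and C D x h hnot)
      exact ⟨ih _ (by simp only [Concept.height]; omega) hm.1 rfl,
        ih _ (by simp only [Concept.height]; omega) hm.2 rfl⟩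
    | or C D =>
      by_cases hC : Assertion.conc C x ∈ A
      · exact Or.inl (ih _ (by simp only [Concept.height]; omega) hC rfl)
      by_cases hD : Assertion.conc D x ∈ A
      · exact Or.inr (ih _ (by simp only [Concept.height]; omega) hD rfl)
      exact absurd (Rule.or C D x h hC hD) (hc _)
    | atLeast n R C =>
      obtain ⟨Y, hY, hmax⟩ := exists_largest A R C x
      have hn : n ≤ Y.card := by
        by_contra hlt
        obtain ⟨fresh, hinj, hfresh⟩ := exists_fresh A
        exact hc _ (Rule.atLeast n R C x h Y hY hmax (not_le.1 hlt) fresh hinj hfresh)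
      have hsub : ULift.up.{u} '' (Y : Set ℕ) ⊆
          {y | (canonical.{u} A).roleExt R ⟨x⟩ y ∧ y ∈ (canonical.{u} A).ext C} := by
        rintro _ ⟨y, hy, rfl⟩
        exact ⟨canonical_roleExt.2 (hY.1 y hy).1,
          ih _ (by simp only [Concept.height]; omega) (hY.1 y hy).2 rfl⟩
      have h1 := Set.encard_le_encard hsub
      rw [ULift.up_injective.encard_image, Set.encard_coe_eq_coe_finsetCard] at h1
      exact (Nat.cast_le.2 hn).trans h1
    | atMost n R C =>
      -- by the choice rule, an asserted successor outside `C(y)` has `∼C(y)`, so it is not in `C`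
      have hsub : {y | (canonical.{u} A).roleExt R ⟨x⟩ y ∧ y ∈ (canonical.{u} A).ext C} ⊆
          ULift.up.{u} '' (↑(A.names.filter fun y => A.Succ R x y ∧ Assertion.conc C y ∈ A) :
            Set ℕ) := by
        rintro ⟨y⟩ ⟨hs, hy⟩
        have hs' := canonical_roleExt.1 hs
        have hC : Assertion.conc C y ∈ A := by
          by_contra hC
          by_cases hC' : Assertion.conc C.sim y ∈ A
          · have := ih _ (by
              have := C.height_nnf_le false
              simp only [Concept.height, Concept.sim]; omega) hC' rfl
            rw [Interpretation.ext_sim] at this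
            exact this hy
          · exact hc _ (Rule.choose n R C x y (Or.inr h) hs' hC hC')
        exact ⟨y, by simpa using ⟨mem_names_of_conc hC, hs', hC⟩, rfl⟩
      refine (Set.encard_le_encard hsub).trans ((ULift.up_injective.encard_image _).trans_le ?_)
      rw [Set.encard_coe_eq_coe_finsetCard, Nat.cast_le]
      set Y := A.names.filter fun y => A.Succ R x y ∧ Assertion.conc C y ∈ A with hY
      by_contra hlt
      rw [not_le] at hlt
      have hmem : ∀ y ∈ Y, A.Succ R x y ∧ Assertion.conc C y ∈ A := fun y hy =>
        (Finset.mem_filter.1 hy).2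
      by_cases hpair : ∃ i j : Fin Y.card, i < j ∧
          ¬ A.Diff (Y.equivFin.symm i) (Y.equivFin.symm j)
      · exact hc _ (Rule.atMost n R C x h Y.card hlt (fun i => (Y.equivFin.symm i : ℕ))
          (Subtype.val_injective.comp Y.equivFin.symm.injective)
          (fun i => hmem _ (Y.equivFin.symm i).2) hpair)
      · push Not at hpair
        refine hmost ⟨n, R, C, x, Y, h, ⟨hmem, fun y hy y' hy' hne => ?_⟩, hlt⟩
        have hij : Y.equivFin ⟨y, hy⟩ ≠ Y.equivFin ⟨y', hy'⟩ := fun e =>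
          hne (congrArg Subtype.val (Y.equivFin.injective e))
        rcases lt_or_gt_of_ne hij with hlt' | hlt'
        · simpa using hpair _ _ hlt'
        · exact (by simpa using hpair _ _ hlt' : A.Diff y' y).symm

end ABox

theorem satisfiable_iff_nnf (C : Concept) :
    Satisfiable.{u} C ↔ ∃ (I : Interpretation.{u}) (f : ℕ → I.Dom),
      ∀ s ∈ initial C, I.Holds f s := by
  constructor
  · rintro ⟨I, d, hd⟩
    refine ⟨I, fun _ => d, fun s hs => ?_⟩
    rw [initial, Finset.mem_singleton] at hs
    rw [hs, Interpretation.Holds, (I.ext_nnf C).1]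
    exact hd
  · rintro ⟨I, f, h⟩
    have := h _ (Finset.mem_singleton_self _)
    rw [Interpretation.Holds, (I.ext_nnf C).1] at this
    exact ⟨I, _, this⟩

/-- A complete and clash-free ABox that the algorithm reaches has a model, in which the input
concept is not empty. -/
theorem Reach.satisfiable {C : Concept} (hC : C.WF) {A : ABox} {N : ℕ} (h : Reach C A N)
    (hc : A.Complete) (hcl : ¬ A.Clash) : Satisfiable.{u} C := by
  obtain ⟨⟨lev, hl, -⟩, x, hx⟩ := h
  have := ABox.ext_canonical.{u} hc hcl
    (fun E y hy => (closed_concepts hC E (hl.conc E y hy).1).1) hx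
  rw [((ABox.canonical.{u} A).ext_nnf C).1] at this
  exact ⟨_, _, this⟩

theorem satisfiable_iff_accepts {σ : ABox → Set ABox} (hσ : IsStrategy σ) {C : Concept}
    (hC : C.WF) : Satisfiable.{u} C ↔ Accepts σ C := by
  constructor
  · rw [satisfiable_iff_nnf]
    rintro ⟨I, f, hf⟩
    have key : ∀ (N : ℕ) (A : ABox), Reach C A N →
        (∃ f : ℕ → I.Dom, ∀ s ∈ A, I.Holds f s) →
        ∃ B : ABox, Relation.ReflTransGen (fun A A' : ABox => ¬ A.Complete ∧ A' ∈ σ A) A B ∧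
          B.Complete ∧ ¬ B.Clash := by
      intro N
      induction N using Nat.strong_induction_on with
      | _ N ih =>
        rintro A hA ⟨f, hf⟩
        by_cases hc : A.Complete
        · exact ⟨A, .refl, hc, ABox.not_clash_of_holds hf⟩
        · obtain ⟨B, hB, hg⟩ := (hσ A hc).exists_holds hf
          obtain ⟨M, hM, hR⟩ := hA.step hC ⟨σ A, hσ A hc, hB⟩
          obtain ⟨B', h1, h2⟩ := ih M hM B hR hg
          exact ⟨B', .head ⟨hc, hB⟩ h1, h2⟩
    obtain ⟨N, hN⟩ := exists_reach_initial C
    exact key N _ hN ⟨f, hf⟩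
  · rintro ⟨B, hB, hc, hcl⟩
    have key : ∃ N, Reach C B N := by
      clear hc hcl
      induction hB with
      | refl => exact exists_reach_initial C
      | tail _ hs ih =>
        obtain ⟨N, hN⟩ := ih
        obtain ⟨M, -, hM⟩ := hN.step hC ⟨_, hσ _ hs.1, hs.2⟩
        exact ⟨M, hM⟩
    obtain ⟨N, hN⟩ := key
    exact hN.satisfiable hC hc hcl

theorem subsumes_iff (C D : Concept) :
    Subsumes.{u} D C ↔ ¬ Satisfiable.{u} (.and C (.neg D)) := by
  simp only [Subsumes, Satisfiable, Interpretation.ext, not_exists, Set.not_nonempty_iff_eq_empty,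
    ← Set.sdiff_eq, Set.sdiff_eq_empty]

/-! ### Decidability -/

/-- The results after `k` rounds, in each of which the rule that `ListABox.next` selects is applied
to all the ABoxes that are not complete, with all its possible results. -/
def frontier (C : Concept) (k : ℕ) : List (List Assertion) :=
  Nat.rec (motive := fun _ => List (List Assertion)) [[Assertion.conc (C.nnf true) 0]]
    (fun _ t => t.flatMap fun L => (ListABox.next L).getD [L]) k

theorem primrec_frontier : Primrec fun p : Concept × ℕ => frontier p.1 p.2 := by
  have h := ListABox.primrec_next
  unfold frontier
  fun_prop

theorem frontier_succ (C : Concept) (k : ℕ) : frontier C (k + 1) =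
    (frontier C k).flatMap fun L => (ListABox.next L).getD [L] := rfl

/-- After `k` rounds, an ABox is complete, or its potential has been decreased `k` times. -/
theorem reach_of_mem_frontier {C : Concept} (hC : C.WF) {N : ℕ} (hN : Reach C (initial C) N)
    {k : ℕ} {L : List Assertion} (hL : L ∈ frontier C k) :
    ∃ M, Reach C L.toFinset M ∧ (ListABox.next L = none ∨ M + k ≤ N) := by
  induction k generalizing L with
  | zero =>
    have e : frontier C 0 = [[Assertion.conc (C.nnf true) 0]] := rfl
    rw [e, List.mem_singleton] at hL
    subst hL
    exact ⟨N, hN, Or.inr le_rfl⟩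
  | succ k ih =>
    rw [frontier_succ, List.mem_flatMap] at hL
    obtain ⟨L', hL', h⟩ := hL
    obtain ⟨M, hM, hk⟩ := ih hL'
    cases hn : ListABox.next L' with
    | none =>
      rw [hn, Option.getD_none, List.mem_singleton] at h
      subst h
      exact ⟨M, hM, Or.inl hn⟩
    | some Bs =>
      rw [hn, Option.getD_some] at h
      obtain ⟨M', hlt, hM'⟩ := hM.step hC ⟨_, ListABox.rule_of_next hn, L, h, rfl⟩
      refine ⟨M', hM', Or.inr ?_⟩
      have := hk.resolve_left (by simp [hn])
      omega

theorem exists_frontier_complete {C : Concept} (hC : C.WF) :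
    ∃ k, ∀ L ∈ frontier C k, ListABox.next L = none := by
  obtain ⟨N, hN⟩ := exists_reach_initial C
  refine ⟨N + 1, fun L hL => ?_⟩
  obtain ⟨M, -, h | h⟩ := reach_of_mem_frontier hC hN hL
  · exact h
  · omega

theorem exists_holds_frontier {C : Concept} {I : Interpretation.{u}} {f : ℕ → I.Dom}
    (hf : ∀ s ∈ initial C, I.Holds f s) (k : ℕ) :
    ∃ L ∈ frontier C k, ∃ g : ℕ → I.Dom, ∀ s ∈ L.toFinset, I.Holds g s := by
  induction k with
  | zero => exact ⟨_, List.mem_singleton_self _, f, hf⟩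
  | succ k ih =>
    obtain ⟨L, hL, g, hg⟩ := ih
    simp only [frontier_succ, List.mem_flatMap]
    cases hn : ListABox.next L with
    | none => exact ⟨L, ⟨L, hL, by simp [hn]⟩, g, hg⟩
    | some Bs =>
      obtain ⟨B, ⟨L', hL', rfl⟩, hB⟩ := (ListABox.rule_of_next hn).exists_holds hg
      exact ⟨L', ⟨L, hL, by simpa [hn] using hL'⟩, hB⟩

theorem satisfiable_iff_frontier {C : Concept} (hC : C.WF) {k : ℕ}
    (hk : ∀ L ∈ frontier C k, ListABox.next L = none) :
    Satisfiable.{u} C ↔ ∃ L ∈ frontier C k, ListABox.clash L = false := by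
  constructor
  · rw [satisfiable_iff_nnf]
    rintro ⟨I, f, hf⟩
    obtain ⟨L, hL, g, hg⟩ := exists_holds_frontier hf k
    refine ⟨L, hL, ?_⟩
    rw [← Bool.not_eq_true, ListABox.clash_iff]
    exact ABox.not_clash_of_holds hg
  · rintro ⟨L, hL, hcl⟩
    obtain ⟨N, hN⟩ := exists_reach_initial C
    obtain ⟨M, hM, -⟩ := reach_of_mem_frontier hC hN hL
    obtain ⟨⟨lev, hl, -⟩, -⟩ := id hM
    refine hM.satisfiable hC ((ListABox.next_eq_none_iff fun E x hE => ?_).1 (hk L hL)) ?_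
    · exact (closed_concepts hC E (hl.conc E x (List.mem_toFinset.2 hE)).1).2.1
    · rw [← ListABox.clash_iff, hcl]
      exact Bool.false_ne_true

/-- All the ABoxes of round `k` are complete, or `C` does not belong to the language, so that nothing
has to be computed. -/
def settled (C : Concept) (k : ℕ) : Bool :=
  !C.wf || (frontier C k).all fun L => decide (ListABox.next L = none)

/-- `C` belongs to the language, and some ABox of round `k` has no clash. -/
def answer (C : Concept) (k : ℕ) : Bool :=
  C.wf && (frontier C k).any fun L => !ListABox.clash L

theorem exists_settled (C : Concept) : ∃ k, settled C k = true := by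
  by_cases hC : C.WF
  · obtain ⟨k, hk⟩ := exists_frontier_complete hC
    exact ⟨k, by simpa [settled] using Or.inr hk⟩
  · have : C.wf = false := by rwa [← Bool.not_eq_true, C.wf_iff]
    exact ⟨0, by simp [settled, this]⟩

theorem answer_iff {C : Concept} {k : ℕ} (hk : settled C k = true) :
    answer C k = true ↔ C.WF ∧ Satisfiable.{u} C := by
  simp only [answer, Bool.and_eq_true, C.wf_iff]
  refine and_congr_right fun hC => ?_
  rw [← C.wf_iff] at hC
  simp only [settled, hC, Bool.not_true, Bool.false_or, List.all_eq_true,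
    decide_eq_true_eq] at hk
  rw [satisfiable_iff_frontier (C.wf_iff.1 hC) hk]
  simp

theorem computablePred_satisfiable :
    ComputablePred fun C : Concept => C.WF ∧ Satisfiable.{u} C := by
  classical
  have hw := Concept.primrec_wf
  have hfr := primrec_frontier
  have hnx := ListABox.primrec_next
  have h1 : Primrec fun p : Concept × ℕ => settled p.1 p.2 := by
    unfold settled; fun_prop
  have h2 : Primrec fun p : Concept × ℕ => answer p.1 p.2 := by
    unfold answer; fun_prop
  have hfind : Computable fun C => Nat.find (exists_settled C) := by
    refine Partrec.of_eq_tot (Partrec.rfind (p := fun C k => Part.some (settled C k))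
      (show Partrec _ from h1.to_comp)) fun C => ?_
    refine Nat.mem_rfind.2 ⟨?_, fun {m} hm => ?_⟩
    · simpa using (Nat.find_spec (exists_settled C)).symm
    · simpa using (Nat.find_min (exists_settled C) hm)
  refine ⟨inferInstance, (h2.to_comp.comp (Computable.id.pair hfind)).of_eq fun C => ?_⟩
  rw [Bool.eq_iff_iff, decide_eq_true_iff]
  exact answer_iff (Nat.find_spec (exists_settled C))

theorem computablePred_subsumes : ComputablePred fun P : Concept × Concept =>
    P.1.WF ∧ P.2.WF ∧ Subsumes.{u} P.2 P.1 := by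
  classical
  obtain ⟨f, hf, hfs⟩ : ∃ f : Concept → Bool, Computable f ∧
      ∀ C, f C = true ↔ C.WF ∧ Satisfiable.{u} C := by
    obtain ⟨hd, hs⟩ := computablePred_satisfiable.{u}
    exact ⟨_, hs, fun C => decide_eq_true_iff⟩
  have hw := Concept.primrec_wf
  have h1 : Computable fun P : Concept × Concept => f (.and P.1 (.neg P.2)) :=
    hf.comp (Primrec.to_comp (by fun_prop))
  have h2 : Computable fun P : Concept × Concept => P.1.wf && P.2.wf :=
    Primrec.to_comp (by fun_prop)
  refine ⟨inferInstance,
    (Primrec.and.to_comp.comp h2 (Primrec.not.to_comp.comp h1)).of_eq fun P => ?_⟩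
  rw [Bool.eq_iff_iff, decide_eq_true_iff]
  change _ ↔ P.1.WF ∧ P.2.WF ∧ Subsumes.{u} P.2 P.1
  rw [subsumes_iff, Bool.and_eq_true, Bool.and_eq_true, Concept.wf_iff, Concept.wf_iff,
    Bool.not_eq_true', ← Bool.not_eq_true, hfs]
  simp only [Concept.WF]
  tauto

end DL

theorem mainTheorem4 :
    -- satisfiability and subsumption are decidable
    (ComputablePred fun C : DL.Concept => C.WF ∧ DL.Satisfiable.{u} C) ∧
    (ComputablePred fun P : DL.Concept × DL.Concept =>
      P.1.WF ∧ P.2.WF ∧ DL.Subsumes.{u} P.2 P.1) ∧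
    -- the tableau algorithm is an effective decision procedure for both
    DL.EffectiveSteps ∧
    (∀ C : DL.Concept, C.WF → DL.Terminates C) ∧
    (∀ σ : DL.ABox → Set DL.ABox, DL.IsStrategy σ →
      (∀ C : DL.Concept, C.WF → (DL.Satisfiable.{u} C ↔ DL.Accepts σ C)) ∧
      (∀ C D : DL.Concept, C.WF → D.WF →
        (DL.Subsumes.{u} D C ↔ ¬ DL.Accepts σ (.and C (.neg D))))) := by
  refine ⟨DL.computablePred_satisfiable, DL.computablePred_subsumes, DL.effectiveSteps,
    fun C => DL.terminates, fun σ hσ => ⟨fun C => DL.satisfiable_iff_accepts hσ,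
      fun C D hC hD => ?_⟩⟩
  have hCD : (DL.Concept.and C (.neg D)).WF := ⟨hC, hD⟩
  rw [DL.subsumes_iff, DL.satisfiable_iff_accepts hσ hCD]
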